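/- **Setting.** For $v\in\mathbb R^2$ let $v^\perp=(v_2,-v_1)$. Let $0<\alpha<1$, $k=\lceil 2\alpha\rceil$, $2\alpha-\lceil 2\alpha\rceil+1\le\gamma\le 1$, $T>0$, $\theta_1,\dots,\theta_N\in\mathbb R$. *Patch solutions.* For $t\in[0,T)$ let $\Omega_1(t),\dots,\Omega_N(t)\subset\mathbb R^2$ be bounded open sets whose boundaries are pairwise disjoint simple closed $C^1$ curves, with arc length parametrizations $x_i(\cdot,t)$ (periodic, with period the length of $\partial\Omega_i(t)$). Put $\omega(\cdot,t)=\sum_i\theta_i\chi_{\Omega_i(t)}$, $\partial\Omega(t)=\bigcup_i\partial\Omega_i(t)$ and $$\|\partial\Omega(t)\|_{C^{k,\gamma}}=\max_i\Big(\sum_{l=0}^k\|\partial_s^lx_i\|_\infty+\sup_{s\ne r}\frac{|\partial_s^kx_i(s)-\partial_s^kx_i(r)|}{|s-r|^\gamma}\Big).$$ This is a $C^{k,\gamma}$ patch solution of $\alpha$-SQG on $[0,T)$ if (1) each $\partial\Omega_i(t)$ is continuous in $t$ for the Hausdorff distance $d_H$; (2) for every $t\in[0,T)$ the normal velocity $u_n=(u\cdot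 n)n$, where $u\cdot n(z)=\mathrm{P.V.}\int\frac{(z-y)^\perp\cdot n(z)}{|z-y|^{2+2\alpha}}\,\omega(y,t)\,dy$ and $n$ is the unit normal, exists on $\partial\Omega(t)$, and $d_H\big(\partial\Omega(t+h),\{z+hu_n(z):z\in\partial\Omega(t)\}\big)=o(h)$ as $h\to0+$; (3) the $x_i(\cdot,t)$ are $C^k$ and $\|\partial\Omega(t)\|_{C^{k,\gamma}}$ is bounded on every $[0,T']$ with $T'<T$. *Splash.* The solution forms a splash singularity at time $T$ if there are $x_0\in\mathbb R^2$, $\rho>0$ and $\varepsilon\in(0,T]$ such that on $[T-\varepsilon,T)$: * (a) $\partial\Omega(t)\cap B_\rho(x_0)$ is the union of two disjoint branches $\mathcal C_1(t)$, $\mathcal C_2(t)$, each of which is an open arc of one of the curves $\partial\Omega_i(t)$, or a whole such curve. Each branch is simple in the following quantitative sense: for some $c>0$ independent of $t$, any two points $x_i(s,t),x_i(r,t)$ of the same branch satisfy $|x_i(s,t)-x_i(r,t)|\ge c\min\{|s-r|_*,\ \|\partial\Omega(t)\|_{C^{k,\gamma}}^{-1/(k+\gamma-1)}\}$, where $|s-r|_*$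 is their distance along the closed curve (this holds in particular if the arc-chord ratios of the branches are bounded below uniformly in $t$). * (b) $\mathcal C_1,\mathcal C_2$ touch exactly at $x_0$: $\mathrm{dist}(x_0,\mathcal C_j(t))\to0$ as $t\to T^-$ for $j=1,2$, and for each $\sigma>0$ there is $c_\sigma>0$ such that, for all $t$, any $p\in\mathcal C_1(t)$, $q\in\mathcal C_2(t)$ with $|p-q|<c_\sigma$ lie in $B_\sigma(x_0)$. * (c) Outside $B_\rho(x_0)$, uniformly in $t$, the $C^{k,\gamma}$ norms of the boundary curves are bounded, different boundary curves have a positive distance, and $|x_i(s,t)-x_i(r,t)|\ge c|s-r|_*$ for some $c>0$. * (d) The possible loss of regularity is localized at $x_0$: for every $\sigma>0$ the $C^{k,\gamma}$ norms of the boundary curves outside $B_\sigma(x_0)$ are bounded uniformly in $t$. **Theorem.** If a $C^{k,\gamma}$ patch solution of $\alpha$-SQG on $[0,T)$ forms a splash singularity at time $T$, then $$\int_0^T\|\partial\Omega(t)\|_{C^{k,\gamma}}^{\frac{k+2\alpha-1}{k+\gamma-1}}\,dt=\infty.$$ In particular, if $\alpha\le\frac12$, then $\int_0^T\kappa(t)\,dt=\infty$,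 where $\kappa(t)\in[0,\infty]$ is the maximal curvature of $\partial\Omega(t)$ (the best Lipschitz constant of the unit tangents $\partial_sx_i(\cdot,t)$); and if $\alpha=\frac12$, then $\int_0^T\|\partial\Omega(t)\|_{C^{1,1}}\,dt=\infty$. -/

import Mathlib

open Set Filter Topology MeasureTheory
open scoped ENNReal NNReal

namespace SQGPatch

/-- The Euclidean plane `ℝ²`. -/
abbrev Plane : Type := EuclideanSpace ℝ (Fin 2)

/-- The rotated vector `v^⊥ = (v₂, -v₁)`. -/
noncomputable def perp (v : Plane) : Plane := !₂[v 1, -(v 0)]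

/-! ### Closed curves and their Hölder norms -/

/-- `Γ` is a simple closed `C¹` curve of length `L`, and `x : ℝ → ℝ²` is an arc length
parametrization of it, extended periodically to the whole line. -/
structure IsArcLengthParam (Γ : Set Plane) (L : ℝ) (x : ℝ → Plane) : Prop where
  length_pos : 0 < L
  contDiff : ContDiff ℝ 1 x
  unit_speed : ∀ s, ‖deriv x s‖ = 1
  periodic : Function.Periodic x L
  injOn : InjOn x (Ico 0 L)
  range_eq : range x = Γ

/-- Distance of the parameters `s` and `r` along a closed curve of length `L`, i.e. the distance of
`s - r` to the nearest integer multiple of `L`. -/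
noncomputable def arcDist (L s r : ℝ) : ℝ := ‖((s - r : ℝ) : AddCircle L)‖

/-- The norm `∑_{l ≤ k} ‖∂ˡx‖_∞ + sup_{s,r} |∂ᵏx(s) - ∂ᵏx(r)| / |s - r|^γ`, with values in `[0,∞]`
(the term `s = r` contributes `0 / 0 = 0`). -/
noncomputable def holderNorm (k : ℕ) (γ : ℝ) (x : ℝ → Plane) : ℝ≥0∞ :=
  (∑ l ∈ Finset.range (k + 1), ⨆ s, ‖iteratedDeriv l x s‖ₑ) +
    ⨆ s, ⨆ r, ‖iteratedDeriv k x s - iteratedDeriv k x r‖ₑ / ENNReal.ofReal (|s - r| ^ γ)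

/-- The maximal curvature of a curve in arc length parametrization, with values in `[0,∞]`: the best
Lipschitz constant of the unit tangent (for a `C²` curve this is `sup |x''|`). -/
noncomputable def maxCurvature (x : ℝ → Plane) : ℝ≥0∞ :=
  ⨆ s, ⨆ r, ‖deriv x s - deriv x r‖ₑ / ENNReal.ofReal |s - r|

/-! ### Patch solutions -/

/-- `ω(·,t) = ∑ᵢ θᵢ χ_{Ωᵢ(t)}`. -/
noncomputable def vorticity {N : ℕ} (θ : Fin N → ℝ) (Ω : Fin N → ℝ → Set Plane) (t : ℝ) :
    Plane → ℝ :=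
  fun y => ∑ i, (Ω i t).indicator (fun _ => θ i) y

/-- `∂Ω(t) = ⋃ᵢ ∂Ωᵢ(t)`. -/
def interface {N : ℕ} (Ω : Fin N → ℝ → Set Plane) (t : ℝ) : Set Plane :=
  ⋃ i, frontier (Ω i t)

/-- `‖∂Ω(t)‖_{C^{k,γ}}`, the maximum over the patches of the norms of their boundary curves, where
`x i t` is the arc length parametrization of `∂Ωᵢ(t)`. -/
noncomputable def interfaceNorm {N : ℕ} (k : ℕ) (γ : ℝ) (x : Fin N → ℝ → ℝ → Plane) (t : ℝ) :
    ℝ≥0∞ :=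
  ⨆ i, holderNorm k γ (x i t)

/-- The component in direction `n` of the velocity
`P.V. ∫ (z - y)^⊥ / |z - y|^{2+2α} ω(y) dy` at `z`, truncated to `|z - y| > ε`; the inner product
with `n` is taken before integrating. -/
noncomputable def truncatedVelocity (α : ℝ) (ω : Plane → ℝ) (z n : Plane) (ε : ℝ) : ℝ :=
  ∫ y in {y : Plane | ε < ‖z - y‖}, inner ℝ (perp (z - y)) n / ‖z - y‖ ^ (2 + 2 * α) * ω y

/-- `v = (u · n) n`, where `u · n` is the principal value integral at the point `z`. -/
def IsNormalVelocity (α : ℝ) (ω : Plane → ℝ) (z n v : Plane) : Prop :=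
  ∃ w : ℝ, Tendsto (truncatedVelocity α ω z n) (𝓝[>] 0) (𝓝 w) ∧ v = w • n

/-- `C^{k,γ}` patch solutions of the `α`-SQG equation on `[0,T)`. Here `Ω i t` is the `i`-th patch
at time `t`, and `L i t`, `x i t` are the length and an arc length parametrization of its boundary.
-/
structure IsPatchSolution (α : ℝ) (k : ℕ) (γ T : ℝ) {N : ℕ} (θ : Fin N → ℝ)
    (Ω : Fin N → ℝ → Set Plane) (L : Fin N → ℝ → ℝ) (x : Fin N → ℝ → ℝ → Plane) : Prop where
  isOpen : ∀ i, ∀ t ∈ Ico 0 T, IsOpen (Ω i t)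
  isBounded : ∀ i, ∀ t ∈ Ico 0 T, Bornology.IsBounded (Ω i t)
  /-- the boundaries are simple closed curves -/
  param : ∀ i, ∀ t ∈ Ico 0 T, IsArcLengthParam (frontier (Ω i t)) (L i t) (x i t)
  /-- the boundaries are pairwise disjoint -/
  disjoint : ∀ t ∈ Ico 0 T, ∀ i j, i ≠ j → Disjoint (frontier (Ω i t)) (frontier (Ω j t))
  /-- each boundary is continuous in time with respect to the Hausdorff distance -/
  continuous : ∀ i, ∀ t ∈ Ico 0 T,
    Tendsto (fun t' => Metric.hausdorffEDist (frontier (Ω i t')) (frontier (Ω i t)))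
      (𝓝[Ico 0 T] t) (𝓝 0)
  /-- the interface moves with the normal velocity `V`:
  `d_H (∂Ω(t+h), {z + h V(z) : z ∈ ∂Ω(t)}) = o(h)` as `h → 0+` -/
  transport : ∀ t ∈ Ico 0 T, ∃ V : Plane → Plane,
    (∀ i s, IsNormalVelocity α (vorticity θ Ω t) (x i t s) (perp (deriv (x i t) s))
      (V (x i t s))) ∧
    Tendsto (fun h : ℝ => Metric.hausdorffEDist (interface Ω (t + h))
      ((fun z => z + h • V z) '' interface Ω t) / ENNReal.ofReal h) (𝓝[>] 0) (𝓝 0)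
  /-- the boundaries are of class `C^k` ... -/
  contDiff : ∀ i, ∀ t ∈ Ico 0 T, ContDiff ℝ k (x i t)
  /-- ... with `C^{k,γ}` norms bounded on every compact time interval in `[0,T)` -/
  locally_bounded : ∀ T' < T, ∃ M : ℝ≥0, ∀ t ∈ Icc 0 T', interfaceNorm k γ x t ≤ M

/-! ### Splash singularities -/

/-- On the time set `I`, the parts of the boundary curves outside the set `B` have `C^{k,γ}` norms
bounded uniformly in time. -/
def BoundedOutside {N : ℕ} (k : ℕ) (γ : ℝ) (x : Fin N → ℝ → ℝ → Plane) (I : Set ℝ)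
    (B : Set Plane) : Prop :=
  ∃ M : ℝ, ∀ t ∈ I, ∀ i,
    (∀ l ≤ k, ∀ s, x i t s ∉ B → ‖iteratedDeriv l (x i t) s‖ ≤ M) ∧
    ∀ s r, x i t s ∉ B → x i t r ∉ B →
      ‖iteratedDeriv k (x i t) s - iteratedDeriv k (x i t) r‖ ≤ M * |s - r| ^ γ

/-- On the time set `I` and outside the set `B`, different boundary curves keep a positive distance,
and each boundary curve has arc-chord ratio bounded below, both uniformly in time. -/
def SeparatedOutside {N : ℕ} (L : Fin N → ℝ → ℝ) (x : Fin N → ℝ → ℝ → Plane) (I : Set ℝ)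
    (B : Set Plane) : Prop :=
  ∃ c > 0, ∀ t ∈ I,
    (∀ i j, i ≠ j → ∀ s r, x i t s ∉ B → x j t r ∉ B → c ≤ dist (x i t s) (x j t r)) ∧
    ∀ i s r, x i t s ∉ B → x i t r ∉ B →
      c * arcDist (L i t) s r ≤ dist (x i t s) (x i t r)

/-- The length scale `‖∂Ω(t)‖_{C^{k,γ}}^{-1/(k+γ-1)}` below which the interface looks straight. -/
noncomputable def regularityScale {N : ℕ} (k : ℕ) (γ : ℝ) (x : Fin N → ℝ → ℝ → Plane) (t : ℝ) :
    ℝ :=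
  (interfaceNorm k γ x t).toReal ^ (-(1 / (k + γ - 1)))

/-- The interface develops a splash singularity at time `T` at the point `x₀`, as witnessed by the
ball `B_ρ(x₀)`, the time interval `[T - ε, T)` and the branches `C 0 t`, `C 1 t`. -/
structure IsSplashAt {N : ℕ} (k : ℕ) (γ T : ℝ) (Ω : Fin N → ℝ → Set Plane)
    (L : Fin N → ℝ → ℝ) (x : Fin N → ℝ → ℝ → Plane)
    (x₀ : Plane) (ρ ε : ℝ) (C : Fin 2 → ℝ → Set Plane) : Prop where
  ρ_pos : 0 < ρ
  ε_pos : 0 < ε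
  ε_le : ε ≤ T
  /-- each branch is an open arc of one of the boundary curves (the whole closed curve if `b - a`
  exceeds its length) -/
  branch : ∀ t ∈ Ico (T - ε) T, ∀ j, ∃ i a b, a < b ∧ C j t = x i t '' Ioo a b
  branch_disjoint : ∀ t ∈ Ico (T - ε) T, Disjoint (C 0 t) (C 1 t)
  /-- there is nothing but the two branches in the ball -/
  branch_union : ∀ t ∈ Ico (T - ε) T, C 0 t ∪ C 1 t = interface Ω t ∩ Metric.ball x₀ ρ
  /-- each branch is simple, in a quantitative sense: different strands of the same branch do not
  come close to each other in comparison with the regularity scale (this is implied by, and weaker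
  than, a lower bound on the arc-chord ratio of the branch that is uniform in time) -/
  branch_simple : ∃ c > 0, ∀ t ∈ Ico (T - ε) T, ∀ j i s r, x i t s ∈ C j t → x i t r ∈ C j t →
    c * min (arcDist (L i t) s r) (regularityScale k γ x t) ≤ dist (x i t s) (x i t r)
  /-- both branches reach `x₀` as `t → T-` ... -/
  touch : ∀ j, Tendsto (fun t => Metric.infDist x₀ (C j t)) (𝓝[<] T) (𝓝 0)
  /-- ... and they touch each other nowhere else -/
  touch_only : ∀ σ > 0, ∃ c > 0, ∀ t ∈ Ico (T - ε) T, ∀ p ∈ C 0 t, ∀ q ∈ C 1 t, dist p q < c →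
    p ∈ Metric.ball x₀ σ ∧ q ∈ Metric.ball x₀ σ
  /-- outside the ball the interface remains regular, without touching or self-intersection -/
  bounded_outside : BoundedOutside k γ x (Ico (T - ε) T) (Metric.ball x₀ ρ)
  separated_outside : SeparatedOutside L x (Ico (T - ε) T) (Metric.ball x₀ ρ)
  /-- the loss of regularity is localized at `x₀` -/
  localized : ∀ σ > 0, BoundedOutside k γ x (Ico (T - ε) T) (Metric.ball x₀ σ)

/-- The interface develops a splash singularity as `t → T-`. -/
def FormsSplash {N : ℕ} (k : ℕ) (γ T : ℝ) (Ω : Fin N → ℝ → Set Plane)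
    (L : Fin N → ℝ → ℝ) (x : Fin N → ℝ → ℝ → Plane) : Prop :=
  ∃ x₀ ρ ε C, IsSplashAt k γ T Ω L x x₀ ρ ε C

end SQGPatch

open Set Filter Topology MeasureTheory
open scoped ENNReal NNReal
namespace SQGPatch

/-! Let `d` be the distance of the two branches. It is positive before `T` and tends to `0` at `T`;
the proof bounds how fast it can shrink. If two closest points approach each other with speed at
most `φ d (1 - log d)`, then `log (1 - log d)` grows at rate at most `φ`. Since it tends to
infinity, `φ` has infinite integral (Osgood, `lintegral_eq_top_of_tendsto_zero`). Here `φ` is a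
constant times the power of the norm in the theorem.

The velocity bound is `abs_sub_le_of_symmetricNear`. Closest points lie on a common normal line, and
only the velocity along that line matters. With this line as vertical axis the kernel is `v.1 / rad
^ s`, `s = 2 + 2α`, which is odd under reflection at the axis, so only the odd part of the vorticity
contributes. Each strand follows a symmetric curve, its osculating parabola (its tangent if `k =
1`), up to an error `m |x| ^ β` with `β = k + γ`. Hence near the two points the odd part lives in
two cusps of thickness `2 m |x| ^ β`. There the kernels at the two points differ by at most `min (2
|x| ^ (1 - s)) (s d |x| ^ (-s))`. As `β ≥ s - 1`, the product with the thickness is of order `min 1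
(d / |x|)`, whose integral is of order `d (1 - log d)`. Outside radius `r` the difference
contributes `d r ^ (-2α)`. If `r` is a fixed fraction of the regularity scale `M ^ (-1 / (β - 1))`,
`M` being the norm, both contributions scale like `M ^ (2α / (β - 1))`, which is at most the power
in the theorem because `M ≥ 1` and `k ≥ 1`.

That the vorticity is even off the cusps is a matter of joining a point to its mirror image without
crossing the interface (`exists_graph_avoiding`). Outside the pair of strands the path follows the
nearer parabola; it misses the other one because the parabolas do not cross, which is the
second-order condition at a closest pair (`curvature_le_of_closest`). Between the strands the path
divides the gap in a fixed ratio, and the gap does not close towards the axis (`gap_pos`). The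
simplicity of the branches ensures that no further strand comes within the scale `r`.

Passing from velocities to `d` is `SplashWindow.branchDist_sub_le`. Neither the labels of the
branches nor the parametrizations are related at different times; only Hausdorff continuity is
known. The limits of the two branches along an ultrafilter of times are shown to be disjoint, and a
branch at the limit time is contained in such a limit as soon as it meets it, so labels can at most
be interchanged. Almost closest points at later times therefore converge to a closest pair. The
transport law, with the continuity of the velocity along the curves
(`RegularAt.continuous_velocity`), then gives a one-sided Dini bound for `d`.

For `α ≤ 1 / 2` one has `k = 1` and the exponent `2α / γ ≤ 1`, and the norm is at most a constant
plus the curvature. -/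

/-! ### A differential inequality -/

/-- If the upper right Dini derivative of a lower semicontinuous function is bounded by a (not
necessarily measurable) function `φ`, then the increment is bounded by the lower integral of `φ`. -/
theorem ofReal_sub_le_lintegral_of_dini {F φ : ℝ → ℝ} {a b K : ℝ} (hab : a ≤ b)
    (hF : LowerSemicontinuousOn F (Icc a b))
    (hD : ∀ t ∈ Ico a b, ∀ η > 0, ∀ᶠ s in 𝓝[>] t, F s - F t ≤ (φ t + η) * (s - t))
    (hK : ∀ t ∈ Ico a b, φ t ≤ K) :
    ENNReal.ofReal (F b - F a) ≤ ∫⁻ t in Ioo a b, ENNReal.ofReal (φ t) := by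
  -- Real induction: lower semicontinuity makes the set closed, and the Dini bound with `η = 1`
  -- extends it to the right, hence the slope `K + 1`.
  have key : ∀ u ∈ Icc a b, ∀ v ∈ Icc a b, u ≤ v → F v - (K + 1) * v ≤ F u - (K + 1) * u := by
    intro u hu v hv huv
    set S : Set ℝ := {s | F s - (K + 1) * s ≤ F u - (K + 1) * u} with hS
    have hsub : Icc u v ⊆ Icc a b := Icc_subset_Icc hu.1 hv.2
    have hcl : IsClosed (S ∩ Icc u v) := by
      have h1 : LowerSemicontinuousOn (fun s => F s + -((K + 1) * s)) (Icc u v) :=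
        (hF.mono hsub).add ((by fun_prop : Continuous fun s : ℝ => -((K + 1) * s)
          ).lowerSemicontinuous.lowerSemicontinuousOn _)
      obtain ⟨w, hw, h2⟩ := lowerSemicontinuousOn_iff_preimage_Iic.1 h1 (F u - (K + 1) * u)
      have : S ∩ Icc u v = Icc u v ∩ w := by
        rw [← h2]; ext s; simp [hS, sub_eq_add_neg, and_comm]
      rw [this]; exact isClosed_Icc.inter hw
    refine (hcl.Icc_subset_of_forall_exists_gt (by simp [hS]) ?_) ⟨huv, le_rfl⟩
    rintro s ⟨hs, hsu, hsv⟩ y hy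
    have hs' : s ∈ Ico a b := ⟨hu.1.trans hsu, hsv.trans_le hv.2⟩
    have hev := (hD s hs' 1 one_pos).and (Ioc_mem_nhdsGT (lt_min hy hsv))
    obtain ⟨r, hr, hr1, hr2⟩ := hev.exists
    refine ⟨r, ?_, hr1, hr2.trans (min_le_left _ _)⟩
    simp only [hS, mem_ofPred_eq] at hs ⊢
    have := mul_le_mul_of_nonneg_right (hK s hs') (sub_nonneg.2 hr1.le)
    nlinarith
  set m : ℝ → ℝ := fun t => (K + 1) * t - F t with hm
  have hmono : MonotoneOn m (Icc a b) := fun u hu v hv huv => by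
    have := key u hu v hv huv
    simp only [hm]; linarith
  have hmono' : MonotoneOn m (uIcc a b) := by rwa [uIcc_of_le hab]
  have hint := hmono'.intervalIntegrable_deriv
  -- For a monotone function the integral of the derivative is at most the increment, so a singular
  -- part of `m` has the favourable sign.
  have hle : ∫ t in a..b, deriv m t ≤ m b - m a := by
    have h1 := hmono'.intervalIntegral_deriv_mem_uIcc
    have h2 : m a ≤ m b := hmono ⟨le_rfl, hab⟩ ⟨hab, le_rfl⟩ hab
    rw [uIcc_of_le (by linarith)] at h1
    exact h1.2
  have hint2 : IntervalIntegrable (fun t => (K + 1) - deriv m t) volume a b :=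
    intervalIntegrable_const.sub hint
  have h1 : F b - F a ≤ ∫ t in a..b, ((K + 1) - deriv m t) := by
    rw [intervalIntegral.integral_sub intervalIntegrable_const hint]
    simp only [hm, intervalIntegral.integral_const, smul_eq_mul] at hle ⊢
    nlinarith
  have hint3 : IntegrableOn (fun t => (K + 1) - deriv m t) (Ioo a b) := by
    rw [intervalIntegrable_iff_integrableOn_Ioo_of_le hab] at hint2
    exact hint2
  have hae : ∀ᵐ t ∂volume.restrict (Ioo a b), (K + 1) - deriv m t ≤ φ t := by
    rw [ae_restrict_iff' measurableSet_Ioo]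
    filter_upwards [hmono.ae_differentiableWithinAt_of_mem] with t ht htI
    have hdm : HasDerivAt m (deriv m t) t :=
      ((ht (Ioo_subset_Icc_self htI)).differentiableAt (Icc_mem_nhds htI.1 htI.2)).hasDerivAt
    have hdF : HasDerivAt F ((K + 1) - deriv m t) t := by
      have : F = fun s => (K + 1) * s - m s := by ext s; simp [hm]
      rw [this]
      exact (((hasDerivAt_id t).const_mul (K + 1)).sub hdm).congr_deriv (by simp)
    refine le_of_forall_pos_le_add fun η hη => ?_
    have hsl := hasDerivWithinAt_iff_tendsto_slope' (by simp) |>.1 (hdF.hasDerivWithinAt (s := Ioi t))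
    refine le_of_tendsto hsl ?_
    filter_upwards [hD t ⟨htI.1.le, htI.2⟩ η hη, self_mem_nhdsWithin] with s hs hts
    rw [slope_def_field, div_le_iff₀ (sub_pos.2 hts)]
    exact hs
  calc ENNReal.ofReal (F b - F a)
      ≤ ENNReal.ofReal (∫ t in Ioo a b, max ((K + 1) - deriv m t) 0) := by
        refine ENNReal.ofReal_le_ofReal (h1.trans ?_)
        rw [intervalIntegral.integral_of_le hab, integral_Ioc_eq_integral_Ioo]
        exact integral_mono hint3 hint3.pos_part fun t => le_max_left _ _
    _ = ∫⁻ t in Ioo a b, ENNReal.ofReal (max ((K + 1) - deriv m t) 0) :=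
        ofReal_integral_eq_lintegral_ofReal hint3.pos_part (ae_of_all _ fun t => le_max_right _ _)
    _ ≤ ∫⁻ t in Ioo a b, ENNReal.ofReal (φ t) := by
        -- The comparison of lower integrals does not need `φ` to be measurable.
        refine lintegral_mono_ae ?_
        filter_upwards [hae] with t ht
        rcases le_total ((K + 1) - deriv m t) 0 with h | h
        · simp [max_eq_right h]
        · rw [max_eq_left h]; exact ENNReal.ofReal_le_ofReal ht

/-- Minus this function is a primitive of the reciprocal of the Osgood modulus `u (1 - log u)`, so
composing with it removes the modulus from the differential inequality for `d`. -/
theorem hasDerivAt_log_one_sub_log {u : ℝ} (hu : 0 < u) (hu1 : u < 1) :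
    HasDerivAt (fun v => Real.log (1 - Real.log v)) (-(1 / (u * (1 - Real.log u)))) u := by
  have h : 0 < 1 - Real.log u := by linarith [Real.log_neg hu hu1]
  convert ((Real.hasDerivAt_log hu.ne').const_sub 1).log h.ne' using 1
  field_simp

/-- Osgood's criterion: a positive upper semicontinuous function which decreases at a rate of at most
`φ d (1 - log d)` can only tend to `0` if `φ` is not integrable. -/
theorem lintegral_eq_top_of_tendsto_zero {d φ : ℝ → ℝ} {t₀ T : ℝ} (htT : t₀ < T)
    (hd : ∀ t ∈ Ico t₀ T, 0 < d t ∧ d t < 1)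
    (husc : ∀ t ∈ Ico t₀ T, ∀ y > d t, ∀ᶠ s in 𝓝[Ico t₀ T] t, d s < y)
    (hdini : ∀ t ∈ Ico t₀ T, ∀ η > 0, ∀ᶠ s in 𝓝[>] t,
      d t - d s ≤ (φ t * (d t * (1 - Real.log (d t))) + η) * (s - t))
    (hlim : Tendsto d (𝓝[<] T) (𝓝 0))
    (hK : ∀ T' < T, ∃ K, ∀ t ∈ Icc t₀ T', φ t ≤ K) :
    ∫⁻ t in Ico t₀ T, ENNReal.ofReal (φ t) = ∞ := by
  set F : ℝ → ℝ := fun t => Real.log (1 - Real.log (d t)) with hFdef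
  have hG : ∀ u v : ℝ, 0 < u → u ≤ v → v < 1 →
      Real.log (1 - Real.log v) ≤ Real.log (1 - Real.log u) := by
    intro u v hu huv hv
    have h1 := Real.log_le_log hu huv
    have h2 := Real.log_neg (hu.trans_le huv) hv
    exact Real.log_le_log (by linarith) (by linarith)
  have hstep : ∀ b ∈ Ico t₀ T, ENNReal.ofReal (F b - F t₀) ≤
      ∫⁻ t in Ico t₀ T, ENNReal.ofReal (φ t) := by
    intro b hb
    obtain ⟨K, hKb⟩ := hK b hb.2
    have hsub : Icc t₀ b ⊆ Ico t₀ T := fun t ht => ⟨ht.1, ht.2.trans_lt hb.2⟩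
    refine (ofReal_sub_le_lintegral_of_dini (φ := φ) (K := K) hb.1 ?_ ?_
      (fun t ht => hKb t (Ico_subset_Icc_self ht))).trans
      (lintegral_mono_set (Ioo_subset_Icc_self.trans hsub))
    -- A decreasing continuous function of an upper semicontinuous one is lower semicontinuous.
    · intro t ht y hy
      have htT := hsub ht
      have hdt := hd t htT
      have hcont : ContinuousAt (fun v => Real.log (1 - Real.log v)) (d t) :=
        (hasDerivAt_log_one_sub_log hdt.1 hdt.2).continuousAt
      have hev : ∀ᶠ v in 𝓝[>] (d t), y < Real.log (1 - Real.log v) ∧ v ∈ Ioo (d t) 1 :=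
        ((hcont.eventually (lt_mem_nhds hy)).filter_mono nhdsWithin_le_nhds).and
          (Ioo_mem_nhdsGT hdt.2)
      obtain ⟨v, hv, hv1, hv2⟩ := hev.exists
      have h3 : ∀ᶠ s in 𝓝[Icc t₀ b] t, d s < v := nhdsWithin_mono _ hsub (husc t htT v hv1)
      filter_upwards [h3, self_mem_nhdsWithin] with s hs hsI
      exact hv.trans_le (hG _ _ (hd s (hsub hsI)).1 hs.le hv2)
    · intro t ht η hη
      have htT := hsub (Ico_subset_Icc_self ht)
      have hdt := hd t htT
      set u := d t with hu
      have hpos : 0 < u * (1 - Real.log u) :=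
        mul_pos hdt.1 (by linarith [Real.log_neg hdt.1 hdt.2])
      -- The slack is scaled so that along the line of slope `-ψ` through `(t, u)` the function `log
      -- (1 - log ·)` has derivative `φ t + η / 2`. The graph of `d` stays above this line.
      set η' := η / 2 * (u * (1 - Real.log u)) with hη'
      set ψ := φ t * (u * (1 - Real.log u)) + η' with hψ
      have hder : HasDerivAt (fun s => Real.log (1 - Real.log (u - ψ * (s - t))))
          (φ t + η / 2) t := by
        have h1 : HasDerivAt (fun s => u - ψ * (s - t)) (-ψ) t := by
          simpa using (((hasDerivAt_id t).sub_const t).const_mul ψ).const_sub u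
        have h2 := (hasDerivAt_log_one_sub_log (u := u - ψ * (t - t)) (by simpa using hdt.1)
          (by simpa using hdt.2)).comp t h1
        refine h2.congr_deriv ?_
        rw [sub_self, mul_zero, sub_zero, hψ, hη']
        field_simp
        rw [mul_div_cancel_left₀ _ hpos.ne']
      have hsl := (hasDerivWithinAt_iff_tendsto_slope' (by simp)).1
        (hder.hasDerivWithinAt (s := Ioi t))
      have hev1 := hsl.eventually (gt_mem_nhds (show φ t + η / 2 < φ t + η by linarith))
      have hc : ContinuousAt (fun s => u - ψ * (s - t)) t := by fun_prop
      have hev2 : ∀ᶠ s in 𝓝[>] t, 0 < u - ψ * (s - t) :=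
        nhdsWithin_le_nhds (hc.eventually (lt_mem_nhds (by simpa using hdt.1)))
      have hη'pos : 0 < η' := by positivity
      filter_upwards [hev1, hev2, hdini t htT η' hη'pos, self_mem_nhdsWithin,
        Ioo_mem_nhdsGT ht.2] with s h1 h2 h3 h4 h5
      rw [slope_def_field, div_lt_iff₀ (sub_pos.2 h4)] at h1
      have hds := hd s (hsub ⟨ht.1.trans h5.1.le, h5.2.le⟩)
      have := hG _ _ h2 (by linarith) hds.2
      simp only [sub_self, mul_zero, sub_zero] at h1
      simp only [hFdef]
      linarith
  have hFlim : Tendsto (fun t => F t - F t₀) (𝓝[<] T) atTop := by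
    refine tendsto_atTop_add_const_right _ _ ?_
    refine Real.tendsto_log_atTop.comp ?_
    have h1 : Tendsto d (𝓝[<] T) (𝓝[>] 0) := by
      refine tendsto_nhdsWithin_iff.2 ⟨hlim, ?_⟩
      filter_upwards [Ico_mem_nhdsLT htT] with t ht using (hd t ht).1
    have h2 := tendsto_neg_atBot_atTop.comp (Real.tendsto_log_nhdsGT_zero.comp h1)
    simpa [sub_eq_add_neg] using! tendsto_atTop_add_const_left _ 1 h2
  refine ENNReal.eq_top_of_forall_nnreal_le fun r => ?_
  obtain ⟨b, hb, hbI⟩ := ((hFlim.eventually (eventually_ge_atTop (r : ℝ))).and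
    (Ico_mem_nhdsLT htT)).exists
  refine le_trans ?_ (hstep b hbI)
  rw [← ENNReal.ofReal_coe_nnreal]
  exact ENNReal.ofReal_le_ofReal hb

/-! ### The velocity in coordinates adapted to a normal line -/

/-- The distance of `v` to the point `(0, c)`. -/
noncomputable def rad (c : ℝ) (v : ℝ × ℝ) : ℝ := √(v.1 ^ 2 + (v.2 - c) ^ 2)

/-- The kernel of the vertical velocity at the point `(0, c)`. -/
noncomputable def ker (s c : ℝ) (v : ℝ × ℝ) : ℝ := v.1 / rad c v ^ s

/-- The reflection at the vertical axis. -/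
def flip (v : ℝ × ℝ) : ℝ × ℝ := (-v.1, v.2)

/-- The part of a function which is odd with respect to reflection, up to a factor `2`. -/
def oddPart (W : ℝ × ℝ → ℝ) (v : ℝ × ℝ) : ℝ := W v - W (flip v)

/-- The truncated vertical velocity at the point `(0, c)` generated by `W`. -/
noncomputable def truncated (s c : ℝ) (W : ℝ × ℝ → ℝ) (ε : ℝ) : ℝ :=
  ∫ v in {v | ε < rad c v}, ker s c v * W v

/-- The set of points that are close to the parabola with curvature `a` through `(0, c)`. -/
def thinSet (m β a c : ℝ) : Set (ℝ × ℝ) := {v | |v.2 - c - a / 2 * v.1 ^ 2| ≤ m * |v.1| ^ β}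

@[fun_prop]
theorem continuous_rad (c : ℝ) : Continuous (rad c) := by unfold rad; fun_prop

theorem rad_nonneg (c : ℝ) (v : ℝ × ℝ) : 0 ≤ rad c v := Real.sqrt_nonneg _

theorem abs_fst_le_rad (c : ℝ) (v : ℝ × ℝ) : |v.1| ≤ rad c v :=
  Real.abs_le_sqrt (by nlinarith [sq_nonneg (v.2 - c)])

theorem abs_snd_sub_le_rad (c : ℝ) (v : ℝ × ℝ) : |v.2 - c| ≤ rad c v :=
  Real.abs_le_sqrt (by nlinarith [sq_nonneg v.1])

theorem rad_le_add (c : ℝ) (v : ℝ × ℝ) : rad c v ≤ |v.1| + |v.2 - c| := by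
  refine Real.sqrt_le_iff.2 ⟨by positivity, ?_⟩
  nlinarith [sq_abs v.1, sq_abs (v.2 - c), mul_nonneg (abs_nonneg v.1) (abs_nonneg (v.2 - c))]

theorem norm_sub_le_rad (c : ℝ) (v : ℝ × ℝ) : ‖v - (0, c)‖ ≤ rad c v := by
  rw [Prod.norm_def]
  simpa using ⟨abs_fst_le_rad c v, abs_snd_sub_le_rad c v⟩

theorem rad_flip (c : ℝ) (v : ℝ × ℝ) : rad c (flip v) = rad c v := by simp [rad, flip]

theorem ker_flip (s c : ℝ) (v : ℝ × ℝ) : ker s c (flip v) = -ker s c v := by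
  simp only [ker, rad_flip]; simp [flip, neg_div]

theorem rad_eq_norm (c : ℝ) (v : ℝ × ℝ) : rad c v = ‖(⟨v.1, v.2 - c⟩ : ℂ)‖ := by
  rw [rad, Complex.norm_eq_sqrt_sq_add_sq]

theorem abs_rad_sub_rad_le (c c' : ℝ) (v : ℝ × ℝ) : |rad c v - rad c' v| ≤ |c - c'| := by
  rw [rad_eq_norm, rad_eq_norm]
  refine (abs_norm_sub_norm_le _ _).trans ?_
  have : (⟨v.1, v.2 - c⟩ - ⟨v.1, v.2 - c'⟩ : ℂ) = (((c' - c : ℝ)) : ℂ) * Complex.I := by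
    apply Complex.ext <;> simp
  rw [this, norm_mul, Complex.norm_I, mul_one, Complex.norm_real, Real.norm_eq_abs, abs_sub_comm]

theorem measurable_flip : Measurable flip := by unfold flip; fun_prop

theorem measurePreserving_flip : MeasurePreserving flip :=
  (Measure.measurePreserving_neg (volume : Measure ℝ)).prod (MeasurePreserving.id volume)

theorem flip_flip (v : ℝ × ℝ) : flip (flip v) = v := by simp [flip]

theorem measurableEmbedding_flip : MeasurableEmbedding flip :=
  (MeasurableEquiv.mk ⟨flip, flip, flip_flip, flip_flip⟩ measurable_flip
    measurable_flip).measurableEmbedding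

/-! ### Bounds for the kernel and for its difference at two heights -/

theorem measurable_ker (s c : ℝ) : Measurable (ker s c) := by
  unfold ker
  exact measurable_fst.div ((continuous_rad c).measurable.pow_const s)

theorem abs_ker_le_rad (s c : ℝ) (v : ℝ × ℝ) : |ker s c v| ≤ rad c v ^ (1 - s) := by
  rcases (rad_nonneg c v).eq_or_lt with h | h
  · have : v.1 = 0 := abs_nonpos_iff.1 ((abs_fst_le_rad c v).trans h.symm.le)
    simp only [ker, this, zero_div, abs_zero]
    exact Real.rpow_nonneg (rad_nonneg c v) _
  · rw [ker, abs_div, abs_of_nonneg (Real.rpow_nonneg h.le s), Real.rpow_sub h, Real.rpow_one]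
    gcongr
    exact abs_fst_le_rad c v

/-- The exponent `1 - s` is nonpositive, so the radius may be replaced by the smaller `|v.1|`. The
result does not involve the height `c` and can be integrated slice by slice over a cusp. -/
theorem abs_ker_le_abs {s : ℝ} (hs : 1 ≤ s) (c : ℝ) (v : ℝ × ℝ) :
    |ker s c v| ≤ |v.1| ^ (1 - s) := by
  rcases (abs_nonneg v.1).eq_or_lt with h | h
  · have : v.1 = 0 := abs_eq_zero.1 h.symm
    simp only [ker, this, zero_div, abs_zero]
    positivity
  · exact (abs_ker_le_rad s c v).trans
      (Real.rpow_le_rpow_of_nonpos h (abs_fst_le_rad c v) (by linarith))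

theorem abs_inv_rpow_sub_le {s A B μ : ℝ} (hs : 0 < s) (hμ : 0 < μ) (hA : μ ≤ A) (hB : μ ≤ B) :
    |A ^ (-s) - B ^ (-s)| ≤ s * μ ^ (-s - 1) * |A - B| := by
  have h := (convex_Ici μ).norm_image_sub_le_of_norm_hasDerivWithin_le
    (f := fun x => x ^ (-s)) (f' := fun x => -s * x ^ (-s - 1)) (C := s * μ ^ (-s - 1))
    (fun x hx => (Real.hasDerivAt_rpow_const (Or.inl (hμ.trans_le hx).ne')).hasDerivWithinAt)
    (fun x hx => by
      have hx0 := hμ.trans_le hx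
      rw [norm_mul, Real.norm_eq_abs, abs_neg, abs_of_pos hs, Real.norm_eq_abs,
        abs_of_nonneg (Real.rpow_nonneg hx0.le _)]
      exact mul_le_mul_of_nonneg_left
        (Real.rpow_le_rpow_of_nonpos hμ hx (by linarith)) hs.le) hB hA
  simpa using h

/-- Mean value theorem for the power `-s` of the radius, the two radii differing by at most `|c -
c'|`. It is used with `μ` the smaller radius far away, and with `μ = |v.1|` in the cusps. -/
theorem abs_ker_sub_ker_le {s c c' μ : ℝ} (hs : 0 < s) {v : ℝ × ℝ} (hμ : 0 < μ)
    (hc : μ ≤ rad c v) (hc' : μ ≤ rad c' v) :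
    |ker s c v - ker s c' v| ≤ s * |c - c'| * (|v.1| * μ ^ (-s - 1)) := by
  have h1 : ker s c v - ker s c' v = v.1 * (rad c v ^ (-s) - rad c' v ^ (-s)) := by
    rw [ker, ker, Real.rpow_neg (rad_nonneg _ _), Real.rpow_neg (rad_nonneg _ _)]; ring
  rw [h1, abs_mul]
  have h2 := abs_inv_rpow_sub_le hs hμ hc hc'
  have h3 := abs_rad_sub_rad_le c c' v
  calc |v.1| * |rad c v ^ (-s) - rad c' v ^ (-s)|
      ≤ |v.1| * (s * μ ^ (-s - 1) * |c - c'|) := by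
        gcongr
        exact h2.trans (mul_le_mul_of_nonneg_left h3 (by positivity))
    _ = _ := by ring

/-- Away from both points, the difference of the kernels is controlled by the distance. -/
theorem abs_ker_sub_ker_le_rad {s c c' : ℝ} (hs : 0 < s) {v : ℝ × ℝ} (hc : 0 < rad c v)
    (hc' : 0 < rad c' v) :
    |ker s c v - ker s c' v| ≤ s * |c - c'| * (rad c v ^ (-s) + rad c' v ^ (-s)) := by
  have key : ∀ μ, 0 < μ → |v.1| ≤ μ → |v.1| * μ ^ (-s - 1) ≤ μ ^ (-s) := by
    intro μ hμ hv
    calc |v.1| * μ ^ (-s - 1) ≤ μ * μ ^ (-s - 1) := by gcongr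
      _ = μ ^ (-s) := by rw [Real.rpow_sub hμ, Real.rpow_one]; field_simp
  have p1 := Real.rpow_nonneg hc.le (-s)
  have p2 := Real.rpow_nonneg hc'.le (-s)
  rcases le_total (rad c v) (rad c' v) with h | h
  · refine (abs_ker_sub_ker_le hs hc le_rfl h).trans (mul_le_mul_of_nonneg_left ?_ (by positivity))
    linarith [key _ hc (abs_fst_le_rad c v)]
  · refine (abs_ker_sub_ker_le hs hc' h le_rfl).trans (mul_le_mul_of_nonneg_left ?_ (by positivity))
    linarith [key _ hc' (abs_fst_le_rad c' v)]

theorem abs_ker_sub_ker_le_abs {s c c' : ℝ} (hs : 0 < s) {v : ℝ × ℝ} :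
    |ker s c v - ker s c' v| ≤ s * |c - c'| * |v.1| ^ (-s) := by
  rcases (abs_nonneg v.1).eq_or_lt with h | h
  · have : v.1 = 0 := abs_eq_zero.1 h.symm
    simp only [ker, this, zero_div, sub_self, abs_zero]
    positivity
  · refine (abs_ker_sub_ker_le hs h (abs_fst_le_rad c v) (abs_fst_le_rad c' v)).trans_eq ?_
    rw [Real.rpow_sub h, Real.rpow_one]; field_simp

theorem integrableOn_ker_mul {s c ε : ℝ} (hs : 1 ≤ s) (hε : 0 < ε) {W : ℝ × ℝ → ℝ}
    (hW : Integrable W) : IntegrableOn (fun v => ker s c v * W v) {v | ε < rad c v} := by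
  refine Integrable.bdd_mul (c := ε ^ (1 - s)) hW.integrableOn
    (measurable_ker s c).aestronglyMeasurable ?_
  rw [ae_restrict_iff' (measurableSet_lt measurable_const (continuous_rad c).measurable)]
  refine ae_of_all _ fun v hv => ?_
  rw [Real.norm_eq_abs]
  exact (abs_ker_le_rad s c v).trans (Real.rpow_le_rpow_of_nonpos hε (le_of_lt hv) (by linarith))

/-! ### Reflection at the normal line -/

theorem integrable_comp_flip {W : ℝ × ℝ → ℝ} (hW : Integrable W) :
    Integrable (fun v => W (flip v)) :=
  (measurePreserving_flip.integrable_comp_emb measurableEmbedding_flip).2 hW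

theorem integrable_oddPart {W : ℝ × ℝ → ℝ} (hW : Integrable W) : Integrable (oddPart W) :=
  hW.sub (integrable_comp_flip hW)

/-- Only the odd part contributes to the velocity. -/
theorem truncated_eq_oddPart {s c ε : ℝ} (hs : 1 ≤ s) (hε : 0 < ε) {W : ℝ × ℝ → ℝ}
    (hW : Integrable W) :
    truncated s c W ε = 1 / 2 * ∫ v in {v | ε < rad c v}, ker s c v * oddPart W v := by
  have h1 : ∫ v in {v | ε < rad c v}, ker s c v * W (flip v) = -truncated s c W ε := by
    have := measurePreserving_flip.setIntegral_preimage_emb measurableEmbedding_flip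
      (fun v => ker s c v * W v) {v | ε < rad c v}
    rw [truncated, ← this]
    have hset : flip ⁻¹' {v | ε < rad c v} = {v | ε < rad c v} := by
      ext v; simp [rad_flip]
    rw [hset, ← integral_neg]
    simp [ker_flip]
  have h2 : ∫ v in {v | ε < rad c v}, ker s c v * oddPart W v =
      (∫ v in {v | ε < rad c v}, ker s c v * W v) -
        ∫ v in {v | ε < rad c v}, ker s c v * W (flip v) := by
    rw [← integral_sub (integrableOn_ker_mul hs hε hW)
      (integrableOn_ker_mul hs hε (integrable_comp_flip hW))]
    simp [oddPart, mul_sub]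
  rw [h2, h1, ← truncated]; ring

/-! ### Integration over the cusps and at infinity -/

/-- Integrals of functions of the first variable over the neighbourhood of a parabola. -/
theorem integrable_indicator_thinSet {m β a c r : ℝ} (hm : 0 ≤ m) {g h : ℝ → ℝ} (hg : Measurable g)
    (hg0 : ∀ x, 0 ≤ g x) (hh : IntegrableOn h (Ioo (-r) r))
    (hgh : ∀ x ∈ Ioo (-r) r, g x * (2 * (m * |x| ^ β)) ≤ h x) :
    Integrable (({v : ℝ × ℝ | v.1 ∈ Ioo (-r) r} ∩ thinSet m β a c).indicator fun v => g v.1) ∧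
    ∫ v, ({v : ℝ × ℝ | v.1 ∈ Ioo (-r) r} ∩ thinSet m β a c).indicator (fun v => g v.1) v ≤
      ∫ x in Ioo (-r) r, h x := by
  set S := {v : ℝ × ℝ | v.1 ∈ Ioo (-r) r} ∩ thinSet m β a c with hS
  have hSm : MeasurableSet S := by
    refine (measurable_fst measurableSet_Ioo).inter (measurableSet_le (by fun_prop) ?_)
    exact measurable_const.mul ((measurable_fst.abs).pow_const β)
  have hmeas : Measurable (S.indicator fun v => g v.1) := (hg.comp measurable_fst).indicator hSm
  have hpos : ∀ v, 0 ≤ S.indicator (fun v => g v.1) v :=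
    fun v => indicator_nonneg (fun v _ => hg0 v.1) v
  have hhpos : ∀ x ∈ Ioo (-r) r, 0 ≤ h x := fun x hx =>
    (mul_nonneg (hg0 x) (by positivity)).trans (hgh x hx)
  -- Tonelli: each vertical slice lies in an interval of length `2 (m |x| ^ β)`.
  have hle : ∫⁻ v, ENNReal.ofReal (S.indicator (fun v => g v.1) v) ≤
      ENNReal.ofReal (∫ x in Ioo (-r) r, h x) := by
    rw [ofReal_integral_eq_lintegral_ofReal hh
      ((ae_restrict_iff' measurableSet_Ioo).2 (ae_of_all _ hhpos)),
      ← lintegral_indicator measurableSet_Ioo, Measure.volume_eq_prod,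
      lintegral_prod _ hmeas.ennreal_ofReal.aemeasurable]
    refine lintegral_mono fun x => ?_
    by_cases hx : x ∈ Ioo (-r) r
    · rw [indicator_of_mem hx]
      calc ∫⁻ y, ENNReal.ofReal (S.indicator (fun v => g v.1) (x, y))
          ≤ ∫⁻ y in Icc (c + a / 2 * x ^ 2 - m * |x| ^ β) (c + a / 2 * x ^ 2 + m * |x| ^ β),
              ENNReal.ofReal (g x) := by
            rw [← lintegral_indicator measurableSet_Icc]
            refine lintegral_mono fun y => ?_
            by_cases hy : (x, y) ∈ S
            · rw [indicator_of_mem hy, indicator_of_mem]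
              have hy2 : |y - c - a / 2 * x ^ 2| ≤ m * |x| ^ β := hy.2
              have := abs_le.1 hy2
              exact ⟨by linarith [this.1], by linarith [this.2]⟩
            · simp [indicator_of_notMem hy]
        _ = ENNReal.ofReal (g x * (2 * (m * |x| ^ β))) := by
            rw [lintegral_const, Measure.restrict_apply_univ, Real.volume_Icc,
              ← ENNReal.ofReal_mul (hg0 x)]
            congr 2; ring
        _ ≤ _ := ENNReal.ofReal_le_ofReal (hgh x hx)
    · have : ∀ y, (x, y) ∉ S := fun y hy => hx hy.1
      simp [indicator_of_notMem (this _), indicator_of_notMem hx]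
  have hint : Integrable (S.indicator fun v => g v.1) := by
    refine ⟨hmeas.aestronglyMeasurable, ?_⟩
    rw [hasFiniteIntegral_iff_ofReal (ae_of_all _ hpos)]
    exact hle.trans_lt ENNReal.ofReal_lt_top
  refine ⟨hint, ?_⟩
  rw [← ofReal_integral_eq_lintegral_ofReal hint (ae_of_all _ hpos)] at hle
  exact (ENNReal.ofReal_le_ofReal_iff
    (setIntegral_nonneg measurableSet_Ioo hhpos)).1 hle

/-- A smooth substitute for `rad c v ^ (-s)` outside the ball of radius `r`. -/
noncomputable def farBound (s r c : ℝ) (v : ℝ × ℝ) : ℝ :=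
  2 ^ s * r ^ (-s) * (1 + ‖r⁻¹ • (v - (0, c))‖) ^ (-s)

theorem rad_rpow_le_farBound {s r c : ℝ} (hs : 0 < s) (hr : 0 < r) {v : ℝ × ℝ} (hv : r ≤ rad c v) :
    rad c v ^ (-s) ≤ farBound s r c v := by
  have h1 := norm_sub_le_rad c v
  have h2 : farBound s r c v = ((r * (1 + ‖r⁻¹ • (v - (0, c))‖)) / 2) ^ (-s) := by
    rw [farBound, Real.div_rpow (by positivity) (by positivity),
      Real.mul_rpow hr.le (by positivity), Real.rpow_neg (by norm_num : (0:ℝ) ≤ 2)]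
    field_simp
  rw [h2]
  -- The radius is at least `r` and at least the sup norm of `v - (0, c)`, hence at least their
  -- mean.
  refine Real.rpow_le_rpow_of_nonpos (by positivity) ?_ (by linarith)
  rw [norm_smul, norm_inv, Real.norm_of_nonneg hr.le]
  have : r * (1 + r⁻¹ * ‖v - (0, c)‖) = r + ‖v - (0, c)‖ := by field_simp
  rw [this]; linarith

theorem integrable_one_add_norm_prod {s : ℝ} (hs : 2 < s) :
    Integrable (fun v : ℝ × ℝ => (1 + ‖v‖) ^ (-s)) :=
  integrable_one_add_norm (by simpa using hs)

theorem farBound_nonneg {s r c : ℝ} (hr : 0 < r) (v : ℝ × ℝ) : 0 ≤ farBound s r c v := by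
  unfold farBound; positivity

/-- Rescaling by `r`: the power `r ^ (2 - s)` is `r ^ (-s)` times the Jacobian `r ^ 2`, and `s > 2`
is integrability at infinity in the plane. -/
theorem integrable_farBound {s r c : ℝ} (hs : 2 < s) (hr : 0 < r) :
    Integrable (farBound s r c) ∧ ∫ v, farBound s r c v =
      2 ^ s * (∫ v : ℝ × ℝ, (1 + ‖v‖) ^ (-s)) * r ^ (2 - s) := by
  have h1 : Integrable (fun v : ℝ × ℝ => (1 + ‖r⁻¹ • v‖) ^ (-s)) :=
    (integrable_comp_smul_iff volume (fun v : ℝ × ℝ => (1 + ‖v‖) ^ (-s)) (inv_ne_zero hr.ne')).2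
      (integrable_one_add_norm_prod hs)
  have h2 : Integrable (fun v : ℝ × ℝ => (1 + ‖r⁻¹ • (v - (0, c))‖) ^ (-s)) :=
    h1.comp_sub_right (0, c)
  refine ⟨h2.const_mul _, ?_⟩
  unfold farBound
  rw [integral_const_mul, integral_sub_right_eq_self (fun v => (1 + ‖r⁻¹ • v‖) ^ (-s)),
    Measure.integral_comp_inv_smul_of_nonneg volume (fun v : ℝ × ℝ => (1 + ‖v‖) ^ (-s)) hr.le]
  simp only [Module.finrank_prod, Module.finrank_self, smul_eq_mul]
  rw [show (2 - s) = -s + (2 : ℕ) by push_cast; ring, Real.rpow_add hr, Real.rpow_natCast]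
  norm_num
  ring

/-! ### Principal values for an almost symmetric vorticity -/

/-- `W` is symmetric near `(0, c)`, except in the neighbourhoods of two parabolas. -/
def SymmetricNear (W : ℝ × ℝ → ℝ) (m β r a₁ c₁ a₂ c₂ c : ℝ) : Prop :=
  ∀ v, rad c v < r → v ∉ thinSet m β a₁ c₁ → v ∉ thinSet m β a₂ c₂ → oddPart W v = 0

theorem abs_oddPart_le {W : ℝ × ℝ → ℝ} {Θ : ℝ} (hW : ∀ v, |W v| ≤ Θ) (v : ℝ × ℝ) :
    |oddPart W v| ≤ 2 * Θ := by
  refine (abs_sub _ _).trans ?_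
  linarith [hW v, hW (flip v)]

theorem SymmetricNear.mono {W : ℝ × ℝ → ℝ} {m β r r' a₁ c₁ a₂ c₂ c : ℝ}
    (h : SymmetricNear W m β r a₁ c₁ a₂ c₂ c) (hr : r' ≤ r) :
    SymmetricNear W m β r' a₁ c₁ a₂ c₂ c :=
  fun v hv => h v (hv.trans_le hr)

/-- The thickness compensates the singularity of the kernel because `β ≥ s - 1`. For `β = k + γ` and
`s = 2 + 2α` this is the lower bound on `γ` in the theorem. -/
theorem rpow_mul_thickness_le {s β m x : ℝ} (hm : 0 ≤ m) (hβ : s - 1 ≤ β) (hx : |x| ≤ 1) :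
    |x| ^ (1 - s) * (2 * (m * |x| ^ β)) ≤ 2 * m := by
  rcases (abs_nonneg x).eq_or_lt with h | h
  · rw [← h]
    rcases eq_or_ne (1 - s) 0 with h1 | h1
    · have : (0:ℝ) ^ β ≤ 1 := Real.zero_rpow_le_one β
      rw [h1, Real.rpow_zero]; nlinarith
    · rw [Real.zero_rpow h1]; linarith
  · have h1 : |x| ^ (1 - s) * |x| ^ β ≤ 1 := by
      rw [← Real.rpow_add h]
      exact Real.rpow_le_one h.le hx (by linarith)
    calc |x| ^ (1 - s) * (2 * (m * |x| ^ β)) = 2 * m * (|x| ^ (1 - s) * |x| ^ β) := by ring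
      _ ≤ 2 * m * 1 := by gcongr
      _ = 2 * m := by ring

/-- The indicator of the neighbourhood of a parabola in a strip, times a function of `v.1`. -/
noncomputable def stripBound (m β r a c : ℝ) (g : ℝ → ℝ) : ℝ × ℝ → ℝ :=
  ({v : ℝ × ℝ | v.1 ∈ Ioo (-r) r} ∩ thinSet m β a c).indicator fun v => g v.1

theorem stripBound_nonneg {m β r a c : ℝ} {g : ℝ → ℝ} (hg : ∀ x, 0 ≤ g x) (v : ℝ × ℝ) :
    0 ≤ stripBound m β r a c g v := indicator_nonneg (fun v _ => hg v.1) v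

theorem stripBound_rpow {s m β r a c : ℝ} (hm : 0 ≤ m) (hβ : s - 1 ≤ β) (hr0 : 0 < r)
    (hr : r ≤ 1) :
    Integrable (stripBound m β r a c fun x => |x| ^ (1 - s)) ∧
      ∫ v, stripBound m β r a c (fun x => |x| ^ (1 - s)) v ≤ 4 * m * r := by
  have h := integrable_indicator_thinSet (m := m) (β := β) (a := a) (c := c) (r := r)
    (g := fun x => |x| ^ (1 - s)) (h := fun _ => 2 * m) hm (by fun_prop)
    (fun x => by positivity) (integrableOn_const measure_Ioo_lt_top.ne) (fun x hx => by
      refine rpow_mul_thickness_le hm hβ ?_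
      exact (abs_le.2 ⟨hx.1.le, hx.2.le⟩).trans hr)
  refine ⟨h.1, h.2.trans_eq ?_⟩
  simp only [setIntegral_const, measureReal_def, Real.volume_Ioo, smul_eq_mul]
  rw [ENNReal.toReal_ofReal (by linarith)]; ring

/-- Pointwise control of the symmetrized integrand near the point `(0, c)`. -/
theorem SymmetricNear.abs_mul_oddPart_le {W : ℝ × ℝ → ℝ} {m β r a₁ c₁ a₂ c₂ c Θ : ℝ}
    (h : SymmetricNear W m β r a₁ c₁ a₂ c₂ c) (hW : ∀ v, |W v| ≤ Θ) {κ : ℝ} {g : ℝ → ℝ}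
    (hg : ∀ x, 0 ≤ g x) {v : ℝ × ℝ} (hκ : |κ| ≤ g v.1) (hv : rad c v < r) :
    |κ * oddPart W v| ≤ 2 * Θ * (stripBound m β r a₁ c₁ g v + stripBound m β r a₂ c₂ g v) := by
  have hΘ : 0 ≤ Θ := (abs_nonneg _).trans (hW v)
  have hx : v.1 ∈ Ioo (-r) r := abs_lt.1 ((abs_fst_le_rad c v).trans_lt hv)
  have p1 := stripBound_nonneg (m := m) (β := β) (r := r) (a := a₁) (c := c₁) hg v
  have p2 := stripBound_nonneg (m := m) (β := β) (r := r) (a := a₂) (c := c₂) hg v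
  have hb : |κ * oddPart W v| ≤ 2 * Θ * g v.1 := by
    rw [abs_mul, mul_comm]
    exact mul_le_mul (abs_oddPart_le hW v) hκ (abs_nonneg _) (by positivity)
  by_cases h1 : v ∈ thinSet m β a₁ c₁
  · have : stripBound m β r a₁ c₁ g v = g v.1 :=
      indicator_of_mem (s := _ ∩ thinSet m β a₁ c₁) ⟨hx, h1⟩ _
    rw [this]
    exact hb.trans (mul_le_mul_of_nonneg_left (by linarith) (by positivity))
  by_cases h2 : v ∈ thinSet m β a₂ c₂
  · have : stripBound m β r a₂ c₂ g v = g v.1 :=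
      indicator_of_mem (s := _ ∩ thinSet m β a₂ c₂) ⟨hx, h2⟩ _
    rw [this]
    exact hb.trans (mul_le_mul_of_nonneg_left (by linarith) (by positivity))
  rw [h v hv h1 h2, mul_zero, abs_zero]
  positivity

theorem SymmetricNear.integrable {W : ℝ × ℝ → ℝ} {m β r a₁ c₁ a₂ c₂ c Θ s : ℝ}
    (h : SymmetricNear W m β r a₁ c₁ a₂ c₂ c) (hW : ∀ v, |W v| ≤ Θ) (hWi : Integrable W)
    (hs : 1 ≤ s) (hm : 0 ≤ m) (hβ : s - 1 ≤ β) (hr0 : 0 < r) (hr : r ≤ 1) :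
    Integrable (fun v => ker s c v * oddPart W v) := by
  set g : ℝ → ℝ := fun x => |x| ^ (1 - s)
  have hg : ∀ x, 0 ≤ g x := fun x => by positivity
  have i1 := (stripBound_rpow (a := a₁) (c := c₁) hm hβ hr0 hr).1
  have i2 := (stripBound_rpow (a := a₂) (c := c₂) hm hβ hr0 hr).1
  refine Integrable.mono' (g := fun v => 2 * Θ * (stripBound m β r a₁ c₁ g v +
    stripBound m β r a₂ c₂ g v) + r ^ (1 - s) * |oddPart W v|)
    (((i1.add i2).const_mul _).add ((integrable_oddPart hWi).abs.const_mul _))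
    ((measurable_ker s c).aestronglyMeasurable.mul (integrable_oddPart hWi).aestronglyMeasurable)
    (ae_of_all _ fun v => ?_)
  have hΘ : 0 ≤ Θ := (abs_nonneg _).trans (hW v)
  have p1 := stripBound_nonneg (m := m) (β := β) (r := r) (a := a₁) (c := c₁) hg v
  have p2 := stripBound_nonneg (m := m) (β := β) (r := r) (a := a₂) (c := c₂) hg v
  rw [Real.norm_eq_abs]
  rcases lt_or_ge (rad c v) r with hv | hv
  · refine (h.abs_mul_oddPart_le hW hg (abs_ker_le_abs hs c v) hv).trans ?_
    have : 0 ≤ r ^ (1 - s) * |oddPart W v| := by positivity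
    linarith
  · rw [abs_mul]
    have h1 : |ker s c v| ≤ r ^ (1 - s) := (abs_ker_le_rad s c v).trans
      (Real.rpow_le_rpow_of_nonpos hr0 hv (by linarith))
    have h2 := mul_le_mul_of_nonneg_right h1 (abs_nonneg (oddPart W v))
    have : 0 ≤ 2 * Θ * (stripBound m β r a₁ c₁ g v + stripBound m β r a₂ c₂ g v) := by positivity
    linarith

/-- The principal value is given by an absolutely convergent integral. -/
theorem SymmetricNear.tendsto_truncated {W : ℝ × ℝ → ℝ} {m β r a₁ c₁ a₂ c₂ c Θ s : ℝ}
    (h : SymmetricNear W m β r a₁ c₁ a₂ c₂ c) (hW : ∀ v, |W v| ≤ Θ) (hWi : Integrable W)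
    (hs : 1 ≤ s) (hm : 0 ≤ m) (hβ : s - 1 ≤ β) (hr0 : 0 < r) (hr : r ≤ 1) :
    Tendsto (truncated s c W) (𝓝[>] 0) (𝓝 (1 / 2 * ∫ v, ker s c v * oddPart W v)) := by
  have hint := h.integrable hW hWi hs hm hβ hr0 hr
  have hms : ∀ ε, MeasurableSet {v : ℝ × ℝ | ε < rad c v} := fun ε =>
    measurableSet_lt measurable_const (continuous_rad c).measurable
  have h1 : Tendsto (fun ε => ∫ v, {v | ε < rad c v}.indicator
      (fun v => ker s c v * oddPart W v) v) (𝓝[>] 0) (𝓝 (∫ v, ker s c v * oddPart W v)) := by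
    refine tendsto_integral_filter_of_dominated_convergence
      (fun v => ‖ker s c v * oddPart W v‖) ?_ ?_ hint.norm ?_
    · exact Eventually.of_forall fun ε => hint.aestronglyMeasurable.indicator (hms ε)
    · exact Eventually.of_forall fun ε => ae_of_all _ fun v => norm_indicator_le_norm_self _ _
    · refine ae_of_all _ fun v => ?_
      rcases (rad_nonneg c v).eq_or_lt with hv | hv
      -- At the centre the indicator stays `0` for every positive `ε`, but there the integrand
      -- vanishes anyway.
      · have h0 : v.1 = 0 := abs_nonpos_iff.1 ((abs_fst_le_rad c v).trans hv.symm.le)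
        have : ker s c v * oddPart W v = 0 := by simp [ker, h0]
        simp [indicator_apply, this]
      · refine tendsto_const_nhds.congr' ?_
        filter_upwards [nhdsWithin_le_nhds (gt_mem_nhds hv)] with ε hε
        rw [indicator_of_mem (by exact hε)]
  refine (h1.const_mul (1 / 2)).congr' ?_
  filter_upwards [self_mem_nhdsWithin] with ε hε
  rw [truncated_eq_oddPart hs hε hWi, integral_indicator (hms ε)]

/-- The error of the truncation. -/
theorem SymmetricNear.abs_sub_truncated_le {W : ℝ × ℝ → ℝ} {m β r a₁ c₁ a₂ c₂ c Θ s w ε : ℝ}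
    (h : SymmetricNear W m β r a₁ c₁ a₂ c₂ c) (hW : ∀ v, |W v| ≤ Θ) (hWi : Integrable W)
    (hs : 1 ≤ s) (hm : 0 ≤ m) (hβ : s - 1 ≤ β) (hε : 0 < ε) (hεr : ε < r) (hr : r ≤ 1)
    (hw : Tendsto (truncated s c W) (𝓝[>] 0) (𝓝 w)) :
    |w - truncated s c W ε| ≤ 16 * Θ * m * ε := by
  have hr0 := hε.trans hεr
  have hint := h.integrable hW hWi hs hm hβ hr0 hr
  have hΘ : 0 ≤ Θ := (abs_nonneg _).trans (hW 0)
  have hms : MeasurableSet {v : ℝ × ℝ | ε < rad c v} :=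
    measurableSet_lt measurable_const (continuous_rad c).measurable
  rw [tendsto_nhds_unique hw (h.tendsto_truncated hW hWi hs hm hβ hr0 hr),
    truncated_eq_oddPart hs hε hWi, ← integral_add_compl hms hint, ← mul_sub, add_sub_cancel_left,
    abs_mul]
  set g : ℝ → ℝ := fun x => |x| ^ (1 - s)
  have hg : ∀ x, 0 ≤ g x := fun x => by positivity
  -- The symmetry holds where `rad` is strictly below the radius, so the strip is taken slightly
  -- wider than `ε`. Its width is still of order `ε`, which makes the error linear in `ε`.
  set r' := min r (2 * ε) with hr'
  have hr'0 : 0 < r' := lt_min hr0 (by linarith)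
  have hεr' : ε < r' := lt_min hεr (by linarith)
  have h' := h.mono (min_le_left r (2 * ε))
  have i1 := stripBound_rpow (a := a₁) (c := c₁) hm hβ hr'0 ((min_le_left _ _).trans hr)
  have i2 := stripBound_rpow (a := a₂) (c := c₂) hm hβ hr'0 ((min_le_left _ _).trans hr)
  have hb : |∫ v in {v | ε < rad c v}ᶜ, ker s c v * oddPart W v| ≤
      ∫ v, 2 * Θ * (stripBound m β r' a₁ c₁ g v + stripBound m β r' a₂ c₂ g v) := by
    rw [← integral_indicator hms.compl, ← Real.norm_eq_abs]
    refine norm_integral_le_of_norm_le (((i1.1.add i2.1)).const_mul _) (ae_of_all _ fun v => ?_)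
    by_cases hv : v ∈ {v | ε < rad c v}ᶜ
    · rw [indicator_of_mem hv]
      have hv' : rad c v ≤ ε := not_lt.1 hv
      exact h'.abs_mul_oddPart_le hW hg (abs_ker_le_abs hs c v) (hv'.trans_lt hεr')
    · rw [indicator_of_notMem hv, norm_zero]
      have p1 := stripBound_nonneg (m := m) (β := β) (r := r') (a := a₁) (c := c₁) hg v
      have p2 := stripBound_nonneg (m := m) (β := β) (r := r') (a := a₂) (c := c₂) hg v
      positivity
  rw [integral_const_mul, integral_add i1.1 i2.1] at hb
  have h2 : r' ≤ 2 * ε := min_le_right _ _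
  have h3 : 4 * m * r' ≤ 8 * m * ε := by nlinarith
  rw [abs_of_pos (by norm_num : (0:ℝ) < 1 / 2)]
  have h4 : 2 * Θ * ((∫ v, stripBound m β r' a₁ c₁ g v) + ∫ v, stripBound m β r' a₂ c₂ g v) ≤
      2 * Θ * (16 * m * ε) := by
    refine mul_le_mul_of_nonneg_left ?_ (by positivity)
    linarith [i1.2, i2.2]
  linarith

/-! ### The velocity difference of two points on a normal line -/

/-- Majorant of the kernel difference as a function of the horizontal distance. -/
noncomputable def kernelGap (s d x : ℝ) : ℝ := min (2 * |x| ^ (1 - s)) (s * d * |x| ^ (-s))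

/-- The part `|x| ≤ d` contributes a multiple of `d`, and `d / |x|` on `d < |x| < 1` a multiple of
`-d log d`. This is the source of the logarithm. -/
theorem integrable_gapBound {s d μ r : ℝ} (hs : 0 < s) (hd : 0 < d) (hd1 : d < 1) (hμ : 0 ≤ μ)
    (hr : r ≤ 1) :
    IntegrableOn (fun x => 2 * μ * (if |x| ≤ d then 2 else s * d * |x|⁻¹)) (Ioo (-r) r) ∧
    ∫ x in Ioo (-r) r, 2 * μ * (if |x| ≤ d then 2 else s * d * |x|⁻¹) ≤
      (8 + 4 * s) * μ * (d * (1 - Real.log d)) := by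
  set f : ℝ → ℝ := fun x => if |x| ≤ d then 2 else s * d * |x|⁻¹ with hf
  have hfm : Measurable f :=
    Measurable.ite (measurableSet_le measurable_abs measurable_const) measurable_const
      (measurable_const.mul measurable_abs.inv)
  have hf0 : ∀ x, 0 ≤ f x := fun x => by simp only [hf]; split_ifs <;> positivity
  have hfb : ∀ x, f x ≤ 2 + s := fun x => by
    simp only [hf]; split_ifs with hx
    · linarith
    · push Not at hx
      have : d * |x|⁻¹ ≤ 1 := by
        rw [← div_eq_mul_inv]; exact (div_le_one (hd.trans hx)).2 hx.le
      nlinarith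
  have hfi : ∀ a b, IntervalIntegrable f volume a b := fun a b =>
    (intervalIntegrable_const (c := 2 + s)).mono_fun hfm.aestronglyMeasurable
      (ae_of_all _ fun x => by
        change ‖f x‖ ≤ ‖2 + s‖
        rw [Real.norm_of_nonneg (hf0 x), Real.norm_of_nonneg (by positivity)]; exact hfb x)
  have hhalf : ∫ x in (0:ℝ)..1, f x = 2 * d + s * d * (-Real.log d) := by
    rw [← intervalIntegral.integral_add_adjacent_intervals (hfi 0 d) (hfi d 1)]
    have e1 : ∫ x in (0:ℝ)..d, f x = ∫ x in (0:ℝ)..d, (2:ℝ) := by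
      refine intervalIntegral.integral_congr fun x hx => ?_
      rw [uIcc_of_le hd.le] at hx
      simp only [hf]
      rw [if_pos (by rw [abs_of_nonneg hx.1]; exact hx.2)]
    have e2 : ∫ x in d..1, f x = ∫ x in d..1, s * d * x⁻¹ := by
      refine intervalIntegral.integral_congr_ae (ae_of_all _ fun x hx => ?_)
      rw [uIoc_of_le hd1.le] at hx
      simp only [hf]
      rw [if_neg (by rw [abs_of_pos (hd.trans hx.1)]; exact not_le.2 hx.1),
        abs_of_pos (hd.trans hx.1)]
    rw [e1, e2, intervalIntegral.integral_const, intervalIntegral.integral_const_mul,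
      integral_inv_of_pos hd one_pos, one_div, Real.log_inv]
    simp; ring
  have hfull : ∫ x in (-1:ℝ)..1, f x = 2 * (2 * d + s * d * (-Real.log d)) := by
    rw [← intervalIntegral.integral_add_adjacent_intervals (hfi (-1) 0) (hfi 0 1), ← hhalf]
    have : ∫ x in (-1:ℝ)..0, f x = ∫ x in (0:ℝ)..1, f x := by
      have := intervalIntegral.integral_comp_neg (a := 0) (b := 1) f
      rw [neg_zero] at this
      rw [← this]
      refine intervalIntegral.integral_congr fun x _ => ?_
      simp [hf]
    rw [this]; ring
  have hI1 : IntegrableOn f (Ioo (-1) 1) :=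
    (intervalIntegrable_iff_integrableOn_Ioo_of_le (by norm_num)).1 (hfi (-1) 1)
  have hsub : Ioo (-r) r ⊆ Ioo (-1) 1 := Ioo_subset_Ioo (by linarith) hr
  have hle : ∫ x in Ioo (-r) r, f x ≤ 2 * (2 * d + s * d * (-Real.log d)) := by
    rw [← hfull, intervalIntegral.integral_of_le (by norm_num), integral_Ioc_eq_integral_Ioo]
    exact setIntegral_mono_set hI1 (ae_of_all _ hf0) hsub.eventuallyLE
  refine ⟨(hI1.mono_set hsub).const_mul _, ?_⟩
  rw [integral_const_mul]
  have hlog := Real.log_neg hd hd1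
  calc 2 * μ * ∫ x in Ioo (-r) r, f x ≤ 2 * μ * (2 * (2 * d + s * d * (-Real.log d))) := by gcongr
    _ ≤ (8 + 4 * s) * μ * (d * (1 - Real.log d)) := by
      have h1 : 0 ≤ μ * d := by positivity
      have h2 : 0 ≤ μ * d * (-Real.log d) := mul_nonneg h1 (by linarith)
      nlinarith [mul_nonneg h1 hs.le]

/-- A factor `|x| ^ (s - 1)` of the thickness cancels the singularity and leaves the profile of
`integrable_gapBound`. The remaining factor `|x| ^ (β - s + 1)` has a nonnegative exponent and is
bounded by its value at `r`. -/
theorem stripBound_kernelGap {s m β r a c d : ℝ} (hs : 2 < s) (hm : 0 ≤ m) (hβ : s - 1 ≤ β)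
    (hd : 0 < d) (hd1 : d < 1) (hr0 : 0 < r) (hr : r ≤ 1) :
    Integrable (stripBound m β r a c (kernelGap s d)) ∧
      ∫ v, stripBound m β r a c (kernelGap s d) v ≤
        (8 + 4 * s) * (m * r ^ (β - s + 1)) * (d * (1 - Real.log d)) := by
  have hb := integrable_gapBound (s := s) (μ := m * r ^ (β - s + 1)) (by linarith) hd hd1
    (by positivity) hr
  have h := integrable_indicator_thinSet (m := m) (β := β) (a := a) (c := c) (r := r)
    (g := kernelGap s d) hm (by unfold kernelGap; fun_prop)
    (fun x => by unfold kernelGap; positivity) hb.1 (fun x hx => by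
      have hxr : |x| ≤ r := abs_le.2 ⟨hx.1.le, hx.2.le⟩
      rcases (abs_nonneg x).eq_or_lt with h | h
      · rw [← h]
        have : kernelGap s d x = 0 := by
          rw [kernelGap, ← h, Real.zero_rpow (by linarith), Real.zero_rpow (by linarith)]; simp
        rw [this, zero_mul, if_pos hd.le]
        positivity
      · have e1 : |x| ^ β = |x| ^ (s - 1) * |x| ^ (β - s + 1) := by
          rw [← Real.rpow_add h]; congr 1; ring
        have e2 : |x| ^ (β - s + 1) ≤ r ^ (β - s + 1) :=
          Real.rpow_le_rpow h.le hxr (by linarith)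
        have e3 : kernelGap s d x * |x| ^ (s - 1) ≤ if |x| ≤ d then 2 else s * d * |x|⁻¹ := by
          split_ifs
          · calc kernelGap s d x * |x| ^ (s - 1) ≤ 2 * |x| ^ (1 - s) * |x| ^ (s - 1) := by
                  gcongr; exact min_le_left _ _
              _ = 2 := by rw [mul_assoc, ← Real.rpow_add h]; simp
          · calc kernelGap s d x * |x| ^ (s - 1) ≤ s * d * |x| ^ (-s) * |x| ^ (s - 1) := by
                  gcongr; exact min_le_right _ _
              _ = s * d * |x|⁻¹ := by
                  rw [mul_assoc, ← Real.rpow_add h, show -s + (s - 1) = -1 by ring,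
                    Real.rpow_neg_one]
        have e4 : 0 ≤ kernelGap s d x := by unfold kernelGap; positivity
        calc kernelGap s d x * (2 * (m * |x| ^ β))
            = 2 * (m * |x| ^ (β - s + 1)) * (kernelGap s d x * |x| ^ (s - 1)) := by
              rw [e1]; ring
          _ ≤ 2 * (m * r ^ (β - s + 1)) * (if |x| ≤ d then 2 else s * d * |x|⁻¹) := by
              gcongr)
  exact ⟨h.1, h.2.trans hb.2⟩

/-- The constant in the estimate of the velocity difference. -/
noncomputable def velocityConst (s : ℝ) : ℝ :=
  s * 2 ^ s * 2 * (∫ v : ℝ × ℝ, (1 + ‖v‖) ^ (-s)) + 2 * (8 + 4 * s)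

theorem velocityConst_nonneg {s : ℝ} (hs : 0 < s) : 0 ≤ velocityConst s := by
  have : 0 ≤ ∫ v : ℝ × ℝ, (1 + ‖v‖) ^ (-s) := integral_nonneg fun v => by positivity
  unfold velocityConst; positivity

/-- The velocity difference of two points at distance `d` on a common normal line. -/
theorem abs_sub_le_of_symmetricNear {W : ℝ × ℝ → ℝ} {m β r a₁ a₂ c₁ c₂ d Θ s w₁ w₂ : ℝ}
    (h₁ : SymmetricNear W m β r a₁ c₁ a₂ c₂ c₁) (h₂ : SymmetricNear W m β r a₁ c₁ a₂ c₂ c₂)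
    (hW : ∀ v, |W v| ≤ Θ) (hWi : Integrable W) (hs : 2 < s) (hm : 0 ≤ m) (hβ : s - 1 ≤ β)
    (hr0 : 0 < r) (hr : r ≤ 1) (hd : 0 < d) (hd1 : d < 1) (hc : |c₁ - c₂| = d)
    (hw₁ : Tendsto (truncated s c₁ W) (𝓝[>] 0) (𝓝 w₁))
    (hw₂ : Tendsto (truncated s c₂ W) (𝓝[>] 0) (𝓝 w₂)) :
    |w₁ - w₂| ≤ velocityConst s * Θ * (r ^ (2 - s) + m * r ^ (β - s + 1)) *
      (d * (1 - Real.log d)) := by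
  have hs1 : 1 ≤ s := by linarith
  have hΘ : 0 ≤ Θ := (abs_nonneg _).trans (hW 0)
  rw [tendsto_nhds_unique hw₁ (h₁.tendsto_truncated hW hWi hs1 hm hβ hr0 hr),
    tendsto_nhds_unique hw₂ (h₂.tendsto_truncated hW hWi hs1 hm hβ hr0 hr), ← mul_sub,
    ← integral_sub (h₁.integrable hW hWi hs1 hm hβ hr0 hr)
      (h₂.integrable hW hWi hs1 hm hβ hr0 hr)]
  set g := kernelGap s d with hg_def
  have hg : ∀ x, 0 ≤ g x := fun x => by simp only [hg_def, kernelGap]; positivity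
  obtain ⟨i1, b1⟩ := stripBound_kernelGap (a := a₁) (c := c₁) hs hm hβ hd hd1 hr0 hr
  obtain ⟨i2, b2⟩ := stripBound_kernelGap (a := a₂) (c := c₂) hs hm hβ hd hd1 hr0 hr
  obtain ⟨f1, e1⟩ := integrable_farBound (c := c₁) hs hr0
  obtain ⟨f2, e2⟩ := integrable_farBound (c := c₂) hs hr0
  have hb : |∫ v, (ker s c₁ v * oddPart W v - ker s c₂ v * oddPart W v)| ≤
      ∫ v, (2 * Θ * (stripBound m β r a₁ c₁ g v + stripBound m β r a₂ c₂ g v) +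
        2 * Θ * (s * d) * (farBound s r c₁ v + farBound s r c₂ v)) := by
    rw [← Real.norm_eq_abs]
    refine norm_integral_le_of_norm_le (((i1.add i2).const_mul _).add ((f1.add f2).const_mul _))
      (ae_of_all _ fun v => ?_)
    rw [← sub_mul, Real.norm_eq_abs]
    have p1 := stripBound_nonneg (m := m) (β := β) (r := r) (a := a₁) (c := c₁) hg v
    have p2 := stripBound_nonneg (m := m) (β := β) (r := r) (a := a₂) (c := c₂) hg v
    have q1 := farBound_nonneg (s := s) (c := c₁) hr0 v
    have q2 := farBound_nonneg (s := s) (c := c₂) hr0 v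
    have hker : |ker s c₁ v - ker s c₂ v| ≤ g v.1 := by
      refine le_min ?_ ?_
      · refine (abs_sub _ _).trans ?_
        linarith [abs_ker_le_abs hs1 c₁ v, abs_ker_le_abs hs1 c₂ v]
      · rw [← hc]; exact abs_ker_sub_ker_le_abs (by linarith)
    have hfar : 0 ≤ 2 * Θ * (s * d) * (farBound s r c₁ v + farBound s r c₂ v) := by positivity
    by_cases hv1 : rad c₁ v < r
    · exact (h₁.abs_mul_oddPart_le hW hg hker hv1).trans (by linarith)
    by_cases hv2 : rad c₂ v < r
    · exact (h₂.abs_mul_oddPart_le hW hg hker hv2).trans (by linarith)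
    push Not at hv1 hv2
    have hk := abs_ker_sub_ker_le_rad (s := s) (by linarith) (hr0.trans_le hv1) (hr0.trans_le hv2)
    rw [hc] at hk
    have r1 := rad_rpow_le_farBound (s := s) (by linarith) hr0 hv1
    have r2 := rad_rpow_le_farBound (s := s) (by linarith) hr0 hv2
    rw [abs_mul]
    have hfin : |ker s c₁ v - ker s c₂ v| * |oddPart W v| ≤
        s * d * (farBound s r c₁ v + farBound s r c₂ v) * (2 * Θ) := by
      refine mul_le_mul (hk.trans ?_) (abs_oddPart_le hW v) (abs_nonneg _) (by positivity)
      gcongr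
    have : 0 ≤ 2 * Θ * (stripBound m β r a₁ c₁ g v + stripBound m β r a₂ c₂ g v) := by positivity
    linarith
  have i12 : Integrable fun v => 2 * Θ * (stripBound m β r a₁ c₁ g v + stripBound m β r a₂ c₂ g v) :=
    (i1.add i2).const_mul _
  have f12 : Integrable fun v => 2 * Θ * (s * d) * (farBound s r c₁ v + farBound s r c₂ v) :=
    (f1.add f2).const_mul _
  rw [integral_add i12 f12, integral_const_mul,
    integral_const_mul, integral_add i1 i2, integral_add f1 f2, e1, e2] at hb
  rw [abs_mul, abs_of_pos (by norm_num : (0:ℝ) < 1 / 2)]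
  set J := ∫ v : ℝ × ℝ, (1 + ‖v‖) ^ (-s) with hJ
  have hJ0 : 0 ≤ J := integral_nonneg fun v => by positivity
  set A := r ^ (2 - s) with hA
  set B := m * r ^ (β - s + 1) with hB
  have hA0 : 0 ≤ A := by positivity
  have hB0 : 0 ≤ B := by positivity
  set D := d * (1 - Real.log d) with hD
  have hdD : d ≤ D := by
    have := Real.log_neg hd hd1
    simp only [hD]; nlinarith
  have hD0 : 0 ≤ D := hd.le.trans hdD
  have k1 : 2 * Θ * ((∫ v, stripBound m β r a₁ c₁ g v) + ∫ v, stripBound m β r a₂ c₂ g v) ≤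
      2 * Θ * (2 * ((8 + 4 * s) * B * D)) :=
    mul_le_mul_of_nonneg_left (by linarith) (by positivity)
  have k2 : 2 * Θ * (s * d) * (2 ^ s * J * A + 2 ^ s * J * A) ≤
      2 * Θ * (s * D) * (2 ^ s * J * A + 2 ^ s * J * A) := by gcongr
  -- A single constant serves for both contributions; the two cross terms are nonnegative and are
  -- dropped.
  have k3 : velocityConst s * Θ * (A + B) * D = 1 / 2 * (2 * Θ * (2 * ((8 + 4 * s) * B * D)) +
      2 * Θ * (s * D) * (2 ^ s * J * A + 2 ^ s * J * A)) +
      (s * 2 ^ s * 2 * J * Θ * B * D + 2 * (8 + 4 * s) * Θ * A * D) := by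
    rw [velocityConst]; ring
  have k4 : 0 ≤ s * 2 ^ s * 2 * J * Θ * B * D + 2 * (8 + 4 * s) * Θ * A * D := by positivity
  rw [k3]
  linarith

/-! ### Reflection symmetry of the patches near two parabolas -/

/-- Put `q = |y| / |x|`. If `β ≥ 2` then `q ^ β ≤ q ^ 2`, so the gap at `y` is at least `(1 - q ^ 2)
(c₁ - c₂)` plus `q ^ 2` times the gap at `x`, a convex combination of positive numbers. For equal
curvatures the gap can only widen towards the axis. -/
theorem gap_pos {m β a₁ a₂ c₁ c₂ x y : ℝ} (hm : 0 ≤ m) (hβ : 0 < β) (ha : a₂ ≤ a₁)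
    (hne : a₁ = a₂ ∨ (c₂ < c₁ ∧ 2 ≤ β)) (hxy : |y| ≤ |x|)
    (hx : 0 < c₁ + a₁ / 2 * x ^ 2 - m * |x| ^ β - (c₂ + a₂ / 2 * x ^ 2 + m * |x| ^ β)) :
    0 < c₁ + a₁ / 2 * y ^ 2 - m * |y| ^ β - (c₂ + a₂ / 2 * y ^ 2 + m * |y| ^ β) := by
  rcases hne with rfl | ⟨hc, hβ2⟩
  · have h1 : |y| ^ β ≤ |x| ^ β := Real.rpow_le_rpow (abs_nonneg _) hxy hβ.le
    nlinarith
  rcases (abs_nonneg x).eq_or_lt with h0 | h0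
  · have hx0 : x = 0 := abs_eq_zero.1 h0.symm
    have hy0 : y = 0 := abs_nonpos_iff.1 (hxy.trans h0.symm.le)
    rw [hx0] at hx
    rwa [hy0]
  set q := |y| / |x| with hq
  have hq0 : 0 ≤ q := by positivity
  have hq1 : q ≤ 1 := (div_le_one h0).2 hxy
  have hyq : |y| = q * |x| := by rw [hq]; field_simp
  have e1 : |y| ^ β = q ^ β * |x| ^ β := by rw [hyq, Real.mul_rpow hq0 h0.le]
  have e2 : y ^ 2 = q ^ 2 * x ^ 2 := by rw [← sq_abs y, hyq, mul_pow, sq_abs]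
  have e3 : q ^ β ≤ q ^ 2 := by
    rcases hq0.eq_or_lt with h | h
    · rw [← h, Real.zero_rpow hβ.ne']; norm_num
    · rw [← Real.rpow_natCast]
      exact Real.rpow_le_rpow_of_exponent_ge h hq1 (by simpa using hβ2)
  have e4 : m * |x| ^ β * q ^ β ≤ m * |x| ^ β * q ^ 2 :=
    mul_le_mul_of_nonneg_left e3 (by positivity)
  have e5 : q ^ 2 ≤ 1 := pow_le_one₀ hq0 hq1
  rw [e1, e2]
  rcases hq1.eq_or_lt with h | h
  · rw [h]; simpa using hx
  · have : q ^ 2 < 1 := by nlinarith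
    nlinarith [sq_nonneg q]

theorem abs_quadratic_sub_le {a x y : ℝ} (hxy : |y| ≤ |x|) :
    |a / 2 * y ^ 2 - a / 2 * x ^ 2| ≤ |a| / 2 * x ^ 2 := by
  have h : y ^ 2 ≤ x ^ 2 := sq_le_sq.2 hxy
  rw [← mul_sub, abs_mul, abs_div, abs_two]
  refine mul_le_mul_of_nonneg_left ?_ (by positivity)
  rw [abs_le]; constructor <;> nlinarith [sq_nonneg y]

theorem abs_thickness_sub_le {m β x y : ℝ} (hm : 0 ≤ m) (hβ : 0 < β) (hxy : |y| ≤ |x|) :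
    |m * |y| ^ β - m * |x| ^ β| ≤ m * |x| ^ β := by
  have h1 : m * |y| ^ β ≤ m * |x| ^ β :=
    mul_le_mul_of_nonneg_left (Real.rpow_le_rpow (abs_nonneg _) hxy hβ.le) hm
  have h2 : 0 ≤ m * |y| ^ β := by positivity
  rw [abs_le]; constructor <;> linarith

/-- A point away from the neighbourhoods of two parabolas, the first of which is above the second
one, can be joined with its mirror image by a graph which avoids these neighbourhoods. -/
theorem exists_graph_avoiding {m β a₁ a₂ c₁ c₂ x h : ℝ} (hm : 0 ≤ m) (hβ : 0 < β) (ha : a₂ ≤ a₁)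
    (hc : c₂ ≤ c₁) (hne : a₁ = a₂ ∨ (c₂ < c₁ ∧ 2 ≤ β)) (h₁ : (x, h) ∉ thinSet m β a₁ c₁)
    (h₂ : (x, h) ∉ thinSet m β a₂ c₂) :
    ∃ φ : ℝ → ℝ, Continuous φ ∧ φ x = h ∧ φ (-x) = h ∧ ∀ y, |y| ≤ |x| →
      (y, φ y) ∉ thinSet m β a₁ c₁ ∧ (y, φ y) ∉ thinSet m β a₂ c₂ ∧
      |φ y - h| ≤ (|a₁| + |a₂|) * x ^ 2 + 4 * (m * |x| ^ β) := by
  have mem : ∀ a c y z, (y, z) ∉ thinSet m β a c ↔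
      (c + a / 2 * y ^ 2 + m * |y| ^ β < z ∨ z < c + a / 2 * y ^ 2 - m * |y| ^ β) := by
    intro a c y z
    rw [thinSet, mem_ofPred_eq, not_le, lt_abs]
    constructor <;> rintro (H | H)
    · left; linarith
    · right; linarith
    · left; linarith
    · right; linarith
  have hM : Continuous fun y : ℝ => m * |y| ^ β :=
    continuous_const.mul (continuous_abs.rpow_const fun _ => Or.inr hβ.le)
  have hM0 : ∀ y, 0 ≤ m * |y| ^ β := fun y => by positivity
  have hord : ∀ y : ℝ, c₂ + a₂ / 2 * y ^ 2 ≤ c₁ + a₁ / 2 * y ^ 2 := fun y => by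
    nlinarith [sq_nonneg y]
  have hq : 0 ≤ |a₁| * x ^ 2 := by positivity
  have hq' : 0 ≤ |a₂| * x ^ 2 := by positivity
  rw [mem] at h₁ h₂
  by_cases hA : c₁ + a₁ / 2 * x ^ 2 + m * |x| ^ β < h
  -- Above both sets: follow the top edge of the upper one at constant vertical distance. The order
  -- of the parabolas (`hord`) keeps the graph above the lower set too.
  · refine ⟨fun y => c₁ + a₁ / 2 * y ^ 2 + m * |y| ^ β + (h - (c₁ + a₁ / 2 * x ^ 2 + m * |x| ^ β)),
      by fun_prop, by ring, by simp, fun y hy => ⟨?_, ?_, ?_⟩⟩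
    · rw [mem]; left; linarith
    · rw [mem]; left; linarith [hord y]
    · have e1 := abs_le.1 (abs_quadratic_sub_le (a := a₁) hy)
      have e2 := abs_le.1 (abs_thickness_sub_le hm hβ hy)
      rw [abs_le]
      constructor <;> linarith [hM0 x]
  by_cases hB : h < c₂ + a₂ / 2 * x ^ 2 - m * |x| ^ β
  · refine ⟨fun y => c₂ + a₂ / 2 * y ^ 2 - m * |y| ^ β + (h - (c₂ + a₂ / 2 * x ^ 2 - m * |x| ^ β)),
      by fun_prop, by ring, by simp, fun y hy => ⟨?_, ?_, ?_⟩⟩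
    · rw [mem]; right; linarith [hord y]
    · rw [mem]; right; linarith
    · have e1 := abs_le.1 (abs_quadratic_sub_le (a := a₂) hy)
      have e2 := abs_le.1 (abs_thickness_sub_le hm hβ hy)
      rw [abs_le]
      constructor <;> linarith [hM0 x]
  have h1 := h₁.resolve_left hA
  have h2 := h₂.resolve_right hB
  set G : ℝ → ℝ := fun y => c₁ + a₁ / 2 * y ^ 2 - m * |y| ^ β - (c₂ + a₂ / 2 * y ^ 2 + m * |y| ^ β)
    with hG
  have hGx : 0 < G x := by simp only [hG]; linarith
  -- Between the two sets: the graph divides the gap in the fixed ratio `l : 1 - l`, determined at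
  -- `x`.
  set l := (c₁ + a₁ / 2 * x ^ 2 - m * |x| ^ β - h) / G x with hl
  have hl0 : 0 < l := div_pos (by linarith) hGx
  have hl1 : l < 1 := (div_lt_one hGx).2 (by simp only [hG]; linarith)
  have hlG : l * G x = c₁ + a₁ / 2 * x ^ 2 - m * |x| ^ β - h := by rw [hl]; field_simp
  have hGneg : G (-x) = G x := by simp [hG]
  refine ⟨fun y => c₁ + a₁ / 2 * y ^ 2 - m * |y| ^ β - l * G y, by fun_prop, by linarith, ?_,
    fun y hy => ⟨?_, ?_, ?_⟩⟩
  · simp only [hGneg, hlG, abs_neg, even_two, Even.neg_pow]; ring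
  · have hGy : 0 < G y := gap_pos hm hβ ha hne hy hGx
    rw [mem]; right; nlinarith
  · have hGy : 0 < G y := gap_pos hm hβ ha hne hy hGx
    rw [mem]; left
    have : l * G y < G y := by nlinarith
    simp only [hG] at this ⊢; linarith
  · have e1 := abs_le.1 (abs_quadratic_sub_le (a := a₁) hy)
    have e3 := abs_le.1 (abs_quadratic_sub_le (a := a₂) hy)
    have e2 := abs_le.1 (abs_thickness_sub_le hm hβ hy)
    have e4 : |G y - G x| ≤ |a₁| / 2 * x ^ 2 + |a₂| / 2 * x ^ 2 + 2 * (m * |x| ^ β) := by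
      simp only [hG]
      rw [abs_le]; constructor <;> linarith
    have e5 : |l * (G y - G x)| ≤ |a₁| / 2 * x ^ 2 + |a₂| / 2 * x ^ 2 + 2 * (m * |x| ^ β) := by
      rw [abs_mul, abs_of_pos hl0]
      nlinarith [abs_nonneg (G y - G x)]
    have e6 := abs_le.1 e5
    have e7 : c₁ + a₁ / 2 * y ^ 2 - m * |y| ^ β - l * G y - h =
        (a₁ / 2 * y ^ 2 - a₁ / 2 * x ^ 2) - (m * |y| ^ β - m * |x| ^ β) - l * (G y - G x) := by
      linarith
    rw [e7, abs_le]
    constructor <;> linarith [hM0 x]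

/-- A function that is locally constant away from a set `I` is symmetric near `(0, c)` if `I` is
contained in the neighbourhoods of two parabolas there. -/
theorem symmetricNear_of_subset {I : Set (ℝ × ℝ)} {W : ℝ × ℝ → ℝ} {m β r a₁ c₁ a₂ c₂ c : ℝ}
    (hW : ∀ S : Set (ℝ × ℝ), IsPreconnected S → Disjoint S I → ∀ v ∈ S, ∀ w ∈ S, W v = W w)
    (hI : ∀ v ∈ I, rad c v < 4 * r → v ∈ thinSet m β a₁ c₁ ∨ v ∈ thinSet m β a₂ c₂)
    (hr : 0 < r) (hm : 0 ≤ m) (hβ : 1 ≤ β) (ha : a₂ ≤ a₁)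
    (hc : c₂ ≤ c₁) (hne : a₁ = a₂ ∨ (c₂ < c₁ ∧ 2 ≤ β)) (har : (|a₁| + |a₂|) * r ≤ 1 / 2)
    (hmr : 8 * (m * r ^ (β - 1)) ≤ 1) :
    SymmetricNear W m β r a₁ c₁ a₂ c₂ c := by
  rintro ⟨x, h⟩ hv h1 h2
  obtain ⟨φ, hφc, hφx, hφx', hφ⟩ := exists_graph_avoiding hm (by linarith) ha hc hne h1 h2
  have hxr : |x| < r := (abs_fst_le_rad c _).trans_lt hv
  have hhr : |h - c| < r := (abs_snd_sub_le_rad c (x, h)).trans_lt hv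
  -- Half of `r` is allotted to the curvature and half to the thickness. The graph then stays within
  -- `3 * r` of the centre, where `hI` applies.
  have hbound : (|a₁| + |a₂|) * x ^ 2 + 4 * (m * |x| ^ β) ≤ r := by
    have b1 : (|a₁| + |a₂|) * x ^ 2 ≤ 1 / 2 * r := by
      have : x ^ 2 ≤ r * r := by rw [← sq_abs]; nlinarith [abs_nonneg x]
      calc (|a₁| + |a₂|) * x ^ 2 ≤ (|a₁| + |a₂|) * (r * r) := by gcongr
        _ = (|a₁| + |a₂|) * r * r := by ring
        _ ≤ 1 / 2 * r := by gcongr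
    have b2 : |x| ^ β ≤ r ^ (β - 1) * r := by
      have : r ^ (β - 1) * r = r ^ β := by
        rw [Real.rpow_sub hr, Real.rpow_one]; field_simp
      rw [this]
      exact Real.rpow_le_rpow (abs_nonneg _) hxr.le (by linarith)
    have b3 : m * |x| ^ β ≤ m * (r ^ (β - 1) * r) := mul_le_mul_of_nonneg_left b2 hm
    nlinarith
  have hS : IsPreconnected ((fun y => (y, φ y)) '' Icc (-|x|) |x|) :=
    isPreconnected_Icc.image _ (by fun_prop)
  have hdis : Disjoint ((fun y => (y, φ y)) '' Icc (-|x|) |x|) I := by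
    rw [Set.disjoint_left]
    rintro _ ⟨y, hy, rfl⟩ hyI
    have hy' : |y| ≤ |x| := abs_le.2 hy
    obtain ⟨n1, n2, n3⟩ := hφ y hy'
    have hrad : rad c (y, φ y) < 4 * r := by
      refine (rad_le_add c _).trans_lt ?_
      have : |φ y - c| ≤ |φ y - h| + |h - c| := abs_sub_le _ _ _
      simp only
      linarith
    rcases hI _ hyI hrad with H | H
    · exact n1 H
    · exact n2 H
  have key := hW _ hS hdis (x, h) ⟨x, ⟨neg_abs_le x, le_abs_self x⟩, by simp [hφx]⟩ (-x, h)
    ⟨-x, ⟨neg_le_neg (le_abs_self x), (neg_le_abs x)⟩, by simp [hφx']⟩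
  rw [oddPart, flip, key, sub_self]

/-! ### Frames -/

theorem perp_add (v w : Plane) : perp (v + w) = perp v + perp w := by
  ext i; fin_cases i
  · simp [perp]
  · simp [perp]; ring

theorem perp_smul (a : ℝ) (v : Plane) : perp (a • v) = a • perp v := by
  ext i; fin_cases i <;> simp [perp]

theorem perp_perp (v : Plane) : perp (perp v) = -v := by
  ext i; fin_cases i <;> simp [perp]

theorem plane_inner (v w : Plane) : inner ℝ v w = v 0 * w 0 + v 1 * w 1 := by
  rw [PiLp.inner_apply, Fin.sum_univ_two]; simp [mul_comm]

theorem inner_perp_perp (v w : Plane) : inner ℝ (perp v) (perp w) = inner ℝ v w := by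
  simp [plane_inner, perp]; ring

theorem inner_perp_self (v : Plane) : inner ℝ (perp v) v = 0 := by
  simp [plane_inner, perp]; ring

theorem norm_perp (v : Plane) : ‖perp v‖ = ‖v‖ := by
  rw [norm_eq_sqrt_real_inner, inner_perp_perp, ← norm_eq_sqrt_real_inner]

theorem continuous_perp : Continuous perp := by
  unfold perp; fun_prop

/-- Coordinates with origin `p` and vertical axis `e`. -/
noncomputable def frame (p e : Plane) (v : ℝ × ℝ) : Plane := p + (v.1 • perp e + v.2 • e)

theorem continuous_frame (p e : Plane) : Continuous (frame p e) := by unfold frame; fun_prop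

theorem norm_frame_sub {e : Plane} (he : ‖e‖ = 1) (p : Plane) (c : ℝ) (v : ℝ × ℝ) :
    ‖frame p e (0, c) - frame p e v‖ = rad c v := by
  rw [rad, norm_eq_sqrt_real_inner]
  congr 1
  have h1 : frame p e (0, c) - frame p e v = (-v.1) • perp e + (c - v.2) • e := by
    simp only [frame]; module
  have h2 : inner ℝ e (perp e) = 0 := by rw [real_inner_comm, inner_perp_self]
  rw [h1]
  simp only [inner_add_left, inner_add_right, inner_smul_left, inner_smul_right,
    inner_perp_self, h2, real_inner_self_eq_norm_sq, norm_perp, he]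
  simp; ring

theorem inner_perp_frame_sub {e : Plane} (he : ‖e‖ = 1) (p : Plane) (c : ℝ) (v : ℝ × ℝ) :
    inner ℝ (perp (frame p e (0, c) - frame p e v)) e = v.1 := by
  have h1 : frame p e (0, c) - frame p e v = (-v.1) • perp e + (c - v.2) • e := by
    simp only [frame]; module
  rw [h1, perp_add, perp_smul, perp_smul, perp_perp, inner_add_left, inner_smul_left,
    inner_smul_left, inner_perp_self, inner_neg_left, real_inner_self_eq_norm_sq, he]
  simp

theorem orthonormal_perp {e : Plane} (he : ‖e‖ = 1) : Orthonormal ℝ ![perp e, e] := by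
  rw [orthonormal_iff_ite]
  have h2 : inner ℝ e (perp e) = 0 := by rw [real_inner_comm, inner_perp_self]
  intro i j
  fin_cases i <;> fin_cases j <;>
    simp [norm_perp, he, inner_perp_self, h2]

theorem eq_inner_smul_add {e : Plane} (he : ‖e‖ = 1) (v : Plane) :
    v = (inner ℝ v (perp e)) • perp e + (inner ℝ v e) • e := by
  have h : e 0 ^ 2 + e 1 ^ 2 = 1 := by
    have := real_inner_self_eq_norm_sq e
    rw [he, plane_inner] at this; linarith
  ext i
  fin_cases i
  · simp [plane_inner, perp]; linear_combination (-(v 0)) * h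
  · simp [plane_inner, perp]; linear_combination (-(v 1)) * h

theorem measurePreserving_frame {e : Plane} (he : ‖e‖ = 1) (p : Plane) :
    MeasurePreserving (frame p e) := by
  have hcard : Fintype.card (Fin 2) = Module.finrank ℝ Plane := by simp
  set b := basisOfOrthonormalOfCardEqFinrank (orthonormal_perp he) hcard with hb
  have hbo : Orthonormal ℝ b := by
    rw [hb, coe_basisOfOrthonormalOfCardEqFinrank]; exact orthonormal_perp he
  have h1 := (b.toOrthonormalBasis hbo).measurePreserving_repr_symm
  have h2 := PiLp.volume_preserving_toLp (Fin 2)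
  have h3 := (volume_preserving_finTwoArrow ℝ).symm
  have h4 := (measurePreserving_add_left (volume : Measure Plane) p).comp
    ((h1.comp h2).comp h3)
  convert! h4 using 1
  ext1 v
  simp only [Function.comp, frame]
  congr 1
  rw [← OrthonormalBasis.sum_repr_symm, Fin.sum_univ_two]
  simp [hb, MeasurableEquiv.finTwoArrow]

theorem measurableEmbedding_frame {e : Plane} (he : ‖e‖ = 1) (p : Plane) :
    MeasurableEmbedding (frame p e) := by
  refine (continuous_frame p e).measurableEmbedding fun v w h => ?_
  have h1 := norm_frame_sub he p w.2 v
  have h2 := norm_frame_sub he p w.2 w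
  have i1 := inner_perp_frame_sub he p w.2 v
  have i2 := inner_perp_frame_sub he p w.2 w
  rw [h] at h1 i1
  have e1 : v.1 = w.1 := i1.symm.trans i2
  have e2 := h1.symm.trans h2
  rw [rad, rad, Real.sqrt_inj (by positivity) (by positivity), e1] at e2
  have e3 : (v.2 - w.2) ^ 2 = 0 := by linarith
  exact Prod.ext e1 (by linarith [pow_eq_zero_iff (two_ne_zero) |>.1 e3])

theorem truncatedVelocity_frame {e : Plane} (he : ‖e‖ = 1) (α : ℝ) (ω : Plane → ℝ) (p : Plane)
    (c : ℝ) (ε : ℝ) :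
    truncatedVelocity α ω (frame p e (0, c)) e ε =
      truncated (2 + 2 * α) c (fun v => ω (frame p e v)) ε := by
  rw [truncatedVelocity, truncated, ← (measurePreserving_frame he p).setIntegral_preimage_emb
    (measurableEmbedding_frame he p)]
  simp only [preimage_ofPred_eq, norm_frame_sub he, inner_perp_frame_sub he, ker]

/-! ### Closed curves -/

theorem IsArcLengthParam.continuous {Γ : Set Plane} {L : ℝ} {y : ℝ → Plane}
    (h : IsArcLengthParam Γ L y) : Continuous y := h.contDiff.continuous

theorem IsArcLengthParam.hasDerivAt {Γ : Set Plane} {L : ℝ} {y : ℝ → Plane}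
    (h : IsArcLengthParam Γ L y) (s : ℝ) : HasDerivAt y (deriv y s) s :=
  (h.contDiff.differentiable one_ne_zero s).hasDerivAt

theorem IsArcLengthParam.continuous_deriv {Γ : Set Plane} {L : ℝ} {y : ℝ → Plane}
    (h : IsArcLengthParam Γ L y) : Continuous (deriv y) := h.contDiff.continuous_deriv le_rfl

theorem IsArcLengthParam.dist_le {Γ : Set Plane} {L : ℝ} {y : ℝ → Plane}
    (h : IsArcLengthParam Γ L y) (s r : ℝ) : dist (y s) (y r) ≤ |s - r| := by
  have := convex_univ.norm_image_sub_le_of_norm_deriv_le (f := y) (C := 1) (x := r) (y := s)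
    (fun u _ => (h.hasDerivAt u).differentiableAt) (fun u _ => (h.unit_speed u).le)
    (mem_univ _) (mem_univ _)
  rw [dist_eq_norm]; simpa using this

theorem IsArcLengthParam.exists_int {Γ : Set Plane} {L : ℝ} {y : ℝ → Plane}
    (h : IsArcLengthParam Γ L y) {s r : ℝ} (hsr : y s = y r) : ∃ n : ℤ, s = r + n * L := by
  have e : ∀ s, y (toIcoMod h.length_pos 0 s) = y s := fun s => by
    rw [toIcoMod]
    exact h.periodic.sub_zsmul_eq _
  have m : ∀ s, toIcoMod h.length_pos 0 s ∈ Ico 0 L := fun s => by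
    simpa using toIcoMod_mem_Ico h.length_pos 0 s
  have h1 := h.injOn (m s) (m r) (by rw [e, e, hsr])
  rw [toIcoMod, toIcoMod] at h1
  refine ⟨toIcoDiv h.length_pos 0 s - toIcoDiv h.length_pos 0 r, ?_⟩
  simp only [zsmul_eq_mul] at h1
  push_cast
  linarith

theorem IsArcLengthParam.exists_mem_Ico {Γ : Set Plane} {L : ℝ} {y : ℝ → Plane}
    (h : IsArcLengthParam Γ L y) (s : ℝ) : ∃ n : ℤ, s + n * L ∈ Ico 0 L ∧ y (s + n * L) = y s := by
  refine ⟨-toIcoDiv h.length_pos 0 s, ?_, ?_⟩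
  · have := toIcoMod_mem_Ico h.length_pos 0 s
    rw [toIcoMod] at this
    simpa [sub_eq_add_neg] using this
  · simpa using h.periodic.zsmul (-toIcoDiv h.length_pos 0 s) s

theorem IsArcLengthParam.add_int_mul {Γ : Set Plane} {L : ℝ} {y : ℝ → Plane}
    (h : IsArcLengthParam Γ L y) (n : ℤ) (s : ℝ) : y (s + n * L) = y s := by
  simpa using h.periodic.zsmul n s

theorem IsArcLengthParam.isCompact {Γ : Set Plane} {L : ℝ} {y : ℝ → Plane}
    (h : IsArcLengthParam Γ L y) : IsCompact Γ := by
  have : Γ = y '' Icc 0 L := by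
    rw [← h.range_eq]
    refine Subset.antisymm ?_ (image_subset_range _ _)
    rintro _ ⟨s, rfl⟩
    obtain ⟨n, hn, hy⟩ := h.exists_mem_Ico s
    exact ⟨_, Ico_subset_Icc_self hn, hy⟩
  rw [this]
  exact isCompact_Icc.image h.continuous

theorem IsArcLengthParam.isPreconnected {Γ : Set Plane} {L : ℝ} {y : ℝ → Plane}
    (h : IsArcLengthParam Γ L y) : IsPreconnected Γ := by
  rw [← h.range_eq]; exact isPreconnected_range h.continuous

theorem IsArcLengthParam.mem {Γ : Set Plane} {L : ℝ} {y : ℝ → Plane}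
    (h : IsArcLengthParam Γ L y) (s : ℝ) : y s ∈ Γ := by
  rw [← h.range_eq]; exact mem_range_self s

/-- Ultrafilters replace subsequences: along a single one all bounded families converge at once, and
choices from a finite set become constant. -/
theorem exists_tendsto_ultrafilter {ι X : Type*} [TopologicalSpace X] {K : Set X}
    (hK : IsCompact K) (U : Ultrafilter ι) {f : ι → X} (hf : ∀ᶠ n in (U : Filter ι), f n ∈ K) :
    ∃ a ∈ K, Tendsto f U (𝓝 a) := by
  obtain ⟨a, ha, h⟩ := hK.ultrafilter_le_nhds' (U.map f) hf
  exact ⟨a, ha, h⟩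

theorem exists_eventually_eq_ultrafilter {ι F : Type*} [Finite F] (U : Ultrafilter ι)
    (f : ι → F) : ∃ a, ∀ᶠ n in (U : Filter ι), f n = a := by
  have h : ∀ᶠ n in (U : Filter ι), ∃ a : F, f n = a := Eventually.of_forall fun n => ⟨_, rfl⟩
  exact Ultrafilter.eventually_exists_iff.1 h

/-- Points of a finite family of disjoint closed curves which are close in the plane are close along
one of the curves. -/
theorem exists_strand_radius {N : ℕ} {Γ : Fin N → Set Plane} {L : Fin N → ℝ}
    {y : Fin N → ℝ → Plane} (h : ∀ i, IsArcLengthParam (Γ i) (L i) (y i))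
    (hd : ∀ i j, i ≠ j → Disjoint (Γ i) (Γ j)) {δ : ℝ} (hδ : 0 < δ) :
    ∃ r₀ > 0, ∀ i j s r, dist (y i s) (y j r) < r₀ → i = j ∧ ∃ n : ℤ, |s + n * L i - r| < δ := by
  -- Counterexamples at distance below `1 / (m + 1)` would converge to a common point of two curves.
  -- By disjointness the curves agree, and by injectivity modulo the period the parameters are close
  -- after a shift by periods.
  by_contra! hcon
  have hcon' : ∀ m : ℕ, ∃ i j s r, dist (y i s) (y j r) < 1 / ((m : ℝ) + 1) ∧
      (i = j → ∀ n : ℤ, δ ≤ |s + n * L i - r|) := fun m => hcon _ Nat.one_div_pos_of_nat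
  choose i j s r hdist hbad using hcon'
  set U : Ultrafilter ℕ := hyperfilter ℕ
  obtain ⟨i₀, hi⟩ := exists_eventually_eq_ultrafilter U i
  obtain ⟨j₀, hj⟩ := exists_eventually_eq_ultrafilter U j
  choose n hn hyn using fun m => (h (i m)).exists_mem_Ico (s m)
  choose n' hn' hyn' using fun m => (h (j m)).exists_mem_Ico (r m)
  obtain ⟨s₀, -, hs⟩ := exists_tendsto_ultrafilter (isCompact_Icc (a := 0) (b := L i₀)) U
    (f := fun m => s m + n m * L (i m)) (by
      filter_upwards [hi] with m hm
      rw [← hm]; exact Ico_subset_Icc_self (hn m))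
  obtain ⟨r₀, -, hr⟩ := exists_tendsto_ultrafilter (isCompact_Icc (a := 0) (b := L j₀)) U
    (f := fun m => r m + n' m * L (j m)) (by
      filter_upwards [hj] with m hm
      rw [← hm]; exact Ico_subset_Icc_self (hn' m))
  have hU : (U : Filter ℕ) ≤ atTop := by
    rw [← Nat.cofinite_eq_atTop]; exact hyperfilter_le_cofinite
  have h0 : Tendsto (fun m => dist (y (i m) (s m)) (y (j m) (r m))) U (𝓝 0) :=
    squeeze_zero (fun _ => dist_nonneg) (fun m => (hdist m).le)
      (tendsto_one_div_add_atTop_nhds_zero_nat.mono_left hU)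
  have h1 : Tendsto (fun m => dist (y (i m) (s m)) (y (j m) (r m))) U
      (𝓝 (dist (y i₀ s₀) (y j₀ r₀))) := by
    refine ((((h i₀).continuous.tendsto s₀).comp hs).dist
      (((h j₀).continuous.tendsto r₀).comp hr)).congr' ?_
    filter_upwards [hi, hj] with m him hjm
    simp only [Function.comp]
    rw [← him, ← hjm, hyn, hyn']
  have heq : y i₀ s₀ = y j₀ r₀ := dist_eq_zero.1 (tendsto_nhds_unique h1 h0)
  have hij : i₀ = j₀ := by
    by_contra hne
    exact Set.disjoint_left.1 (hd _ _ hne) ((h i₀).mem s₀) (heq ▸ (h j₀).mem r₀)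
  subst hij
  obtain ⟨q, hq⟩ := (h i₀).exists_int heq
  have hlim : Tendsto (fun m => |(s m + n m * L (i m)) - (r m + n' m * L (j m)) - q * L i₀|) U
      (𝓝 |s₀ - r₀ - q * L i₀|) := ((hs.sub hr).sub_const _).abs
  rw [hq, show r₀ + q * L i₀ - r₀ - q * L i₀ = 0 by ring, abs_zero] at hlim
  obtain ⟨m, hm, him, hjm⟩ := ((hlim.eventually (gt_mem_nhds hδ)).and (hi.and hj)).exists
  -- The shift combines the two reductions to `[0, L]` with the period difference `q` of the limits.
  have := hbad m (him.trans hjm.symm) (n m - n' m - q)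
  rw [him] at this hm
  rw [hjm] at hm
  push_cast at this
  rw [show s m + ((n m : ℝ) - n' m - q) * L i₀ - r m =
    (s m + n m * L i₀) - (r m + n' m * L i₀) - q * L i₀ by ring] at this
  linarith

/-! ### Hölder bounds -/

/-- The curve `y` has `C^{k,γ}` norm at most `M`. -/
structure HolderBound (k : ℕ) (γ M : ℝ) (y : ℝ → Plane) : Prop where
  contDiff : ContDiff ℝ k y
  unit_speed : ∀ s, ‖deriv y s‖ = 1
  deriv_le : ∀ l ≤ k, ∀ s, ‖iteratedDeriv l y s‖ ≤ M
  holder : ∀ s r, ‖iteratedDeriv k y s - iteratedDeriv k y r‖ ≤ M * |s - r| ^ γ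

theorem holderNorm_bounds {k : ℕ} {γ M : ℝ} (hγ : 0 < γ) {y : ℝ → Plane}
    (h : holderNorm k γ y ≤ ENNReal.ofReal M) (hM : 0 ≤ M) :
    (∀ l ≤ k, ∀ s, ‖iteratedDeriv l y s‖ ≤ M) ∧
    ∀ s r, ‖iteratedDeriv k y s - iteratedDeriv k y r‖ ≤ M * |s - r| ^ γ := by
  constructor
  · intro l hl s
    have h1 : ‖iteratedDeriv l y s‖ₑ ≤ ENNReal.ofReal M := by
      refine le_trans ?_ (le_self_add.trans h)
      refine le_trans ?_ (Finset.single_le_sum (f := fun l => ⨆ s, ‖iteratedDeriv l y s‖ₑ)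
        (fun _ _ => zero_le) (Finset.mem_range.2 (Nat.lt_succ_of_le hl)))
      exact le_iSup (fun s => ‖iteratedDeriv l y s‖ₑ) s
    rwa [← ofReal_norm, ENNReal.ofReal_le_ofReal_iff hM] at h1
  · intro s r
    rcases eq_or_ne s r with rfl | hsr
    · simp [Real.zero_rpow hγ.ne']
    have hpos : 0 < |s - r| ^ γ := Real.rpow_pos_of_pos (abs_pos.2 (sub_ne_zero.2 hsr)) _
    have h1 : ‖iteratedDeriv k y s - iteratedDeriv k y r‖ₑ / ENNReal.ofReal (|s - r| ^ γ) ≤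
        ENNReal.ofReal M := by
      refine le_trans ?_ (le_add_self.trans h)
      exact le_iSup₂ (f := fun s r => ‖iteratedDeriv k y s - iteratedDeriv k y r‖ₑ /
        ENNReal.ofReal (|s - r| ^ γ)) s r
    rw [ENNReal.div_le_iff (by simpa using hpos) ENNReal.ofReal_ne_top, ← ENNReal.ofReal_mul hM,
      ← ofReal_norm, ENNReal.ofReal_le_ofReal_iff (by positivity)] at h1
    exact h1

/-- One integration raises the exponent by one. Applied `k` times it turns the Hölder bound for the
`k`-th derivative into a Taylor error of order `|u| ^ (k + γ)`. -/
theorem norm_taylor_le {E : Type*} [NormedAddCommGroup E] [NormedSpace ℝ E] {f f' : ℝ → E}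
    {M β : ℝ} (hM : 0 ≤ M) (hβ : 0 ≤ β) (hf0 : f 0 = 0)
    (hf : ∀ u, HasDerivAt f (f' u) u) (hf' : ∀ u, ‖f' u‖ ≤ M * |u| ^ β) (u : ℝ) :
    ‖f u‖ ≤ M * |u| ^ (β + 1) := by
  have h := (convex_uIcc 0 u).norm_image_sub_le_of_norm_hasDerivWithin_le (f := f) (f' := f')
    (C := M * |u| ^ β) (fun v _ => (hf v).hasDerivWithinAt) (fun v hv => by
      refine (hf' v).trans (mul_le_mul_of_nonneg_left ?_ hM)
      have hvu : |v| ≤ |u| := by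
        have := abs_sub_left_of_mem_uIcc hv
        simpa using this
      exact Real.rpow_le_rpow (abs_nonneg _) hvu hβ) left_mem_uIcc right_mem_uIcc
  rw [hf0, sub_zero, sub_zero, Real.norm_eq_abs, mul_assoc] at h
  rwa [Real.rpow_add_one' (abs_nonneg u) (by linarith)]

theorem HolderBound.deriv_holder {k : ℕ} {γ M : ℝ} {y : ℝ → Plane} (h : HolderBound k γ M y)
    (hk : k = 1 ∨ k = 2) (hγ : γ ≤ 1) {s r : ℝ} (hsr : |s - r| ≤ 1) :
    ‖deriv y s - deriv y r‖ ≤ M * |s - r| ^ γ := by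
  have hM : 0 ≤ M := (norm_nonneg _).trans (h.deriv_le 0 (Nat.zero_le _) 0)
  rcases hk with rfl | rfl
  · simpa using h.holder s r
  · have hd : Differentiable ℝ (deriv y) := by
      have := h.contDiff.differentiable_iteratedDeriv 1 (by norm_num)
      simpa using this
    have h1 := convex_univ.norm_image_sub_le_of_norm_deriv_le (f := deriv y) (C := M)
      (x := r) (y := s) (fun u _ => hd u) (fun u _ => by
        have := h.deriv_le 2 le_rfl u
        rwa [iteratedDeriv_succ, iteratedDeriv_one] at this) (mem_univ _) (mem_univ _)
    refine h1.trans (mul_le_mul_of_nonneg_left ?_ hM)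
    rw [Real.norm_eq_abs]
    rcases (abs_nonneg (s - r)).eq_or_lt with h0 | h0
    · rw [← h0]; positivity
    · exact Real.self_le_rpow_of_le_one h0.le hsr hγ

/-- Arc length is comparable to distance at small scales. -/
theorem HolderBound.half_le_dist {k : ℕ} {γ M δ : ℝ} {y : ℝ → Plane} (h : HolderBound k γ M y)
    (hk : k = 1 ∨ k = 2) (hγ0 : 0 < γ) (hγ : γ ≤ 1) (hδ : δ ≤ 1) (hMδ : M * δ ^ γ ≤ 1 / 2)
    {s r : ℝ} (hsr : |s - r| ≤ δ) : |s - r| / 2 ≤ dist (y s) (y r) := by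
  have hM : 0 ≤ M := (norm_nonneg _).trans (h.deriv_le 0 (Nat.zero_le _) 0)
  have hdiff : Differentiable ℝ y := h.contDiff.differentiable (by rcases hk with rfl | rfl <;> simp)
  have h1 := (convex_uIcc r s).norm_image_sub_le_of_norm_hasDerivWithin_le
    (f := fun u => y u - u • deriv y r) (f' := fun u => deriv y u - (1:ℝ) • deriv y r) (C := 1 / 2)
    (fun u _ => ((hdiff u).hasDerivAt.sub ((hasDerivAt_id u).smul_const _)).hasDerivWithinAt)
    (fun u hu => by
      have hur : |u - r| ≤ δ := (abs_sub_left_of_mem_uIcc hu).trans hsr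
      rw [one_smul]
      refine (h.deriv_holder hk hγ (hur.trans hδ)).trans (le_trans ?_ hMδ)
      exact mul_le_mul_of_nonneg_left (Real.rpow_le_rpow (abs_nonneg _) hur hγ0.le) hM)
    left_mem_uIcc right_mem_uIcc
  have h2 : (s - r) • deriv y r = (y s - y r) - (y s - s • deriv y r - (y r - r • deriv y r)) := by
    module
  have h3 : ‖(s - r) • deriv y r‖ = |s - r| := by
    rw [norm_smul, h.unit_speed, mul_one, Real.norm_eq_abs]
  rw [Real.norm_eq_abs] at h1
  have h4 := norm_sub_le (y s - y r) (y s - s • deriv y r - (y r - r • deriv y r))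
  rw [← h2, h3] at h4
  rw [dist_eq_norm]; linarith

/-- Second order expansion of a curve; the quadratic term is normal to the curve. -/
theorem HolderBound.exists_expansion {k : ℕ} {γ M R : ℝ} {y : ℝ → Plane} (h : HolderBound k γ M y)
    (hk : k = 1 ∨ k = 2) (hγ0 : 0 < γ) (hR : 0 < R) (hMR : M * R ^ (k + γ - 1) ≤ 1)
    (s₀ : ℝ) : ∃ a : ℝ, |a| * R ≤ 3 ∧ (a = 0 ∨ 2 ≤ k) ∧ ∀ u,
      ‖y (s₀ + u) - y s₀ - u • deriv y s₀ - (a / 2 * u ^ 2) • perp (deriv y s₀)‖ ≤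
        M * |u| ^ (k + γ) := by
  have hM : 0 ≤ M := (norm_nonneg _).trans (h.deriv_le 0 (Nat.zero_le _) 0)
  have hdiff : Differentiable ℝ y := h.contDiff.differentiable (by rcases hk with rfl | rfl <;> simp)
  have hshift : ∀ u, HasDerivAt (fun u => y (s₀ + u)) (deriv y (s₀ + u)) u := fun u => by
    simpa using (hdiff (s₀ + u)).hasDerivAt.comp_const_add s₀ u
  have hid : ∀ (c : Plane) (u : ℝ), HasDerivAt (fun u : ℝ => u • c) c u := fun c u => by
    simpa using (hasDerivAt_id u).smul_const c
  rcases hk with rfl | rfl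
  · refine ⟨0, by simp, Or.inl rfl, fun u => ?_⟩
    have := norm_taylor_le (f := fun u => y (s₀ + u) - y s₀ - u • deriv y s₀)
      (f' := fun u => deriv y (s₀ + u) - deriv y s₀) hM hγ0.le (by simp)
      (fun u => ((hshift u).sub_const _).sub (hid _ u)) (fun u => by
        have := h.holder (s₀ + u) s₀
        simpa using this) u
    simpa [add_comm] using this
  · have hd : Differentiable ℝ (deriv y) := by
      have := h.contDiff.differentiable_iteratedDeriv 1 (by norm_num)
      simpa using this
    set B := deriv (deriv y) s₀ with hB
    have hit : ∀ u, iteratedDeriv 2 y u = deriv (deriv y) u := fun u => by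
      rw [iteratedDeriv_succ, iteratedDeriv_one]
    have horth : inner ℝ B (deriv y s₀) = 0 := by
      have h1 : HasDerivAt (fun s => inner ℝ (deriv y s) (deriv y s))
          (inner ℝ (deriv y s₀) B + inner ℝ B (deriv y s₀)) s₀ :=
        (hd s₀).hasDerivAt.inner ℝ (hd s₀).hasDerivAt
      have h2 : (fun s => inner ℝ (deriv y s) (deriv y s)) = fun _ => (1:ℝ) := by
        ext s; rw [real_inner_self_eq_norm_sq, h.unit_speed]; norm_num
      rw [h2] at h1
      have h3 := h1.unique (hasDerivAt_const s₀ 1)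
      rw [real_inner_comm] at h3
      linarith
    set a := inner ℝ B (perp (deriv y s₀)) with ha
    have hBa : B = a • perp (deriv y s₀) := by
      have := eq_inner_smul_add (h.unit_speed s₀) B
      rw [horth, zero_smul, add_zero] at this
      exact this
    have hnormB : |a| = ‖B‖ := by
      rw [hBa, norm_smul, norm_perp, h.unit_speed, mul_one, Real.norm_eq_abs]
    have hshift' : ∀ u, HasDerivAt (fun u => deriv y (s₀ + u)) (deriv (deriv y) (s₀ + u)) u :=
      fun u => by simpa using (hd (s₀ + u)).hasDerivAt.comp_const_add s₀ u
    have h1 : ∀ u, ‖deriv y (s₀ + u) - deriv y s₀ - u • B‖ ≤ M * |u| ^ (γ + 1) :=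
      norm_taylor_le (f := fun u => deriv y (s₀ + u) - deriv y s₀ - u • B)
        (f' := fun u => deriv (deriv y) (s₀ + u) - B) hM hγ0.le (by simp)
        (fun u => ((hshift' u).sub_const _).sub (hid _ u)) (fun u => by
          have := h.holder (s₀ + u) s₀
          rw [hit, hit] at this
          simpa using this)
    refine ⟨a, ?_, Or.inr le_rfl, fun u => ?_⟩
    -- `R • B` is a difference of two unit tangents up to a Taylor error of at most `M * R ^ (γ + 1)
    -- ≤ 1`, which explains the bound `3`.
    · have h2 := h1 R
      have h3 : ‖R • B‖ ≤ ‖deriv y (s₀ + R)‖ + ‖deriv y s₀‖ +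
          ‖deriv y (s₀ + R) - deriv y s₀ - R • B‖ := by
        have : R • B = deriv y (s₀ + R) - deriv y s₀ - (deriv y (s₀ + R) - deriv y s₀ - R • B) := by
          abel
        rw [this]
        refine (norm_sub_le _ _).trans ?_
        have := norm_sub_le (deriv y (s₀ + R)) (deriv y s₀)
        simp only [sub_sub_cancel]
        linarith
      rw [norm_smul, Real.norm_of_nonneg hR.le, h.unit_speed, h.unit_speed] at h3
      rw [abs_of_pos hR] at h2
      have h4 : M * R ^ (γ + 1) ≤ 1 := by
        refine le_of_eq_of_le ?_ hMR
        congr 2; push_cast; ring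
      rw [hnormB]; linarith
    · have hsq : ∀ u : ℝ, HasDerivAt (fun u : ℝ => (u ^ 2 / 2) • B) (u • B) u := fun u => by
        have h5 : HasDerivAt (fun u : ℝ => u ^ 2 / 2) u u := by
          have := (hasDerivAt_pow 2 u).div_const 2
          simpa using this
        exact h5.smul_const B
      have h2 := norm_taylor_le (f := fun u => y (s₀ + u) - y s₀ - u • deriv y s₀ - (u ^ 2 / 2) • B)
        (f' := fun u => deriv y (s₀ + u) - deriv y s₀ - u • B) hM (by linarith : 0 ≤ γ + 1) (by simp)
        (fun u => (((hshift u).sub_const _).sub (hid _ u)).sub (hsq u)) h1 u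
      have e1 : (u ^ 2 / 2) • B = (a / 2 * u ^ 2) • perp (deriv y s₀) := by
        conv_lhs => rw [hBa]
        rw [smul_smul]; congr 1; ring
      rw [e1] at h2
      refine h2.trans_eq ?_
      congr 2; push_cast; ring

/-- The expansion is in arc length `u`, the thin set in the horizontal coordinate `X`, and `σ` is
the orientation. The error in `X` is at most `|u| / 2`, so `|X| ≥ |u| / 2`; replacing `u ^ 2` by `X
^ 2` costs `5 / 4 * (M * |u| ^ β)`. Finally `|u| ^ β ≤ 8 * |X| ^ β` because `β ≤ 3`, and `9 / 4 * 8
= 18 ≤ 24`. -/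
theorem mem_thinSet_of_expansion {u X H a c M β σ : ℝ} (hM : 0 ≤ M) (hβ1 : 1 ≤ β) (hβ3 : β ≤ 3)
    (hσ : |σ| = 1) (hX : |X - σ * u| ≤ M * |u| ^ β) (hH : |H - c - a / 2 * u ^ 2| ≤ M * |u| ^ β)
    (hMu : M * |u| ^ (β - 1) ≤ 1 / 2) (ha : |a| * |u| ≤ 1) :
    (X, H) ∈ thinSet (24 * M) β a c := by
  have hσ2 : σ ^ 2 = 1 := by rw [← sq_abs, hσ]; norm_num
  have hpow : M * |u| ^ β = M * |u| ^ (β - 1) * |u| := by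
    rw [mul_assoc, ← Real.rpow_add_one' (abs_nonneg u) (by linarith)]; congr 2; ring
  have hhalf : M * |u| ^ β ≤ 1 / 2 * |u| := by
    rw [hpow]; exact mul_le_mul_of_nonneg_right hMu (abs_nonneg u)
  have hσu : |σ * u| = |u| := by rw [abs_mul, hσ, one_mul]
  have hXu : |u| / 2 ≤ |X| := by
    have := abs_sub_abs_le_abs_sub (σ * u) X
    rw [hσu, abs_sub_comm] at this
    linarith
  have hXu' : |X| ≤ 3 / 2 * |u| := by
    have := abs_sub_abs_le_abs_sub X (σ * u)
    rw [hσu] at this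
    linarith
  have hsq : |u ^ 2 - X ^ 2| ≤ M * |u| ^ β * (5 / 2 * |u|) := by
    have : u ^ 2 - X ^ 2 = -((X - σ * u) * (X + σ * u)) := by linear_combination (-(u ^ 2)) * hσ2
    rw [this, abs_neg, abs_mul]
    refine mul_le_mul hX ?_ (abs_nonneg _) (by positivity)
    refine (abs_add_le _ _).trans ?_
    rw [hσu]; linarith
  have hq : |a / 2 * (u ^ 2 - X ^ 2)| ≤ 5 / 4 * (M * |u| ^ β) := by
    rw [abs_mul, abs_div, abs_two]
    calc |a| / 2 * |u ^ 2 - X ^ 2| ≤ |a| / 2 * (M * |u| ^ β * (5 / 2 * |u|)) := by gcongr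
      _ = 5 / 4 * (M * |u| ^ β) * (|a| * |u|) := by ring
      _ ≤ 5 / 4 * (M * |u| ^ β) * 1 := by gcongr
      _ = _ := by ring
  have hmain : |H - c - a / 2 * X ^ 2| ≤ 9 / 4 * (M * |u| ^ β) := by
    have : H - c - a / 2 * X ^ 2 = (H - c - a / 2 * u ^ 2) + a / 2 * (u ^ 2 - X ^ 2) := by ring
    rw [this]
    refine (abs_add_le _ _).trans ?_
    linarith
  have hfin : |u| ^ β ≤ 8 * |X| ^ β := by
    calc |u| ^ β ≤ (2 * |X|) ^ β := Real.rpow_le_rpow (abs_nonneg _) (by linarith) (by linarith)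
      _ = 2 ^ β * |X| ^ β := Real.mul_rpow (by norm_num) (abs_nonneg _)
      _ ≤ 8 * |X| ^ β := by
        gcongr
        calc (2:ℝ) ^ β ≤ 2 ^ (3:ℝ) := Real.rpow_le_rpow_of_exponent_le (by norm_num) hβ3
          _ = 8 := by norm_num
  change |H - c - a / 2 * X ^ 2| ≤ 24 * M * |X| ^ β
  have := mul_le_mul_of_nonneg_left hfin hM
  have h0 : 0 ≤ M * |X| ^ β := by positivity
  linarith

/-! ### The interface at a fixed time -/

/-- The regularity of the patches at a fixed time `t`. -/
structure RegularAt {N : ℕ} (k : ℕ) (γ M : ℝ) (Ω : Fin N → ℝ → Set Plane) (L : Fin N → ℝ → ℝ)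
    (x : Fin N → ℝ → ℝ → Plane) (t : ℝ) : Prop where
  isOpen : ∀ i, IsOpen (Ω i t)
  isBounded : ∀ i, Bornology.IsBounded (Ω i t)
  param : ∀ i, IsArcLengthParam (frontier (Ω i t)) (L i t) (x i t)
  disjoint : ∀ i j, i ≠ j → Disjoint (frontier (Ω i t)) (frontier (Ω j t))
  holder : ∀ i, HolderBound k γ M (x i t)

section Vorticity

variable {N : ℕ} {θ : Fin N → ℝ} {Ω : Fin N → ℝ → Set Plane} {t : ℝ}

theorem abs_vorticity_le (θ : Fin N → ℝ) (Ω : Fin N → ℝ → Set Plane) (t : ℝ) (y : Plane) :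
    |vorticity θ Ω t y| ≤ ∑ i, |θ i| := by
  refine (Finset.abs_sum_le_sum_abs _ _).trans (Finset.sum_le_sum fun i _ => ?_)
  exact norm_indicator_le_norm_self (fun _ => θ i) y

theorem integrable_vorticity (ho : ∀ i, IsOpen (Ω i t)) (hb : ∀ i, Bornology.IsBounded (Ω i t)) :
    Integrable (vorticity θ Ω t) :=
  integrable_finsetSum _ fun i _ =>
    (integrable_indicator_iff (ho i).measurableSet).2 (integrableOn_const (hb i).measure_lt_top.ne)

/-- A connected set which avoids the boundary of a patch is covered by the interior of the patch and
the complement of its closure, and hence lies in one of them. -/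
theorem vorticity_eq_of_isPreconnected {S : Set Plane} (hS : IsPreconnected S)
    (hd : Disjoint S (interface Ω t)) {y z : Plane} (hy : y ∈ S) (hz : z ∈ S) :
    vorticity θ Ω t y = vorticity θ Ω t z := by
  have key : ∀ i, ∀ y ∈ S, ∀ z ∈ S, y ∈ Ω i t → z ∈ Ω i t := by
    intro i y hy z hz hyi
    by_contra hzi
    have hfr : ∀ w ∈ S, w ∈ closure (Ω i t) → w ∈ interior (Ω i t) := fun w hw hwc => by
      by_contra hwi
      exact Set.disjoint_left.1 hd hw (mem_iUnion.2 ⟨i, hwc, hwi⟩)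
    obtain ⟨w, -, hw1, hw2⟩ := hS (interior (Ω i t)) (closure (Ω i t))ᶜ isOpen_interior
      isClosed_closure.isOpen_compl
      (fun w hw => (em (w ∈ closure (Ω i t))).imp (hfr w hw) id)
      ⟨y, hy, hfr y hy (subset_closure hyi)⟩
      ⟨z, hz, fun hzc => hzi (interior_subset (hfr z hz hzc))⟩
    exact hw2 (subset_closure (interior_subset hw1))
  refine Finset.sum_congr rfl fun i _ => ?_
  by_cases h : y ∈ Ω i t
  · rw [indicator_of_mem h, indicator_of_mem (key i y hy z hz h)]
  · rw [indicator_of_notMem h, indicator_of_notMem fun h' => h (key i z hz y hy h')]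

end Vorticity

/-- `u · n` and `n` change sign together. The direction joining two closest points agrees with the
chosen unit normal at each of them only up to sign. -/
theorem IsNormalVelocity.smul {α τ : ℝ} {ω : Plane → ℝ} {z n v : Plane}
    (h : IsNormalVelocity α ω z n v) (hτ : τ ^ 2 = 1) : IsNormalVelocity α ω z (τ • n) v := by
  obtain ⟨w, hw, rfl⟩ := h
  refine ⟨τ * w, ?_, ?_⟩
  · have : truncatedVelocity α ω z (τ • n) = fun ε => τ * truncatedVelocity α ω z n ε := by
      ext ε
      rw [truncatedVelocity, truncatedVelocity, ← integral_const_mul]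
      congr 1; ext y
      rw [inner_smul_right]; ring
    rw [this]
    exact hw.const_mul τ
  · rw [smul_smul, show τ * w * τ = τ ^ 2 * w by ring, hτ, one_mul]

theorem frame_zero (p e : Plane) : frame p e (0, 0) = p := by simp [frame]

theorem frame_sub_eq (p e : Plane) (c : ℝ) (v : ℝ × ℝ) :
    frame p e v - frame p e (0, c) = v.1 • perp e + (v.2 - c) • e := by
  simp only [frame]; module

/-- A point of a strand lies close to the osculating parabola. -/
theorem mem_thinSet_of_frame_eq {y : ℝ → Plane} {p e : Plane} {s₀ u a c τ M β : ℝ} {v : ℝ × ℝ}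
    (he : ‖e‖ = 1) (hτ : |τ| = 1) (hen : e = τ • perp (deriv y s₀)) (hq : y s₀ = frame p e (0, c))
    (hexp : ‖y (s₀ + u) - y s₀ - u • deriv y s₀ - (a / 2 * u ^ 2) • perp (deriv y s₀)‖ ≤
      M * |u| ^ β) (hM : 0 ≤ M) (hβ1 : 1 ≤ β) (hβ3 : β ≤ 3) (hMu : M * |u| ^ (β - 1) ≤ 1 / 2)
    (ha : |a| * |u| ≤ 1) (hv : frame p e v = y (s₀ + u)) : v ∈ thinSet (24 * M) β (τ * a) c := by
  have hτ2 : τ * τ = 1 := by rw [← abs_mul_abs_self, hτ, one_mul]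
  have hn : perp (deriv y s₀) = τ • e := by rw [hen, smul_smul, hτ2, one_smul]
  have hder : deriv y s₀ = (-τ) • perp e := by
    have := congrArg perp hn
    rw [perp_perp, perp_smul] at this
    rw [neg_smul, ← this, neg_neg]
  rw [← hv, hq, frame_sub_eq, hn, hder] at hexp
  have hvec : v.1 • perp e + (v.2 - c) • e - u • (-τ) • perp e - (a / 2 * u ^ 2) • τ • e =
      (v.1 - (-τ) * u) • perp e + (v.2 - c - τ * a / 2 * u ^ 2) • e := by module
  rw [hvec] at hexp
  have h2 : inner ℝ e (perp e) = 0 := by rw [real_inner_comm, inner_perp_self]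
  have i1 : inner ℝ ((v.1 - (-τ) * u) • perp e + (v.2 - c - τ * a / 2 * u ^ 2) • e) (perp e) =
      v.1 - (-τ) * u := by
    rw [inner_add_left, inner_smul_left, inner_smul_left, h2, inner_perp_perp,
      real_inner_self_eq_norm_sq, he]; simp
  have i2 : inner ℝ ((v.1 - (-τ) * u) • perp e + (v.2 - c - τ * a / 2 * u ^ 2) • e) e =
      v.2 - c - τ * a / 2 * u ^ 2 := by
    rw [inner_add_left, inner_smul_left, inner_smul_left, inner_perp_self,
      real_inner_self_eq_norm_sq, he]; simp
  have j1 := abs_real_inner_le_norm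
    ((v.1 - (-τ) * u) • perp e + (v.2 - c - τ * a / 2 * u ^ 2) • e) (perp e)
  have j2 := abs_real_inner_le_norm
    ((v.1 - (-τ) * u) • perp e + (v.2 - c - τ * a / 2 * u ^ 2) • e) e
  rw [i1, norm_perp, he, mul_one] at j1
  rw [i2, he, mul_one] at j2
  exact mem_thinSet_of_expansion (X := v.1) (H := v.2) hM hβ1 hβ3 (by rw [abs_neg, hτ])
    (j1.trans hexp) (j2.trans hexp) hMu (by rwa [abs_mul, hτ, one_mul])

/-- The fraction of the regularity scale on which the interface is almost straight. -/
noncomputable def smallness (β : ℝ) : ℝ := min (1 / 12) ((1 / 192) ^ (1 / (β - 1)))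

theorem smallness_pos (β : ℝ) : 0 < smallness β :=
  lt_min (by norm_num) (Real.rpow_pos_of_pos (by norm_num) _)

/-- The constant is `192 = 8 * 24`: with thickness constant `m = 24 * M` this is the condition `8 *
(m * r ^ (β - 1)) ≤ 1` of `symmetricNear_of_subset`. The other entry `1 / 12` of `smallness` turns
`|a| * R ≤ 3` for both curvatures into `(|a₁| + |a₂|) * r ≤ 1 / 2`. -/
theorem mul_rpow_le_of_le_smallness {M R β u : ℝ} (hM : 0 ≤ M) (hβ : 1 < β) (hR : 0 < R)
    (hMR : M * R ^ (β - 1) ≤ 1) (hu0 : 0 ≤ u) (hu : u ≤ smallness β * R) :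
    M * u ^ (β - 1) ≤ 1 / 192 := by
  have hκ := smallness_pos β
  have h1 : smallness β ^ (β - 1) ≤ 1 / 192 := by
    calc smallness β ^ (β - 1) ≤ ((1 / 192) ^ (1 / (β - 1))) ^ (β - 1) :=
          Real.rpow_le_rpow hκ.le (min_le_right _ _) (by linarith)
      _ = 1 / 192 := by
          rw [← Real.rpow_mul (by norm_num), one_div_mul_cancel (by linarith), Real.rpow_one]
  calc M * u ^ (β - 1) ≤ M * (smallness β * R) ^ (β - 1) :=
        mul_le_mul_of_nonneg_left (Real.rpow_le_rpow hu0 hu (by linarith)) hM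
    _ = smallness β ^ (β - 1) * (M * R ^ (β - 1)) := by
        rw [Real.mul_rpow hκ.le hR.le]; ring
    _ ≤ 1 / 192 * 1 := mul_le_mul h1 hMR (by positivity) (by norm_num)
    _ = 1 / 192 := by norm_num

theorem const_of_disjoint_preimage {N : ℕ} (θ : Fin N → ℝ) (Ω : Fin N → ℝ → Set Plane) (t : ℝ)
    (p e : Plane) (S : Set (ℝ × ℝ)) (hS : IsPreconnected S)
    (hd : Disjoint S (frame p e ⁻¹' interface Ω t)) (v : ℝ × ℝ) (hv : v ∈ S) (w : ℝ × ℝ)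
    (hw : w ∈ S) :
    vorticity θ Ω t (frame p e v) = vorticity θ Ω t (frame p e w) := by
  refine vorticity_eq_of_isPreconnected (hS.image _ (continuous_frame p e).continuousOn) ?_
    (mem_image_of_mem _ hv) (mem_image_of_mem _ hw)
  rw [Set.disjoint_left]
  rintro _ ⟨z, hz, rfl⟩ hz'
  exact Set.disjoint_left.1 hd hz hz'

theorem mem_interface {N : ℕ} {k : ℕ} {γ M : ℝ} {Ω : Fin N → ℝ → Set Plane} {L : Fin N → ℝ → ℝ}
    {x : Fin N → ℝ → ℝ → Plane} {t : ℝ} (h : RegularAt k γ M Ω L x t) {z : Plane} :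
    z ∈ interface Ω t ↔ ∃ i s, z = x i t s := by
  rw [interface, mem_iUnion]
  refine exists_congr fun i => ?_
  rw [← (h.param i).range_eq]
  exact ⟨fun ⟨s, hs⟩ => ⟨s, hs.symm⟩, fun ⟨s, hs⟩ => ⟨s, hs.symm⟩⟩

section Regular

variable {N : ℕ} {k : ℕ} {α γ M R : ℝ} {θ : Fin N → ℝ} {Ω : Fin N → ℝ → Set Plane}
  {L : Fin N → ℝ → ℝ} {x : Fin N → ℝ → ℝ → Plane} {t : ℝ}

theorem integrable_vorticity_frame (h : RegularAt k γ M Ω L x t) (p : Plane) {e : Plane}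
    (he : ‖e‖ = 1) : Integrable (fun v => vorticity θ Ω t (frame p e v)) :=
  ((measurePreserving_frame he p).integrable_comp_emb (measurableEmbedding_frame he p)).2
    (integrable_vorticity h.isOpen h.isBounded)

theorem beta_bounds (hk : k = 1 ∨ k = 2) (hγ0 : 0 < γ) (hγ1 : γ ≤ 1) :
    1 < (k + γ : ℝ) ∧ (k + γ : ℝ) ≤ 3 := by
  rcases hk with rfl | rfl <;> constructor <;> push_cast <;> linarith

/-- Near each of its points, the interface consists of a single strand; hence the patches are almost
symmetric with respect to the normal line. -/
theorem RegularAt.exists_symmetricNear (h : RegularAt k γ M Ω L x t) (hk : k = 1 ∨ k = 2)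
    (hγ0 : 0 < γ) (hγ1 : γ ≤ 1) (hR : 0 < R) (hMR : M * R ^ (k + γ - 1) ≤ 1) (hM : 0 ≤ M) :
    ∃ r > 0, r ≤ 1 ∧ ∀ i s, ∃ a, SymmetricNear
      (fun v => vorticity θ Ω t (frame (x i t s) (perp (deriv (x i t) s)) v))
      (24 * M) (k + γ) r a 0 a 0 0 := by
  obtain ⟨hβ1, hβ3⟩ := beta_bounds hk hγ0 hγ1
  set κ := smallness (k + γ) with hκ
  have hκ0 : 0 < κ := smallness_pos _
  obtain ⟨r₀, hr₀, hstrand⟩ := exists_strand_radius h.param h.disjoint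
    (mul_pos hκ0 hR)
  -- `r₀ / 4`, because points up to distance `4 * r` have to be on the strand. As `r₀` comes from
  -- compactness there is no quantitative lower bound, but the continuity of the velocity does not
  -- need one.
  set r := min (min 1 (κ * R)) (r₀ / 4) with hr
  have hrpos : 0 < r := lt_min (lt_min one_pos (mul_pos hκ0 hR)) (by linarith)
  have hr1 : r ≤ κ * R := (min_le_left _ _).trans (min_le_right _ _)
  have hκ12 : κ ≤ 1 / 12 := min_le_left _ _
  refine ⟨r, hrpos, (min_le_left _ _).trans (min_le_left _ _), fun i s => ?_⟩
  obtain ⟨a, haR, -, hexp⟩ := (h.holder i).exists_expansion hk hγ0 hR hMR s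
  set e := perp (deriv (x i t) s) with he
  have hen : ‖e‖ = 1 := by rw [he, norm_perp, (h.param i).unit_speed]
  -- A single strand is treated as two copies of the same parabola.
  refine ⟨a, symmetricNear_of_subset (I := frame (x i t s) e ⁻¹' interface Ω t)
    (const_of_disjoint_preimage θ Ω t _ _) ?_ hrpos (by positivity) hβ1.le le_rfl le_rfl (Or.inl rfl)
    ?_ ?_⟩
  · intro v hv hrad
    left
    obtain ⟨j, s', hs'⟩ := (mem_interface h).1 hv
    have hdist : dist (x j t s') (x i t s) < r₀ := by
      have := norm_frame_sub hen (x i t s) 0 v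
      rw [frame_zero, hs'] at this
      rw [dist_comm, dist_eq_norm, this]
      have : r ≤ r₀ / 4 := min_le_right _ _
      linarith
    obtain ⟨rfl, n, hn⟩ := hstrand j i s' s hdist
    set u := s' + n * L j t - s with hu
    have hvu : frame (x j t s) e v = x j t (s + u) := by
      rw [hs', hu, add_sub_cancel, (h.param j).add_int_mul]
    have := mem_thinSet_of_frame_eq (τ := 1) hen (by simp) (by rw [one_smul])
      (frame_zero (x j t s) e).symm (hexp u) hM hβ1.le hβ3
      ((mul_rpow_le_of_le_smallness hM hβ1 hR hMR (abs_nonneg u) hn.le).trans (by norm_num)) (by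
        calc |a| * |u| ≤ |a| * (κ * R) := by gcongr
          _ = |a| * R * κ := by ring
          _ ≤ 3 * (1 / 12) := by gcongr
          _ ≤ 1 := by norm_num) hvu
    rwa [one_mul] at this
  · calc (|a| + |a|) * r ≤ (|a| + |a|) * (κ * R) := by gcongr
      _ = 2 * (|a| * R) * κ := by ring
      _ ≤ 2 * 3 * (1 / 12) := by gcongr
      _ = 1 / 2 := by norm_num
  · have := mul_rpow_le_of_le_smallness hM hβ1 hR hMR hrpos.le hr1
    linarith

/-- Dominated convergence; the cut-off jumps only on the sphere of radius `ε`, which is a null set.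
-/
theorem continuous_truncatedVelocity {α ε : ℝ} (hα : 0 < α) (hε : 0 < ε) {ω : Plane → ℝ}
    (hω : Integrable ω) {z n : ℝ → Plane} (hz : Continuous z) (hn : Continuous n)
    (hn1 : ∀ s, ‖n s‖ = 1) : Continuous fun s => truncatedVelocity α ω (z s) (n s) ε := by
  rw [continuous_iff_continuousAt]
  intro s₀
  have hms : ∀ s, MeasurableSet {y : Plane | ε < ‖z s - y‖} := fun s =>
    measurableSet_lt measurable_const (by fun_prop)
  have heq : ∀ s, truncatedVelocity α ω (z s) (n s) ε = ∫ y, {y : Plane | ε < ‖z s - y‖}.indicator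
      (fun y => inner ℝ (perp (z s - y)) (n s) / ‖z s - y‖ ^ (2 + 2 * α) * ω y) y := fun s => by
    rw [truncatedVelocity, integral_indicator (hms s)]
  simp only [ContinuousAt, heq]
  have hpc := continuous_perp
  refine tendsto_integral_filter_of_dominated_convergence
    (fun y => ε ^ (1 - (2 + 2 * α)) * ‖ω y‖) ?_ ?_ (hω.norm.const_mul _) ?_
  · refine Eventually.of_forall fun s => AEStronglyMeasurable.indicator ?_ (hms s)
    refine AEStronglyMeasurable.mul (Measurable.aestronglyMeasurable ?_) hω.aestronglyMeasurable
    have m1 : Measurable fun y : Plane => inner ℝ (perp (z s - y)) (n s) :=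
      ((hpc.comp (continuous_const.sub continuous_id)).inner continuous_const).measurable
    have m2 : Measurable fun y : Plane => ‖z s - y‖ ^ (2 + 2 * α) := by fun_prop
    exact m1.div m2
  · refine Eventually.of_forall fun s => ae_of_all _ fun y => ?_
    by_cases hy : y ∈ {y : Plane | ε < ‖z s - y‖}
    · rw [indicator_of_mem hy, norm_mul]
      refine mul_le_mul_of_nonneg_right ?_ (norm_nonneg _)
      have hy' : ε < ‖z s - y‖ := hy
      have hpos := hε.trans hy'
      rw [norm_div, Real.norm_of_nonneg (Real.rpow_nonneg hpos.le _)]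
      calc ‖(inner ℝ (perp (z s - y)) (n s) : ℝ)‖ / ‖z s - y‖ ^ (2 + 2 * α)
          ≤ ‖z s - y‖ / ‖z s - y‖ ^ (2 + 2 * α) := by
            gcongr
            refine (norm_inner_le_norm _ _).trans ?_
            rw [norm_perp, hn1, mul_one]
        _ = ‖z s - y‖ ^ (1 - (2 + 2 * α)) := by rw [Real.rpow_sub hpos, Real.rpow_one]
        _ ≤ ε ^ (1 - (2 + 2 * α)) := Real.rpow_le_rpow_of_nonpos hε hy'.le (by linarith)
    · rw [indicator_of_notMem hy, norm_zero]; positivity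
  · have hsphere : ∀ᵐ y : Plane, y ∉ Metric.sphere (z s₀) ε :=
      measure_eq_zero_iff_ae_notMem.1 (Measure.addHaar_sphere volume (z s₀) ε)
    filter_upwards [hsphere] with y hy
    have hzc : Tendsto (fun s => ‖z s - y‖) (𝓝 s₀) (𝓝 ‖z s₀ - y‖) :=
      (hz.sub continuous_const).norm.tendsto s₀
    have hne : ‖z s₀ - y‖ ≠ ε := fun h => hy (by rw [Metric.mem_sphere, dist_comm, dist_eq_norm, h])
    rcases lt_or_gt_of_ne hne with h | h
    · have h0 : y ∉ {y : Plane | ε < ‖z s₀ - y‖} := not_lt.2 h.le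
      rw [indicator_of_notMem h0]
      refine tendsto_const_nhds.congr' ?_
      filter_upwards [hzc.eventually (gt_mem_nhds h)] with s hs
      rw [indicator_of_notMem (show y ∉ {y : Plane | ε < ‖z s - y‖} from not_lt.2 hs.le)]
    · have h0 : y ∈ {y : Plane | ε < ‖z s₀ - y‖} := h
      have hpos : 0 < ‖z s₀ - y‖ := hε.trans h
      rw [indicator_of_mem h0]
      have hlim : Tendsto (fun s => inner ℝ (perp (z s - y)) (n s) / ‖z s - y‖ ^ (2 + 2 * α) * ω y)
          (𝓝 s₀) (𝓝 (inner ℝ (perp (z s₀ - y)) (n s₀) / ‖z s₀ - y‖ ^ (2 + 2 * α) * ω y)) := by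
        refine Tendsto.mul_const _ (Tendsto.div ?_ (hzc.rpow_const (Or.inl hpos.ne'))
          (Real.rpow_pos_of_pos hpos _).ne')
        exact ((hpc.comp (hz.sub continuous_const)).inner hn).tendsto s₀
      refine hlim.congr' ?_
      filter_upwards [hzc.eventually (lt_mem_nhds h)] with s hs
      rw [indicator_of_mem (show y ∈ {y : Plane | ε < ‖z s - y‖} from hs)]

/-- The normal velocity is continuous along the boundary curves. -/
theorem RegularAt.continuous_velocity (h : RegularAt k γ M Ω L x t) (hk : k = 1 ∨ k = 2)
    (hα : 0 < α) (hγ0 : 0 < γ) (hγ1 : γ ≤ 1) (hαγ : 1 + 2 * α ≤ k + γ) (hR : 0 < R)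
    (hMR : M * R ^ (k + γ - 1) ≤ 1) (hM : 0 ≤ M) {V : Plane → Plane} (i : Fin N)
    (hV : ∀ s, IsNormalVelocity α (vorticity θ Ω t) (x i t s) (perp (deriv (x i t) s))
      (V (x i t s))) : Continuous fun s => V (x i t s) := by
  choose w hw hVw using hV
  obtain ⟨r, hr0, hr1, hsym⟩ := h.exists_symmetricNear (θ := θ) hk hγ0 hγ1 hR hMR hM
  have hnc : Continuous fun s => perp (deriv (x i t) s) :=
    continuous_perp.comp (h.param i).continuous_deriv
  have hn1 : ∀ s, ‖perp (deriv (x i t) s)‖ = 1 := fun s => by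
    rw [norm_perp, (h.param i).unit_speed]
  have hωi := integrable_vorticity (θ := θ) h.isOpen h.isBounded
  -- The error is uniform in `s`, so the normal velocity is a uniform limit of continuous
  -- truncations.
  have happrox : ∀ ε, 0 < ε → ε < r → ∀ s, |w s - truncatedVelocity α (vorticity θ Ω t) (x i t s)
      (perp (deriv (x i t) s)) ε| ≤ 16 * (∑ i, |θ i|) * (24 * M) * ε := by
    intro ε hε hεr s
    obtain ⟨a, ha⟩ := hsym i s
    have hw' := hw s
    have htr : truncatedVelocity α (vorticity θ Ω t) (x i t s) (perp (deriv (x i t) s)) =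
        truncated (2 + 2 * α) 0
          (fun v => vorticity θ Ω t (frame (x i t s) (perp (deriv (x i t) s)) v)) := by
      ext ε
      rw [← truncatedVelocity_frame (hn1 s), frame_zero]
    rw [htr] at hw' ⊢
    exact ha.abs_sub_truncated_le (fun v => abs_vorticity_le θ Ω t _)
      (integrable_vorticity_frame h _ (hn1 s)) (by linarith) (by positivity) (by linarith) hε hεr hr1
      hw'
  have hwc : Continuous w := by
    refine continuous_of_uniform_approx_of_continuous fun u hu => ?_
    obtain ⟨η, hη, hηu⟩ := Metric.mem_uniformity_dist.1 hu
    set A := 16 * (∑ i, |θ i|) * (24 * M) with hA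
    have hA0 : 0 ≤ A := by positivity
    set ε := min (r / 2) (η / (2 * (A + 1))) with hε
    have hε0 : 0 < ε := lt_min (by linarith) (by positivity)
    refine ⟨_, continuous_truncatedVelocity hα hε0 hωi (h.param i).continuous hnc hn1,
      fun s => hηu ?_⟩
    rw [Real.dist_eq]
    refine (happrox ε hε0 ((min_le_left _ _).trans_lt (by linarith)) s).trans_lt ?_
    calc A * ε ≤ (A + 1) * (η / (2 * (A + 1))) := by
          gcongr
          · linarith
          · exact min_le_right _ _
      _ = η / 2 := by field_simp
      _ < η := by linarith
  simp_rw [hVw]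
  exact hwc.smul hnc

end Regular

/-! ### The velocity at a pair of closest points -/

/-- First-order condition for the squared distance. Applied at both ends it puts a closest pair on a
common normal line. -/
theorem inner_deriv_eq_zero_of_closest {y : ℝ → Plane} {q y' : Plane} {s₀ δ : ℝ}
    (hy : HasDerivAt y y' s₀) (hδ : 0 < δ)
    (hmin : ∀ u, |u| < δ → dist (y s₀) q ≤ dist (y (s₀ + u)) q) : inner ℝ (y s₀ - q) y' = 0 := by
  have hd : HasDerivAt (fun s => ‖y s - q‖ ^ 2) (2 * inner ℝ (y s₀ - q) y') s₀ :=
    (hy.sub_const q).norm_sq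
  have hloc : IsLocalMin (fun s => ‖y s - q‖ ^ 2) s₀ := by
    filter_upwards [Metric.ball_mem_nhds s₀ hδ] with s hs
    have := hmin (s - s₀) (by simpa [Real.dist_eq] using hs)
    rw [add_sub_cancel, dist_eq_norm, dist_eq_norm] at this
    exact pow_le_pow_left₀ (norm_nonneg _) this 2
  have := hloc.hasDerivAt_eq_zero hd
  linarith

theorem exists_sign_of_inner_eq_zero {e y' : Plane} (he : ‖e‖ = 1) (hy : ‖y'‖ = 1)
    (h : inner ℝ e y' = 0) : ∃ τ : ℝ, |τ| = 1 ∧ e = τ • perp y' := by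
  have h1 := eq_inner_smul_add hy e
  rw [h, zero_smul, add_zero] at h1
  refine ⟨_, ?_, h1⟩
  have := congrArg norm h1
  rw [norm_smul, norm_perp, hy, mul_one, he] at this
  exact this.symm

/-- At a pair of closest points the first curve bends away from the second one. -/
theorem curvature_le_of_closest {y₁ y₂ : ℝ → Plane} {e : Plane} {s₁ s₂ a₁ a₂ τ₁ τ₂ d δ M β : ℝ}
    (he : ‖e‖ = 1) (hτ₁ : |τ₁| = 1) (hτ₂ : |τ₂| = 1) (he₁ : e = τ₁ • perp (deriv y₁ s₁))
    (he₂ : e = τ₂ • perp (deriv y₂ s₂)) (hd : 0 < d) (hdist : y₁ s₁ - y₂ s₂ = d • e)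
    (hexp₁ : ∀ u, ‖y₁ (s₁ + u) - y₁ s₁ - u • deriv y₁ s₁ - (a₁ / 2 * u ^ 2) • perp (deriv y₁ s₁)‖
      ≤ M * |u| ^ β)
    (hexp₂ : ∀ u, ‖y₂ (s₂ + u) - y₂ s₂ - u • deriv y₂ s₂ - (a₂ / 2 * u ^ 2) • perp (deriv y₂ s₂)‖
      ≤ M * |u| ^ β) (hβ : 2 < β) (hδ : 0 < δ)
    (hmin : ∀ u v, |u| < δ → |v| < δ → d ≤ dist (y₁ (s₁ + u)) (y₂ (s₂ + v))) :
    τ₂ * a₂ ≤ τ₁ * a₁ := by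
  -- Otherwise moving both points by the same small `w` along `perp e` shortens their distance by `b
  -- / 2 * w ^ 2`, while the error `2 * M * w ^ β` is of higher order since `β > 2`.
  by_contra! hlt
  set b := τ₂ * a₂ - τ₁ * a₁ with hb
  have hb0 : 0 < b := by linarith
  have aux : ∀ (τ : ℝ) (y' : Plane), |τ| = 1 → e = τ • perp y' → τ * τ = 1 ∧ perp y' = τ • e ∧
      y' = (-τ) • perp e := by
    intro τ y' hτ h
    have hτ2 : τ * τ = 1 := by rw [← abs_mul_abs_self, hτ, one_mul]
    have hn : perp y' = τ • e := by rw [h, smul_smul, hτ2, one_smul]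
    refine ⟨hτ2, hn, ?_⟩
    have := congrArg perp hn
    rw [perp_perp, perp_smul] at this
    rw [neg_smul, ← this, neg_neg]
  obtain ⟨q1, n1, d1⟩ := aux τ₁ _ hτ₁ he₁
  obtain ⟨q2, n2, d2⟩ := aux τ₂ _ hτ₂ he₂
  have hlim : Tendsto (fun w : ℝ => 2 * M * w ^ (β - 2)) (𝓝 0) (𝓝 0) := by
    have := ((Real.continuousAt_rpow_const 0 (β - 2) (Or.inr (by linarith))).const_mul (2 * M))
    simp only [ContinuousAt] at this
    rwa [Real.zero_rpow (by linarith), mul_zero] at this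
  have hc2 : Tendsto (fun w : ℝ => b / 2 * w ^ 2) (𝓝 0) (𝓝 0) := by
    have : Continuous fun w : ℝ => b / 2 * w ^ 2 := by fun_prop
    simpa using this.tendsto 0
  have hev : ∀ᶠ w : ℝ in 𝓝[>] 0, (2 * M * w ^ (β - 2) < b / 2 ∧ b / 2 * w ^ 2 < d ∧ w < δ) ∧ 0 < w :=
    (((hlim.eventually (gt_mem_nhds (by linarith))).and ((hc2.eventually (gt_mem_nhds hd)).and
      (gt_mem_nhds hδ))).filter_mono nhdsWithin_le_nhds).and self_mem_nhdsWithin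
  obtain ⟨w, ⟨hw1, hw2, hwδ⟩, hw0⟩ := hev.exists
  -- The signs compensate the orientations: both points move in the direction `+ perp e`.
  have hm := hmin (-τ₁ * w) (-τ₂ * w) (by rw [abs_mul, abs_neg, hτ₁, one_mul, abs_of_pos hw0]; exact hwδ)
    (by rw [abs_mul, abs_neg, hτ₂, one_mul, abs_of_pos hw0]; exact hwδ)
  have b1 := hexp₁ (-τ₁ * w)
  have b2 := hexp₂ (-τ₂ * w)
  rw [abs_mul, abs_neg, hτ₁, one_mul, abs_of_pos hw0, n1, d1] at b1
  rw [abs_mul, abs_neg, hτ₂, one_mul, abs_of_pos hw0, n2, d2] at b2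
  set E₁ := y₁ (s₁ + -τ₁ * w) - y₁ s₁ - (-τ₁ * w) • (-τ₁) • perp e -
    (a₁ / 2 * (-τ₁ * w) ^ 2) • τ₁ • e with hE₁
  set E₂ := y₂ (s₂ + -τ₂ * w) - y₂ s₂ - (-τ₂ * w) • (-τ₂) • perp e -
    (a₂ / 2 * (-τ₂ * w) ^ 2) • τ₂ • e with hE₂
  have e1 : y₁ (s₁ + -τ₁ * w) = y₁ s₁ + w • perp e + (τ₁ * a₁ / 2 * w ^ 2) • e + E₁ := by
    have c1 : (-τ₁ * w) • (-τ₁) • perp e = w • perp e := by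
      rw [smul_smul]; congr 1; linear_combination w * q1
    have c2 : (a₁ / 2 * (-τ₁ * w) ^ 2) • τ₁ • e = (τ₁ * a₁ / 2 * w ^ 2) • e := by
      rw [smul_smul]; congr 1; linear_combination (τ₁ * a₁ / 2 * w ^ 2) * q1
    rw [hE₁, c1, c2]; abel
  have e2 : y₂ (s₂ + -τ₂ * w) = y₂ s₂ + w • perp e + (τ₂ * a₂ / 2 * w ^ 2) • e + E₂ := by
    have c1 : (-τ₂ * w) • (-τ₂) • perp e = w • perp e := by
      rw [smul_smul]; congr 1; linear_combination w * q2
    have c2 : (a₂ / 2 * (-τ₂ * w) ^ 2) • τ₂ • e = (τ₂ * a₂ / 2 * w ^ 2) • e := by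
      rw [smul_smul]; congr 1; linear_combination (τ₂ * a₂ / 2 * w ^ 2) * q2
    rw [hE₂, c1, c2]; abel
  have e3 : y₁ (s₁ + -τ₁ * w) - y₂ (s₂ + -τ₂ * w) = (d - b / 2 * w ^ 2) • e + (E₁ - E₂) := by
    have : y₁ (s₁ + -τ₁ * w) - y₂ (s₂ + -τ₂ * w) = (y₁ s₁ - y₂ s₂) +
        (τ₁ * a₁ / 2 * w ^ 2 - τ₂ * a₂ / 2 * w ^ 2) • e + (E₁ - E₂) := by
      rw [e1, e2]; module
    rw [this, hdist, hb]; module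
  rw [dist_eq_norm, e3] at hm
  have h4 : ‖(d - b / 2 * w ^ 2) • e + (E₁ - E₂)‖ ≤ (d - b / 2 * w ^ 2) + (M * w ^ β + M * w ^ β) := by
    refine (norm_add_le _ _).trans (add_le_add ?_ ((norm_sub_le _ _).trans (add_le_add b1 b2)))
    rw [norm_smul, he, mul_one, Real.norm_of_nonneg (by linarith)]
  have h5 : w ^ β = w ^ (β - 2) * w ^ 2 := by
    rw [Real.rpow_sub hw0]
    have : w ^ (2:ℝ) = w ^ 2 := by rw [← Real.rpow_natCast]; norm_num
    rw [this]; field_simp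
  have h6 : 2 * M * w ^ (β - 2) * w ^ 2 < b / 2 * w ^ 2 :=
    mul_lt_mul_of_pos_right hw1 (by positivity)
  have h7 : M * w ^ β + M * w ^ β = 2 * M * w ^ (β - 2) * w ^ 2 := by rw [h5]; ring
  linarith

section Regular

variable {N : ℕ} {k : ℕ} {α γ M R : ℝ} {θ : Fin N → ℝ} {Ω : Fin N → ℝ → Set Plane}
  {L : Fin N → ℝ → ℝ} {x : Fin N → ℝ → ℝ → Plane} {t : ℝ}

/-- The approach velocity of a pair of closest points on two strands of the interface. -/
theorem RegularAt.norm_velocity_sub_le (h : RegularAt k γ M Ω L x t) (hk : k = 1 ∨ k = 2)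
    (hα : 0 < α) (hγ0 : 0 < γ) (hγ1 : γ ≤ 1) (hαγ : 1 + 2 * α ≤ k + γ) (hR : 0 < R)
    (hMR : M * R ^ (k + γ - 1) ≤ 1) (hM : 0 ≤ M) {V : Plane → Plane}
    (hV : ∀ i s, IsNormalVelocity α (vorticity θ Ω t) (x i t s) (perp (deriv (x i t) s))
      (V (x i t s))) {i j : Fin N} {s₁ s₂ d δ r : ℝ} (hd : dist (x i t s₁) (x j t s₂) = d)
    (hd0 : 0 < d) (hd1 : d < 1) (hδ : 0 < δ)
    (hmin : ∀ u v, |u| < δ → |v| < δ → d ≤ dist (x i t (s₁ + u)) (x j t (s₂ + v)))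
    (hr0 : 0 < r) (hr1 : r ≤ 1) (hrR : r ≤ smallness (k + γ) * R)
    (hstrand : ∀ z ∈ interface Ω t, dist z (x i t s₁) < 4 * r ∨ dist z (x j t s₂) < 4 * r →
      (∃ u, |u| ≤ smallness (k + γ) * R ∧ z = x i t (s₁ + u)) ∨
      ∃ u, |u| ≤ smallness (k + γ) * R ∧ z = x j t (s₂ + u)) :
    ‖V (x i t s₁) - V (x j t s₂)‖ ≤ velocityConst (2 + 2 * α) * (∑ i, |θ i|) *
      (r ^ (-(2 * α)) + 24 * M * r ^ (k + γ - 1 - 2 * α)) * (d * (1 - Real.log d)) := by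
  obtain ⟨hβ1, hβ3⟩ := beta_bounds hk hγ0 hγ1
  set κ := smallness (k + γ) with hκ
  have hκ12 : κ ≤ 1 / 12 := min_le_left _ _
  set p := x i t s₁ with hp
  set q := x j t s₂ with hq
  set e := d⁻¹ • (p - q) with he_def
  have hnorm : ‖p - q‖ = d := by rw [← dist_eq_norm]; exact hd
  have he : ‖e‖ = 1 := by
    rw [he_def, norm_smul, hnorm, norm_inv, Real.norm_of_nonneg hd0.le, inv_mul_cancel₀ hd0.ne']
  have hpq : p - q = d • e := by rw [he_def, smul_smul, mul_inv_cancel₀ hd0.ne', one_smul]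
  have o1 : inner ℝ e (deriv (x i t) s₁) = 0 := by
    have := inner_deriv_eq_zero_of_closest (q := q) ((h.param i).hasDerivAt s₁) hδ (fun u hu => by
      have := hmin u 0 hu (by simpa using hδ)
      rw [add_zero] at this
      rw [← hp, hd]; exact this)
    rw [he_def, inner_smul_left, this, mul_zero]
  have o2 : inner ℝ e (deriv (x j t) s₂) = 0 := by
    have := inner_deriv_eq_zero_of_closest (q := p) ((h.param j).hasDerivAt s₂) hδ (fun u hu => by
      have := hmin 0 u (by simpa using hδ) hu
      rw [add_zero] at this
      rw [← hq, dist_comm, hd, dist_comm]; exact this)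
    rw [he_def, ← neg_sub, smul_neg, inner_neg_left, inner_smul_left, this, mul_zero, neg_zero]
  obtain ⟨τ₁, hτ₁, he₁⟩ := exists_sign_of_inner_eq_zero he ((h.param i).unit_speed s₁) o1
  obtain ⟨τ₂, hτ₂, he₂⟩ := exists_sign_of_inner_eq_zero he ((h.param j).unit_speed s₂) o2
  obtain ⟨a₁, ha₁, hk₁, hexp₁⟩ := (h.holder i).exists_expansion hk hγ0 hR hMR s₁
  obtain ⟨a₂, ha₂, hk₂, hexp₂⟩ := (h.holder j).exists_expansion hk hγ0 hR hMR s₂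
  have hsq : ∀ τ : ℝ, |τ| = 1 → τ ^ 2 = 1 := fun τ hτ => by rw [← sq_abs, hτ]; norm_num
  -- The order of the parabolas: for `k = 1` both are straight lines, for `k = 2` this is the
  -- second-order condition at the closest pair.
  have horder : τ₂ * a₂ ≤ τ₁ * a₁ ∧ (τ₁ * a₁ = τ₂ * a₂ ∨ (-d < 0 ∧ (2:ℝ) ≤ k + γ)) := by
    rcases hk with rfl | rfl
    · rw [hk₁.resolve_right (by norm_num), hk₂.resolve_right (by norm_num)]; simp
    · refine ⟨curvature_le_of_closest he hτ₁ hτ₂ he₁ he₂ hd0 hpq hexp₁ hexp₂ ?_ hδ hmin, Or.inr ?_⟩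
      · push_cast; linarith
      · push_cast; constructor <;> linarith
  have hq0 : q = frame p e (0, -d) := by
    have : q = p - d • e := by rw [← hpq]; abel
    rw [this]; simp [frame, sub_eq_add_neg]
  have habs : ∀ τ a : ℝ, |τ| = 1 → |τ * a| = |a| := fun τ a hτ => by rw [abs_mul, hτ, one_mul]
  have hsmall : ∀ a : ℝ, |a| * R ≤ 3 → ∀ u, |u| ≤ κ * R → |a| * |u| ≤ 1 / 4 := by
    intro a ha u hu
    calc |a| * |u| ≤ |a| * (κ * R) := by gcongr
      _ = |a| * R * κ := by ring
      _ ≤ 3 * (1 / 12) := mul_le_mul ha hκ12 (smallness_pos _).le (by norm_num)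
      _ = 1 / 4 := by norm_num
  have hthin : ∀ v ∈ frame p e ⁻¹' interface Ω t,
      (dist (frame p e v) p < 4 * r ∨ dist (frame p e v) q < 4 * r) →
      v ∈ thinSet (24 * M) (k + γ) (τ₁ * a₁) 0 ∨ v ∈ thinSet (24 * M) (k + γ) (τ₂ * a₂) (-d) := by
    intro v hv hdist
    have hMu : ∀ u, |u| ≤ κ * R → M * |u| ^ (k + γ - 1) ≤ 1 / 2 := fun u hu =>
      (mul_rpow_le_of_le_smallness hM hβ1 hR hMR (abs_nonneg u) hu).trans (by norm_num)
    rcases hstrand _ hv hdist with ⟨u, hu, hz⟩ | ⟨u, hu, hz⟩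
    · left
      exact mem_thinSet_of_frame_eq he hτ₁ he₁ (frame_zero p e).symm (hexp₁ u) hM hβ1.le hβ3
        (hMu u hu) ((hsmall a₁ ha₁ u hu).trans (by norm_num)) hz
    · right
      exact mem_thinSet_of_frame_eq he hτ₂ he₂ hq0 (hexp₂ u) hM hβ1.le hβ3
        (hMu u hu) ((hsmall a₂ ha₂ u hu).trans (by norm_num)) hz
  have har : (|τ₁ * a₁| + |τ₂ * a₂|) * r ≤ 1 / 2 := by
    rw [habs _ _ hτ₁, habs _ _ hτ₂, add_mul]
    have hr' : |r| ≤ κ * R := by rwa [abs_of_pos hr0]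
    have k1 := hsmall a₁ ha₁ r hr'
    have k2 := hsmall a₂ ha₂ r hr'
    rw [abs_of_pos hr0] at k1 k2
    linarith
  have hmr : 8 * (24 * M * r ^ (k + γ - 1)) ≤ 1 := by
    have := mul_rpow_le_of_le_smallness hM hβ1 hR hMR hr0.le hrR
    linarith
  have hWc := const_of_disjoint_preimage θ Ω t p e
  have hsym₁ : SymmetricNear (fun v => vorticity θ Ω t (frame p e v)) (24 * M) (k + γ) r (τ₁ * a₁) 0
      (τ₂ * a₂) (-d) 0 := by
    refine symmetricNear_of_subset hWc (fun v hv hrad => hthin v hv (Or.inl ?_)) hr0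
      (by positivity) hβ1.le horder.1 (by linarith) horder.2 har hmr
    have := norm_frame_sub he p 0 v
    rw [frame_zero] at this
    rw [dist_comm, dist_eq_norm, this]; exact hrad
  have hsym₂ : SymmetricNear (fun v => vorticity θ Ω t (frame p e v)) (24 * M) (k + γ) r (τ₁ * a₁) 0
      (τ₂ * a₂) (-d) (-d) := by
    refine symmetricNear_of_subset hWc (fun v hv hrad => hthin v hv (Or.inr ?_)) hr0
      (by positivity) hβ1.le horder.1 (by linarith) horder.2 har hmr
    have := norm_frame_sub he p (-d) v
    rw [← hq0] at this
    rw [dist_comm, dist_eq_norm, this]; exact hrad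
  have hV₁ := (hV i s₁).smul (hsq _ hτ₁)
  have hV₂ := (hV j s₂).smul (hsq _ hτ₂)
  rw [← he₁] at hV₁
  rw [← he₂] at hV₂
  obtain ⟨w₁, hw₁, hv₁⟩ := hV₁
  obtain ⟨w₂, hw₂, hv₂⟩ := hV₂
  have ht₁ : truncatedVelocity α (vorticity θ Ω t) p e =
      truncated (2 + 2 * α) 0 (fun v => vorticity θ Ω t (frame p e v)) := by
    ext ε; rw [← truncatedVelocity_frame he, frame_zero]
  have ht₂ : truncatedVelocity α (vorticity θ Ω t) q e =
      truncated (2 + 2 * α) (-d) (fun v => vorticity θ Ω t (frame p e v)) := by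
    ext ε; rw [← truncatedVelocity_frame he, ← hq0]
  rw [← hp, ht₁] at hw₁
  rw [← hq, ht₂] at hw₂
  have hfin := abs_sub_le_of_symmetricNear hsym₁ hsym₂ (fun v => abs_vorticity_le θ Ω t _)
    (integrable_vorticity_frame h p he) (by linarith) (by positivity) (by linarith) hr0 hr1 hd0 hd1
    (by rw [sub_neg_eq_add, zero_add, abs_of_pos hd0]) hw₁ hw₂
  rw [hv₁, hv₂, ← sub_smul, norm_smul, he, mul_one, Real.norm_eq_abs]
  refine hfin.trans_eq ?_
  rw [show 2 - (2 + 2 * α) = -(2 * α) by ring,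
    show (k + γ - (2 + 2 * α) + 1 : ℝ) = k + γ - 1 - 2 * α by ring]

end Regular

/-! ### Branches at a fixed time -/

section Branches

variable {N : ℕ} {k : ℕ} {γ M ρ : ℝ} {Ω : Fin N → ℝ → Set Plane} {x₀ : Plane}
  {L : Fin N → ℝ → ℝ} {x : Fin N → ℝ → ℝ → Plane} {t : ℝ} {C : Fin 2 → ℝ → Set Plane}

/-- The branches of the interface in a ball, at a fixed time. -/
structure BranchesAt (Ω : Fin N → ℝ → Set Plane) (x : Fin N → ℝ → ℝ → Plane) (x₀ : Plane) (ρ : ℝ)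
    (C : Fin 2 → ℝ → Set Plane) (t : ℝ) : Prop where
  branch : ∀ j, ∃ i a b, a < b ∧ C j t = x i t '' Ioo a b
  disj : Disjoint (C 0 t) (C 1 t)
  union : C 0 t ∪ C 1 t = interface Ω t ∩ Metric.ball x₀ ρ

theorem BranchesAt.disjoint_rev (hC : BranchesAt Ω x x₀ ρ C t) (j : Fin 2) :
    Disjoint (C j t) (C j.rev t) := by
  fin_cases j
  · exact hC.disj
  · exact hC.disj.symm

theorem BranchesAt.mem_or_mem_rev (hC : BranchesAt Ω x x₀ ρ C t) (j : Fin 2) {z : Plane}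
    (hz : z ∈ interface Ω t) (hzB : z ∈ Metric.ball x₀ ρ) : z ∈ C j t ∨ z ∈ C j.rev t := by
  have : z ∈ C 0 t ∪ C 1 t := by rw [hC.union]; exact ⟨hz, hzB⟩
  fin_cases j
  · exact this
  · exact this.symm

theorem BranchesAt.subset (hC : BranchesAt Ω x x₀ ρ C t) (j : Fin 2) :
    C j t ⊆ interface Ω t ∩ Metric.ball x₀ ρ := by
  rw [← hC.union]
  fin_cases j
  · exact subset_union_left
  · exact subset_union_right

theorem BranchesAt.nonempty (hC : BranchesAt Ω x x₀ ρ C t) (j : Fin 2) : (C j t).Nonempty := by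
  obtain ⟨i, a, b, hab, h⟩ := hC.branch j
  rw [h]
  exact (nonempty_Ioo.2 hab).image _

theorem BranchesAt.isPreconnected (hC : BranchesAt Ω x x₀ ρ C t) (h : RegularAt k γ M Ω L x t)
    (j : Fin 2) : IsPreconnected (C j t) := by
  obtain ⟨i, a, b, hab, hj⟩ := hC.branch j
  rw [hj]
  exact isPreconnected_Ioo.image _ (h.param i).continuous.continuousOn

theorem mem_of_eq_of_mem_frontier (h : RegularAt k γ M Ω L x t) {i j : Fin N} {z : Plane}
    (hi : z ∈ frontier (Ω i t)) (hj : z ∈ frontier (Ω j t)) : i = j := by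
  by_contra hne
  exact Set.disjoint_left.1 (h.disjoint i j hne) hi hj

/-- The branches are relatively closed in the ball. -/
theorem BranchesAt.mem_of_mem_closure (hC : BranchesAt Ω x x₀ ρ C t) (h : RegularAt k γ M Ω L x t)
    (j : Fin 2) {z : Plane} (hz : z ∈ closure (C j t)) (hzB : z ∈ Metric.ball x₀ ρ) :
    z ∈ C j t := by
  obtain ⟨i, a, b, hab, hj⟩ := hC.branch j
  have hcl : closure (C j t) ⊆ x i t '' Icc a b := by
    refine closure_minimal ?_ (isCompact_Icc.image (h.param i).continuous).isClosed
    rw [hj]; exact image_mono Ioo_subset_Icc_self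
  obtain ⟨s, hs, rfl⟩ := hcl hz
  by_contra hnot
  have hmem : x i t s ∈ C j.rev t :=
    (hC.mem_or_mem_rev j ((mem_interface h).2 ⟨i, s, rfl⟩) hzB).resolve_left hnot
  obtain ⟨i', a', b', hab', hj'⟩ := hC.branch j.rev
  rw [hj'] at hmem
  obtain ⟨r, hr, hrs⟩ := hmem
  have hii : i' = i := mem_of_eq_of_mem_frontier h ((h.param i').mem r) (hrs ▸ (h.param i).mem s)
  subst hii
  obtain ⟨n, hn⟩ := (h.param i').exists_int hrs
  -- points of the arc close to the endpoint also belong to the other branch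
  have hcl' : s ∈ closure (Ioo a b) := by rw [closure_Ioo hab.ne]; exact hs
  have hopen : IsOpen {s' : ℝ | s' + n * L i' t ∈ Ioo a' b'} :=
    isOpen_Ioo.preimage (by fun_prop)
  obtain ⟨s', hs'1, hs'2⟩ := mem_closure_iff.1 hcl' _ hopen
    (by change s + n * L i' t ∈ Ioo a' b'; rw [← hn]; exact hr)
  have hA : x i' t s' ∈ C j t := by rw [hj]; exact mem_image_of_mem _ hs'2
  have hB : x i' t s' ∈ C j.rev t := by
    rw [hj', ← (h.param i').add_int_mul n s']; exact mem_image_of_mem _ hs'1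
  exact Set.disjoint_left.1 (hC.disjoint_rev j) hA hB

theorem BranchesAt.notMem_closure_rev (hC : BranchesAt Ω x x₀ ρ C t) (h : RegularAt k γ M Ω L x t)
    (j : Fin 2) {z : Plane} (hz : z ∈ C j t) : z ∉ closure (C j.rev t) := fun hcl =>
  Set.disjoint_left.1 (hC.disjoint_rev j) hz (hC.mem_of_mem_closure h _ hcl (hC.subset j hz).2)

/-- The branches are disjoint, relatively closed, and fill the interface in the ball. Hence they are
also relatively open, and a connected set cannot meet both. -/
theorem BranchesAt.subset_of_isPreconnected (hC : BranchesAt Ω x x₀ ρ C t)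
    (h : RegularAt k γ M Ω L x t) (j : Fin 2) {Z : Set Plane} (hZ : IsPreconnected Z)
    (hsub : Z ⊆ interface Ω t ∩ Metric.ball x₀ ρ) {z : Plane} (hz : z ∈ Z) (hzC : z ∈ C j t) :
    Z ⊆ C j t := by
  intro w hw
  by_contra hnot
  have hw' := (hC.mem_or_mem_rev j (hsub hw).1 (hsub hw).2).resolve_left hnot
  have hwj : w ∉ closure (C j t) := by
    have := hC.notMem_closure_rev h j.rev hw'
    rwa [Fin.rev_rev] at this
  obtain ⟨v, hv, hv1, hv2⟩ := hZ (closure (C j.rev t))ᶜ (closure (C j t))ᶜ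
    isClosed_closure.isOpen_compl isClosed_closure.isOpen_compl
    (fun v hv => (hC.mem_or_mem_rev j (hsub hv).1 (hsub hv).2).imp
      (fun hvC => hC.notMem_closure_rev h j hvC) (fun hvC => by
        have := hC.notMem_closure_rev h j.rev hvC
        rwa [Fin.rev_rev] at this))
    ⟨z, hz, hC.notMem_closure_rev h j hzC⟩ ⟨w, hw, hwj⟩
  rcases hC.mem_or_mem_rev j (hsub hv).1 (hsub hv).2 with h' | h'
  · exact hv2 (subset_closure h')
  · exact hv1 (subset_closure h')

theorem BranchesAt.exists_nhds (hC : BranchesAt Ω x x₀ ρ C t) (h : RegularAt k γ M Ω L x t)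
    (j : Fin 2) {z : Plane} (hz : z ∈ C j t) :
    ∀ᶠ w in 𝓝 z, w ∈ interface Ω t → w ∈ C j t := by
  filter_upwards [isClosed_closure.isOpen_compl.mem_nhds (hC.notMem_closure_rev h j hz),
    Metric.isOpen_ball.mem_nhds (hC.subset j hz).2] with w hw hwB hwI
  exact (hC.mem_or_mem_rev j hwI hwB).resolve_right fun h' => hw (subset_closure h')

theorem exists_chord_scale (M : ℝ) {γ : ℝ} (hγ0 : 0 < γ) :
    ∃ δ > 0, δ ≤ 1 ∧ M * δ ^ γ ≤ 1 / 2 := by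
  have h : Tendsto (fun δ : ℝ => M * δ ^ γ) (𝓝[>] 0) (𝓝 0) := by
    have := ((Real.continuousAt_rpow_const 0 γ (Or.inr hγ0.le)).const_mul M)
    simp only [ContinuousAt] at this
    rw [Real.zero_rpow hγ0.ne', mul_zero] at this
    exact this.mono_left nhdsWithin_le_nhds
  obtain ⟨δ, hδ, hδ0, hδ1⟩ := ((h.eventually (gt_mem_nhds (by norm_num : (0:ℝ) < 1 / 2))).and
    (Ioc_mem_nhdsGT one_pos)).exists
  exact ⟨δ, hδ0, hδ1, hδ.le⟩

/-- A bi-Lipschitz arc in the interface covers a neighbourhood of its midpoint. -/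
theorem RegularAt.arc_covers_nhds (h : RegularAt k γ M Ω L x t) (hk : k = 1 ∨ k = 2)
    (hγ0 : 0 < γ) (hγ1 : γ ≤ 1) {Y : ℝ → Plane} {δ : ℝ} (hδ : 0 < δ)
    (hY : ∀ s ∈ Icc (-δ) δ, Y s ∈ interface Ω t)
    (hY1 : ∀ s ∈ Icc (-δ) δ, ∀ r ∈ Icc (-δ) δ, |s - r| / 2 ≤ dist (Y s) (Y r))
    (hY2 : ∀ s ∈ Icc (-δ) δ, ∀ r ∈ Icc (-δ) δ, dist (Y s) (Y r) ≤ |s - r|) :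
    ∃ η > 0, ∀ z ∈ interface Ω t, dist z (Y 0) < η → ∃ s ∈ Icc (-δ) δ, z = Y s := by
  obtain ⟨δ₁, hδ₁, hδ₁1, hMδ⟩ := exists_chord_scale M hγ0
  obtain ⟨i, σ₀, hσ₀⟩ := (mem_interface h).1 (hY 0 ⟨by linarith, hδ.le⟩)
  have hchord : ∀ s r, |s - r| ≤ δ₁ → |s - r| / 2 ≤ dist (x i t s) (x i t r) :=
    fun s r => (h.holder i).half_le_dist hk hγ0 hγ1 hδ₁1 hMδ
  have hstr : ∀ δ' > 0, ∃ r₀ > 0, ∀ z ∈ interface Ω t, dist z (Y 0) < r₀ →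
      ∃ σ, |σ - σ₀| < δ' ∧ z = x i t σ := by
    intro δ' hδ'
    obtain ⟨r₀, hr₀, H⟩ := exists_strand_radius h.param h.disjoint hδ'
    refine ⟨r₀, hr₀, fun z hz hd => ?_⟩
    obtain ⟨i', s, rfl⟩ := (mem_interface h).1 hz
    rw [hσ₀] at hd
    obtain ⟨rfl, n, hn⟩ := H i' i s σ₀ hd
    exact ⟨_, hn, ((h.param i').add_int_mul n s).symm⟩
  obtain ⟨r₀, hr₀, H₀⟩ := hstr (δ₁ / 2) (by linarith)
  set δ₂ := min δ (r₀ / 2) with hδ₂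
  have hδ₂0 : 0 < δ₂ := lt_min hδ (by linarith)
  have hsub : Icc (-δ₂) δ₂ ⊆ Icc (-δ) δ :=
    Icc_subset_Icc (neg_le_neg (min_le_left _ _)) (min_le_left _ _)
  have h0 : (0:ℝ) ∈ Icc (-δ₂) δ₂ := ⟨by linarith, hδ₂0.le⟩
  have hex : ∀ s ∈ Icc (-δ₂) δ₂, ∃ σ, |σ - σ₀| < δ₁ / 2 ∧ Y s = x i t σ := fun s hs => by
    refine H₀ _ (hY s (hsub hs)) ((hY2 s (hsub hs) 0 (hsub h0)).trans_lt ?_)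
    rw [sub_zero]
    have : |s| ≤ δ₂ := abs_le.2 hs
    have : δ₂ ≤ r₀ / 2 := min_le_right _ _
    linarith
  -- `Y` is pulled back to a parameter `τ` of the boundary curve. Being continuous and injective,
  -- `τ` is strictly monotone, so its values fill an interval around `σ₀ = τ 0`.
  choose! τ hτ1 hτ2 using hex
  have hclose : ∀ s ∈ Icc (-δ₂) δ₂, ∀ r ∈ Icc (-δ₂) δ₂, |τ s - τ r| ≤ δ₁ := fun s hs r hr => by
    have := abs_sub_le (τ s) σ₀ (τ r)
    rw [abs_sub_comm σ₀] at this
    linarith [hτ1 s hs, hτ1 r hr]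
  have hlip : ∀ s ∈ Icc (-δ₂) δ₂, ∀ r ∈ Icc (-δ₂) δ₂, |τ s - τ r| ≤ 2 * |s - r| := fun s hs r hr => by
    have h1 := hchord _ _ (hclose s hs r hr)
    rw [← hτ2 s hs, ← hτ2 r hr] at h1
    linarith [hY2 s (hsub hs) r (hsub hr)]
  have hcont : ContinuousOn τ (Icc (-δ₂) δ₂) := by
    refine LipschitzOnWith.continuousOn (K := 2) (LipschitzOnWith.of_dist_le_mul fun s hs r hr => ?_)
    simpa [Real.dist_eq] using hlip s hs r hr
  have hinj : InjOn τ (Icc (-δ₂) δ₂) := fun s hs r hr hsr => by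
    have h1 := hY1 s (hsub hs) r (hsub hr)
    rw [hτ2 s hs, hτ2 r hr, hsr, dist_self] at h1
    have h2 : |s - r| = 0 := le_antisymm (by linarith) (abs_nonneg _)
    linarith [abs_eq_zero.1 h2]
  have hτ0 : τ 0 = σ₀ := by
    have h1 := hchord (τ 0) σ₀ (by linarith [hτ1 0 h0])
    rw [← hτ2 0 h0, ← hσ₀, dist_self] at h1
    have h2 : |τ 0 - σ₀| = 0 := le_antisymm (by linarith) (abs_nonneg _)
    linarith [abs_eq_zero.1 h2]
  have hl : (-δ₂) ∈ Icc (-δ₂) δ₂ := ⟨le_rfl, by linarith⟩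
  have hr : δ₂ ∈ Icc (-δ₂) δ₂ := ⟨by linarith, le_rfl⟩
  have himg : ∃ m > 0, Icc (σ₀ - m) (σ₀ + m) ⊆ τ '' Icc (-δ₂) δ₂ := by
    have hle : -δ₂ ≤ δ₂ := by linarith
    rcases hcont.strictMonoOn_of_injOn_Icc' hle hinj with hm | hm
    · have m1 := hm hl h0 (by linarith)
      have m2 := hm h0 hr hδ₂0
      rw [hτ0] at m1 m2
      refine ⟨min (σ₀ - τ (-δ₂)) (τ δ₂ - σ₀), lt_min (by linarith) (by linarith), ?_⟩
      refine (Icc_subset_Icc ?_ ?_).trans (intermediate_value_Icc hle hcont)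
      · linarith [min_le_left (σ₀ - τ (-δ₂)) (τ δ₂ - σ₀)]
      · linarith [min_le_right (σ₀ - τ (-δ₂)) (τ δ₂ - σ₀)]
    · have m1 := hm hl h0 (by linarith)
      have m2 := hm h0 hr hδ₂0
      rw [hτ0] at m1 m2
      refine ⟨min (σ₀ - τ δ₂) (τ (-δ₂) - σ₀), lt_min (by linarith) (by linarith), ?_⟩
      refine (Icc_subset_Icc ?_ ?_).trans (intermediate_value_Icc' hle hcont)
      · linarith [min_le_left (σ₀ - τ δ₂) (τ (-δ₂) - σ₀)]
      · linarith [min_le_right (σ₀ - τ δ₂) (τ (-δ₂) - σ₀)]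
  obtain ⟨m, hm0, hm⟩ := himg
  obtain ⟨η, hη, H⟩ := hstr m hm0
  refine ⟨η, hη, fun z hz hd => ?_⟩
  obtain ⟨σ, hσ, rfl⟩ := H z hz hd
  have := abs_lt.1 hσ
  obtain ⟨s, hs, rfl⟩ := hm ⟨by linarith, by linarith⟩
  exact ⟨s, hsub hs, (hτ2 s hs).symm⟩

end Branches

/-! ### Continuity of the branches in time -/

section Labels

variable {N : ℕ} {k : ℕ} {γ ρ c t : ℝ} {Ω : Fin N → ℝ → Set Plane} {x₀ : Plane}
  {L : Fin N → ℝ → ℝ} {x : Fin N → ℝ → ℝ → Plane} {C : Fin 2 → ℝ → Set Plane} {I : Set ℝ}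

/-- The properties of the interface before a splash which determine how its branches evolve. -/
structure SplashWindow (k : ℕ) (γ : ℝ) (Ω : Fin N → ℝ → Set Plane) (L : Fin N → ℝ → ℝ)
    (x : Fin N → ℝ → ℝ → Plane) (x₀ : Plane) (ρ c : ℝ) (C : Fin 2 → ℝ → Set Plane) (I : Set ℝ) :
    Prop where
  k_eq : k = 1 ∨ k = 2
  γ_pos : 0 < γ
  γ_le : γ ≤ 1
  ρ_pos : 0 < ρ
  c_pos : 0 < c
  regular : ∀ t ∈ I, ∃ M, ∀ᶠ t' in 𝓝[I] t, RegularAt k γ M Ω L x t'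
  tendsto : ∀ i, ∀ t ∈ I, Tendsto (fun t' => Metric.hausdorffEDist (frontier (Ω i t'))
    (frontier (Ω i t))) (𝓝[I] t) (𝓝 0)
  branches : ∀ t ∈ I, BranchesAt Ω x x₀ ρ C t
  touch_only : ∀ t ∈ I, ∀ p ∈ C 0 t, ∀ q ∈ C 1 t, dist p q < c →
    p ∈ Metric.ball x₀ (ρ / 2) ∧ q ∈ Metric.ball x₀ (ρ / 2)
  meets : ∀ t ∈ I, ∀ j, ∃ z ∈ C j t, z ∈ Metric.ball x₀ (ρ / 2)

/-- The limit points of the branch `C j` along an ultrafilter of times. -/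
def limitSet (C : Fin 2 → ℝ → Set Plane) (U : Ultrafilter ℝ) (j : Fin 2) : Set Plane :=
  {a | Tendsto (fun t' => Metric.infDist a (C j t')) U (𝓝 0)}

theorem mem_limitSet_of_tendsto {U : Ultrafilter ℝ} {j : Fin 2} {f : ℝ → Plane} {a : Plane}
    (hf : ∀ᶠ t' in (U : Filter ℝ), f t' ∈ C j t') (ha : Tendsto f U (𝓝 a)) :
    a ∈ limitSet C U j := by
  have h1 : Tendsto (fun t' => dist a (f t')) U (𝓝 0) := by
    have := (tendsto_const_nhds (x := a)).dist ha
    rwa [dist_self] at this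
  refine squeeze_zero' (Eventually.of_forall fun _ => Metric.infDist_nonneg) ?_ h1
  filter_upwards [hf] with t' ht'
  exact Metric.infDist_le_dist_of_mem ht'

theorem isClosed_limitSet (C : Fin 2 → ℝ → Set Plane) (U : Ultrafilter ℝ) (j : Fin 2) :
    IsClosed (limitSet C U j) := by
  refine isClosed_of_closure_subset fun a ha => ?_
  refine Metric.tendsto_nhds.2 fun ε hε => ?_
  obtain ⟨b, hb, hab⟩ := Metric.mem_closure_iff.1 ha (ε / 2) (by linarith)
  filter_upwards [Metric.tendsto_nhds.1 hb (ε / 2) (by linarith)] with t' ht'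
  rw [Real.dist_0_eq_abs, abs_of_nonneg Metric.infDist_nonneg] at ht' ⊢
  have := Metric.infDist_le_infDist_add_dist (s := C j t') (x := a) (y := b)
  linarith

section

variable (hS : SplashWindow k γ Ω L x x₀ ρ c C I) (ht : t ∈ I) {U : Ultrafilter ℝ}
  (hU : (U : Filter ℝ) ≤ 𝓝[I] t)

include hS ht in
theorem SplashWindow.regularAt : ∃ M, RegularAt k γ M Ω L x t := by
  obtain ⟨M, hM⟩ := hS.regular t ht
  exact ⟨M, hM.self_of_nhdsWithin ht⟩

include hS ht hU in
-- One half of Hausdorff convergence: boundary points at nearby times are close to the boundary at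
-- time `t`. The other half gives `SplashWindow.exists_approx`.
theorem SplashWindow.mem_frontier_of_tendsto {i : Fin N} {f : ℝ → Plane} {a : Plane}
    (hf : ∀ᶠ t' in (U : Filter ℝ), f t' ∈ frontier (Ω i t')) (ha : Tendsto f U (𝓝 a)) :
    a ∈ frontier (Ω i t) := by
  rw [← isClosed_frontier.closure_eq, Metric.mem_closure_iff_infEDist_zero]
  have h1 : Tendsto (fun t' => Metric.infEDist (f t') (frontier (Ω i t))) U (𝓝 0) := by
    refine tendsto_of_tendsto_of_tendsto_of_le_of_le' tendsto_const_nhds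
      ((hS.tendsto i t ht).mono_left hU) (Eventually.of_forall fun _ => zero_le) ?_
    filter_upwards [hf] with t' ht'
    exact Metric.infEDist_le_hausdorffEDist_of_mem ht'
  have h2 : Tendsto (fun t' => Metric.infEDist (f t') (frontier (Ω i t))) U
      (𝓝 (Metric.infEDist a (frontier (Ω i t)))) := (Metric.continuous_infEDist.tendsto a).comp ha
  exact tendsto_nhds_unique h2 h1

include hS ht hU in
theorem SplashWindow.exists_approx {i : Fin N} {a : Plane} (ha : a ∈ frontier (Ω i t)) :
    ∃ f : ℝ → Plane, (∀ᶠ t' in (U : Filter ℝ), f t' ∈ frontier (Ω i t')) ∧ Tendsto f U (𝓝 a) := by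
  obtain ⟨M, hM⟩ := hS.regular t ht
  have hex : ∀ t', ∃ z, RegularAt k γ M Ω L x t' → z ∈ frontier (Ω i t') ∧
      Metric.infEDist a (frontier (Ω i t')) = edist a z := fun t' => by
    by_cases h : RegularAt k γ M Ω L x t'
    · obtain ⟨z, hz⟩ := (h.param i).isCompact.exists_infEDist_eq_edist ⟨_, (h.param i).mem 0⟩ a
      exact ⟨z, fun _ => hz⟩
    · exact ⟨a, fun h' => absurd h' h⟩
  choose f hf using hex
  have hreg := hU hM
  refine ⟨f, ?_, ?_⟩
  · filter_upwards [hreg] with t' ht' using (hf t' ht').1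
  · rw [tendsto_iff_edist_tendsto_0]
    refine tendsto_of_tendsto_of_tendsto_of_le_of_le' tendsto_const_nhds
      ((hS.tendsto i t ht).mono_left hU) (Eventually.of_forall fun _ => zero_le) ?_
    filter_upwards [hreg] with t' ht'
    rw [edist_comm, ← (hf t' ht').2, Metric.hausdorffEDist_comm]
    exact Metric.infEDist_le_hausdorffEDist_of_mem ha

include hS ht hU in
/-- Limits of points of the interface are points of the interface. -/
theorem SplashWindow.exists_frontier_of_tendsto {f : ℝ → Plane} {a : Plane}
    (hf : ∀ᶠ t' in (U : Filter ℝ), f t' ∈ interface Ω t') (ha : Tendsto f U (𝓝 a)) :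
    ∃ i, a ∈ frontier (Ω i t) ∧ ∀ᶠ t' in (U : Filter ℝ), f t' ∈ frontier (Ω i t') := by
  have h1 : ∀ᶠ t' in (U : Filter ℝ), ∃ i, f t' ∈ frontier (Ω i t') := by
    filter_upwards [hf] with t' ht' using mem_iUnion.1 ht'
  obtain ⟨i, hi⟩ := Ultrafilter.eventually_exists_iff.1 h1
  exact ⟨i, hS.mem_frontier_of_tendsto ht hU hi ha, hi⟩

include hS ht hU in
-- No branch disappears in the limit: `meets` provides points in the smaller ball, and their limit
-- cannot leave the ball of radius `ρ`.
theorem SplashWindow.limitSet_inter_nonempty (j : Fin 2) :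
    ∃ a ∈ limitSet C U j, a ∈ interface Ω t ∧ a ∈ Metric.ball x₀ ρ := by
  have hex : ∀ t', ∃ z, t' ∈ I → z ∈ C j t' ∧ z ∈ Metric.ball x₀ (ρ / 2) := fun t' => by
    by_cases h : t' ∈ I
    · obtain ⟨z, hz⟩ := hS.meets t' h j
      exact ⟨z, fun _ => hz⟩
    · exact ⟨x₀, fun h' => absurd h' h⟩
  choose f hf using hex
  have hI : ∀ᶠ t' in (U : Filter ℝ), t' ∈ I := hU self_mem_nhdsWithin
  obtain ⟨a, ha, hfa⟩ := exists_tendsto_ultrafilter (isCompact_closedBall x₀ (ρ / 2)) U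
    (hI.mono fun t' h => Metric.ball_subset_closedBall (hf t' h).2)
  obtain ⟨i, hi, -⟩ := hS.exists_frontier_of_tendsto ht hU
    (hI.mono fun t' h => ((hS.branches t' h).subset j (hf t' h).1).1) hfa
  refine ⟨a, mem_limitSet_of_tendsto (hI.mono fun t' h => (hf t' h).1) hfa, mem_iUnion.2 ⟨i, hi⟩, ?_⟩
  have := hS.ρ_pos
  exact Metric.closedBall_subset_ball (by linarith) ha

variable (hne : (U : Filter ℝ) ≤ 𝓝[≠] t)

include hS hU hne in
-- A branch is an open arc, so `infDist` need not be attained. The slack `|t' - t|` tends to `0` but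
-- is positive, because the ultrafilter avoids `t`.
theorem SplashWindow.exists_tendsto_of_mem_limitSet {j : Fin 2} {a : Plane}
    (ha : a ∈ limitSet C U j) :
    ∃ f : ℝ → Plane, (∀ᶠ t' in (U : Filter ℝ), f t' ∈ C j t') ∧ Tendsto f U (𝓝 a) := by
  have hex : ∀ t', ∃ z, t' ∈ I → t' ≠ t → z ∈ C j t' ∧
      dist a z < Metric.infDist a (C j t') + |t' - t| := fun t' => by
    by_cases h : t' ∈ I ∧ t' ≠ t
    · have hpos : 0 < |t' - t| := abs_pos.2 (sub_ne_zero.2 h.2)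
      obtain ⟨z, hz, hd⟩ := (Metric.infDist_lt_iff ((hS.branches t' h.1).nonempty j)).1
        (lt_add_of_pos_right (Metric.infDist a (C j t')) hpos)
      exact ⟨z, fun _ _ => ⟨hz, hd⟩⟩
    · exact ⟨a, fun h1 h2 => absurd ⟨h1, h2⟩ h⟩
  choose f hf using hex
  have hI : ∀ᶠ t' in (U : Filter ℝ), t' ∈ I := hU self_mem_nhdsWithin
  have hN : ∀ᶠ t' in (U : Filter ℝ), t' ≠ t := hne self_mem_nhdsWithin
  refine ⟨f, ?_, ?_⟩
  · filter_upwards [hI, hN] with t' h1 h2 using (hf t' h1 h2).1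
  · rw [tendsto_iff_dist_tendsto_zero]
    have hlim : Tendsto (fun t' => Metric.infDist a (C j t') + |t' - t|) U (𝓝 0) := by
      have h2 : Tendsto (fun t' : ℝ => |t' - t|) U (𝓝 0) := by
        have : Continuous fun t' : ℝ => |t' - t| := by fun_prop
        have h3 := this.tendsto t
        rw [sub_self, abs_zero] at h3
        exact h3.mono_left (hne.trans nhdsWithin_le_nhds)
      simpa using Tendsto.add ha h2
    refine squeeze_zero' (Eventually.of_forall fun _ => dist_nonneg) ?_ hlim
    filter_upwards [hI, hN] with t' h1 h2
    rw [dist_comm]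
    exact (hf t' h1 h2).2.le

include hS ht hU hne in
/-- The limit set of a branch is relatively open in the interface. -/
theorem SplashWindow.limitSet_open {j : Fin 2} {a : Plane} (ha : a ∈ limitSet C U j)
    (haB : a ∈ Metric.ball x₀ ρ) :
    ∃ η > 0, ∀ z ∈ interface Ω t, dist z a < η → z ∈ limitSet C U j := by
  obtain ⟨f, hf, hfa⟩ := hS.exists_tendsto_of_mem_limitSet hU hne ha
  obtain ⟨M, hM⟩ := hS.regular t ht
  have hMt := hM.self_of_nhdsWithin ht
  have hI : ∀ᶠ t' in (U : Filter ℝ), t' ∈ I := hU self_mem_nhdsWithin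
  have hreg : ∀ᶠ t' in (U : Filter ℝ), RegularAt k γ M Ω L x t' := hU hM
  obtain ⟨i, hai, hfi⟩ := hS.exists_frontier_of_tendsto ht hU
    (by filter_upwards [hf, hI] with t' h1 h2 using ((hS.branches t' h2).subset j h1).1) hfa
  have hex : ∀ t', ∃ σ, RegularAt k γ M Ω L x t' → f t' ∈ frontier (Ω i t') →
      f t' = x i t' σ := fun t' => by
    by_cases h : RegularAt k γ M Ω L x t' ∧ f t' ∈ frontier (Ω i t')
    · have h2 := h.2
      rw [← (h.1.param i).range_eq] at h2
      obtain ⟨σ, hσ⟩ := h2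
      exact ⟨σ, fun _ _ => hσ.symm⟩
    · exact ⟨0, fun h1 h2 => absurd ⟨h1, h2⟩ h⟩
  choose σ hσ using hex
  have hfσ : ∀ᶠ t' in (U : Filter ℝ), f t' = x i t' (σ t') := by
    filter_upwards [hreg, hfi] with t' h1 h2 using hσ t' h1 h2
  obtain ⟨δ₁, hδ₁, hδ₁1, hMδ⟩ := exists_chord_scale M hS.γ_pos
  have hgap : 0 < ρ - dist a x₀ := by rw [Metric.mem_ball] at haB; linarith
  set δ := min (δ₁ / 2) ((ρ - dist a x₀) / 3) with hδ_def
  have hδ : 0 < δ := lt_min (by linarith) (by linarith)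
  -- An arc of fixed parameter radius `δ` about `f t'` stays in the ball; being connected, it stays
  -- on the branch.
  have hmem : ∀ᶠ t' in (U : Filter ℝ), ∀ s ∈ Icc (-δ) δ, x i t' (σ t' + s) ∈ C j t' ∧
      x i t' (σ t' + s) ∈ Metric.closedBall x₀ ρ := by
    filter_upwards [hreg, hI, hf, hfσ,
      hfa.eventually (Metric.ball_mem_nhds a (by linarith : 0 < (ρ - dist a x₀) / 3))]
      with t' h1 h2 h3 h4 h5
    have hball : ∀ s ∈ Icc (-δ) δ, x i t' (σ t' + s) ∈ Metric.ball x₀ ρ := fun s hs => by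
      have d1 := (h1.param i).dist_le (σ t' + s) (σ t')
      rw [add_sub_cancel_left, ← h4] at d1
      have d2 : |s| ≤ δ := abs_le.2 hs
      have d3 : δ ≤ (ρ - dist a x₀) / 3 := min_le_right _ _
      rw [Metric.mem_ball]
      have d4 := dist_triangle4 (x i t' (σ t' + s)) (f t') a x₀
      linarith
    have hZ : IsPreconnected ((fun s => x i t' (σ t' + s)) '' Icc (-δ) δ) :=
      isPreconnected_Icc.image _ ((h1.param i).continuous.comp (by fun_prop)).continuousOn
    have hsub := (hS.branches t' h2).subset_of_isPreconnected h1 j hZ (by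
      rintro _ ⟨s, hs, rfl⟩
      exact ⟨(mem_interface h1).2 ⟨i, _, rfl⟩, hball s hs⟩)
      (z := f t') ⟨0, ⟨by linarith, hδ.le⟩, by simp [h4]⟩ h3
    exact fun s hs => ⟨hsub ⟨s, hs, rfl⟩, Metric.ball_subset_closedBall (hball s hs)⟩
  -- The parametrizations at different times are unrelated. The limit arc `Y` is taken pointwise
  -- along the ultrafilter and inherits only bi-Lipschitz bounds, which are enough for
  -- `arc_covers_nhds`.
  have hYex : ∀ s ∈ Icc (-δ) δ, ∃ b, Tendsto (fun t' => x i t' (σ t' + s)) U (𝓝 b) := by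
    intro s hs
    obtain ⟨b, -, hb⟩ := exists_tendsto_ultrafilter (isCompact_closedBall x₀ ρ) U
      (hmem.mono fun t' h => (h s hs).2)
    exact ⟨b, hb⟩
  choose! Y hY using hYex
  have hY0 : Y 0 = a := by
    have h1 := hY 0 ⟨by linarith, hδ.le⟩
    simp only [add_zero] at h1
    exact tendsto_nhds_unique h1 (hfa.congr' hfσ)
  have hYI : ∀ s ∈ Icc (-δ) δ, Y s ∈ interface Ω t := fun s hs => by
    refine mem_iUnion.2 ⟨i, hS.mem_frontier_of_tendsto ht hU ?_ (hY s hs)⟩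
    filter_upwards [hreg] with t' h1 using (h1.param i).mem _
  obtain ⟨η, hη, hcov⟩ := hMt.arc_covers_nhds hS.k_eq hS.γ_pos hS.γ_le hδ hYI
    (fun s hs r hr => by
      refine ge_of_tendsto ((hY s hs).dist (hY r hr)) ?_
      filter_upwards [hreg] with t' h1
      have hsr : |σ t' + s - (σ t' + r)| ≤ δ₁ := by
        rw [add_sub_add_left_eq_sub]
        have d1 : |s| ≤ δ := abs_le.2 hs
        have d2 : |r| ≤ δ := abs_le.2 hr
        have d3 : δ ≤ δ₁ / 2 := min_le_left _ _
        linarith [abs_sub s r]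
      have := (h1.holder i).half_le_dist hS.k_eq hS.γ_pos hS.γ_le hδ₁1 hMδ hsr
      rwa [add_sub_add_left_eq_sub] at this)
    (fun s hs r hr => by
      refine le_of_tendsto ((hY s hs).dist (hY r hr)) ?_
      filter_upwards [hreg] with t' h1
      have := (h1.param i).dist_le (σ t' + s) (σ t' + r)
      rwa [add_sub_add_left_eq_sub] at this)
  refine ⟨η, hη, fun z hz hd => ?_⟩
  obtain ⟨s, hs, rfl⟩ := hcov z hz (by rwa [hY0])
  exact mem_limitSet_of_tendsto (hmem.mono fun t' h => (h s hs).1) (hY s hs)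

/-- Connectedness of `Z`: its intersection with `J` is relatively closed, and relatively open by
`hopen`. -/
theorem subset_of_locally_subset {Z J : Set Plane} (hZ : IsPreconnected Z) (hJ : IsClosed J)
    (hopen : ∀ a ∈ Z, a ∈ J → ∃ η > 0, ∀ z ∈ Z, dist z a < η → z ∈ J) {a : Plane} (haZ : a ∈ Z)
    (haJ : a ∈ J) : Z ⊆ J := by
  choose! η hη hsub using hopen
  intro b hb
  by_contra hbJ
  set u : Set Plane := ⋃ a ∈ Z ∩ J, Metric.ball a (η a) with hu
  have huo : IsOpen u := isOpen_biUnion fun _ _ => Metric.isOpen_ball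
  have hmem : ∀ z ∈ Z, z ∈ J → z ∈ u := fun z hz hzJ =>
    mem_biUnion ⟨hz, hzJ⟩ (Metric.mem_ball_self (hη z hz hzJ))
  obtain ⟨w, hwZ, hwu, hwJ⟩ := hZ u Jᶜ huo hJ.isOpen_compl
    (fun z hz => (em (z ∈ J)).imp (hmem z hz) id) ⟨a, haZ, hmem a haZ haJ⟩ ⟨b, hb, hbJ⟩
  obtain ⟨a', ha', hwa⟩ := mem_iUnion₂.1 hwu
  exact hwJ (hsub a' ha'.1 ha'.2 w hwZ hwa)

include hS ht hU hne in
/-- The branches do not collapse onto each other before the splash. -/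
theorem SplashWindow.disjoint_limitSet : Disjoint (limitSet C U 0) (limitSet C U 1) := by
  rw [Set.disjoint_left]
  intro a ha0 ha1
  have hI : ∀ᶠ t' in (U : Filter ℝ), t' ∈ I := hU self_mem_nhdsWithin
  have hρ := hS.ρ_pos
  obtain ⟨M, hM⟩ := hS.regular t ht
  have hMt := hM.self_of_nhdsWithin ht
  have hreg : ∀ᶠ t' in (U : Filter ℝ), RegularAt k γ M Ω L x t' := hU hM
  have hball : ∀ a, a ∈ limitSet C U 0 → a ∈ limitSet C U 1 → a ∈ Metric.closedBall x₀ (ρ / 2) := by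
    intro a ha0 ha1
    obtain ⟨f, hf, hfa⟩ := hS.exists_tendsto_of_mem_limitSet hU hne ha0
    obtain ⟨g, hg, hga⟩ := hS.exists_tendsto_of_mem_limitSet hU hne ha1
    have hd := hfa.dist hga
    rw [dist_self] at hd
    refine Metric.isClosed_closedBall.mem_of_tendsto hfa ?_
    filter_upwards [hf, hg, hI, hd.eventually (gt_mem_nhds hS.c_pos)] with t' h1 h2 h3 h4
    exact Metric.ball_subset_closedBall (hS.touch_only t' h3 _ h1 _ h2 h4).1
  obtain ⟨f, hf, hfa⟩ := hS.exists_tendsto_of_mem_limitSet hU hne ha0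
  obtain ⟨g, hg, hga⟩ := hS.exists_tendsto_of_mem_limitSet hU hne ha1
  obtain ⟨i, hai, hfi⟩ := hS.exists_frontier_of_tendsto ht hU
    (by filter_upwards [hf, hI] with t' h1 h2 using ((hS.branches t' h2).subset 0 h1).1) hfa
  obtain ⟨i', hai', hgi⟩ := hS.exists_frontier_of_tendsto ht hU
    (by filter_upwards [hg, hI] with t' h1 h2 using ((hS.branches t' h2).subset 1 h1).1) hga
  obtain rfl := mem_of_eq_of_mem_frontier hMt hai hai'
  -- The common limit points are open and closed in the boundary curve, so they would contain all of
  -- it. At nearby times the whole curve would then lie in the ball, hence on a single branch,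
  -- although it contains points of both.
  have hsubJ : frontier (Ω i t) ⊆ limitSet C U 0 ∩ limitSet C U 1 := by
    refine subset_of_locally_subset (hMt.param i).isPreconnected
      ((isClosed_limitSet C U 0).inter (isClosed_limitSet C U 1)) ?_ hai ⟨ha0, ha1⟩
    rintro b - ⟨hb0, hb1⟩
    have hbB : b ∈ Metric.ball x₀ ρ := Metric.closedBall_subset_ball (by linarith) (hball b hb0 hb1)
    obtain ⟨η₀, hη₀, h0⟩ := hS.limitSet_open ht hU hne hb0 hbB
    obtain ⟨η₁, hη₁, h1⟩ := hS.limitSet_open ht hU hne hb1 hbB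
    exact ⟨min η₀ η₁, lt_min hη₀ hη₁, fun z hz hd =>
      ⟨h0 z (mem_iUnion.2 ⟨i, hz⟩) (hd.trans_le (min_le_left _ _)),
        h1 z (mem_iUnion.2 ⟨i, hz⟩) (hd.trans_le (min_le_right _ _))⟩⟩
  have hH := ((hS.tendsto i t ht).mono_left hU).eventually
    (gt_mem_nhds (show (0 : ℝ≥0∞) < ENNReal.ofReal (ρ / 2) by simpa using hρ))
  obtain ⟨t', h1, h2, h3, h4, h5, h6, h7⟩ :=
    (hreg.and (hI.and (hf.and (hg.and (hfi.and (hgi.and hH)))))).exists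
  have hsub : frontier (Ω i t') ⊆ interface Ω t' ∩ Metric.ball x₀ ρ := by
    intro z hz
    refine ⟨mem_iUnion.2 ⟨i, hz⟩, ?_⟩
    obtain ⟨w, hw, hzw⟩ := Metric.infEDist_lt_iff.1
      ((Metric.infEDist_le_hausdorffEDist_of_mem hz).trans_lt h7)
    have hzw' : dist z w < ρ / 2 := by
      rw [edist_dist] at hzw
      exact (ENNReal.ofReal_lt_ofReal_iff (by linarith)).1 hzw
    have hwB := hball w (hsubJ hw).1 (hsubJ hw).2
    rw [Metric.mem_closedBall] at hwB
    rw [Metric.mem_ball]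
    linarith [dist_triangle z w x₀]
  have hall := (hS.branches t' h2).subset_of_isPreconnected h1 0 (h1.param i).isPreconnected hsub h5 h3
  exact Set.disjoint_left.1 (hS.branches t' h2).disj (hall h6) h4

include hS ht hU hne in
theorem SplashWindow.disjoint_limitSet_rev (j : Fin 2) :
    Disjoint (limitSet C U j) (limitSet C U j.rev) := by
  fin_cases j
  · exact hS.disjoint_limitSet ht hU hne
  · exact (hS.disjoint_limitSet ht hU hne).symm

include hS ht hU hne in
/-- A branch which meets the limit set of a branch is contained in it. -/
theorem SplashWindow.branch_subset_limitSet {j j' : Fin 2} {a : Plane} (ha : a ∈ C j' t)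
    (haj : a ∈ limitSet C U j) : C j' t ⊆ limitSet C U j := by
  obtain ⟨M, hM⟩ := hS.regularAt ht
  have hB := hS.branches t ht
  refine subset_of_locally_subset (hB.isPreconnected hM j') (isClosed_limitSet C U j) ?_ ha haj
  intro b hb hbj
  obtain ⟨η, hη, h⟩ := hS.limitSet_open ht hU hne hbj (hB.subset j' hb).2
  exact ⟨η, hη, fun z hz hd => h z (hB.subset j' hz).1 hd⟩

include hS ht hU hne in
/-- Limits of points of different branches lie on different branches. -/
theorem SplashWindow.exists_rev_of_limitSet {a b : Plane} (ha : a ∈ limitSet C U 0)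
    (hb : b ∈ limitSet C U 1) (haI : a ∈ interface Ω t) (hbI : b ∈ interface Ω t)
    (haB : a ∈ Metric.ball x₀ ρ) (hbB : b ∈ Metric.ball x₀ ρ) :
    ∃ j, a ∈ C j t ∧ b ∈ C j.rev t := by
  have hB := hS.branches t ht
  have hdis := Set.disjoint_left.1 (hS.disjoint_limitSet ht hU hne)
  rcases hB.mem_or_mem_rev 0 haI haB with h | h
  · refine ⟨0, h, (hB.mem_or_mem_rev 0 hbI hbB).resolve_left fun h' => ?_⟩
    exact hdis (hS.branch_subset_limitSet ht hU hne h ha h') hb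
  · refine ⟨1, h, (hB.mem_or_mem_rev 1 hbI hbB).resolve_left fun h' => ?_⟩
    exact hdis (hS.branch_subset_limitSet ht hU hne h ha h') hb

include hS ht hU hne in
/-- Points of different branches are not limits of the same branch. -/
theorem SplashWindow.notMem_limitSet_of_branches {a b : Plane} (ha : a ∈ C 0 t) (hb : b ∈ C 1 t)
    {j : Fin 2} (haj : a ∈ limitSet C U j) : b ∉ limitSet C U j := by
  intro hbj
  have hB := hS.branches t ht
  obtain ⟨z, hz, hzI, hzB⟩ := hS.limitSet_inter_nonempty ht hU j.rev
  have hzj : z ∈ limitSet C U j := by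
    rcases hB.mem_or_mem_rev 0 hzI hzB with h | h
    · exact hS.branch_subset_limitSet ht hU hne ha haj h
    · exact hS.branch_subset_limitSet ht hU hne hb hbj h
  exact Set.disjoint_left.1 (hS.disjoint_limitSet_rev ht hU hne j) hzj hz

end

end Labels

/-! ### The distance of the branches -/

theorem exists_ultrafilter_of_frequently {X : Type*} {f : Filter X} {P : X → Prop}
    (h : ∃ᶠ s in f, P s) : ∃ U : Ultrafilter X, (U : Filter X) ≤ f ∧ ∀ᶠ s in (U : Filter X), P s := by
  have : (f ⊓ 𝓟 {s | P s}).NeBot := frequently_mem_iff_neBot.1 h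
  have hle := Ultrafilter.of_le (f ⊓ 𝓟 {s | P s})
  exact ⟨_, hle.trans inf_le_left, le_principal_iff.1 (hle.trans inf_le_right)⟩

/-- The distance of the two branches at time `t`. -/
noncomputable def branchDist (C : Fin 2 → ℝ → Set Plane) (t : ℝ) : ℝ :=
  sInf (image2 dist (C 0 t) (C 1 t))

section Distance

variable {N : ℕ} {k : ℕ} {α γ M ρ c t : ℝ} {Ω : Fin N → ℝ → Set Plane} {x₀ : Plane}
  {L : Fin N → ℝ → ℝ} {x : Fin N → ℝ → ℝ → Plane} {C : Fin 2 → ℝ → Set Plane} {I : Set ℝ}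
  {θ : Fin N → ℝ}

theorem branchDist_le {p q : Plane} (hp : p ∈ C 0 t) (hq : q ∈ C 1 t) :
    branchDist C t ≤ dist p q := by
  refine csInf_le ⟨0, ?_⟩ (mem_image2_of_mem hp hq)
  rintro _ ⟨a, -, b, -, rfl⟩
  exact dist_nonneg

theorem branchDist_le_rev {j : Fin 2} {p q : Plane} (hp : p ∈ C j t) (hq : q ∈ C j.rev t) :
    branchDist C t ≤ dist p q := by
  fin_cases j
  · exact branchDist_le hp hq
  · rw [dist_comm]; exact branchDist_le hq hp

theorem BranchesAt.exists_dist_lt (hC : BranchesAt Ω x x₀ ρ C t) {y : ℝ}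
    (h : branchDist C t < y) : ∃ p ∈ C 0 t, ∃ q ∈ C 1 t, dist p q < y := by
  obtain ⟨_, ⟨p, hp, q, hq, rfl⟩, hlt⟩ :=
    exists_lt_of_csInf_lt (image2_nonempty_iff.2 ⟨hC.nonempty 0, hC.nonempty 1⟩) h
  exact ⟨p, hp, q, hq, hlt⟩

/-- Pairs closer than `c` lie in the smaller ball, and the parts of the branches in its closure are
disjoint compact sets. -/
theorem SplashWindow.branchDist_pos (hS : SplashWindow k γ Ω L x x₀ ρ c C I) (ht : t ∈ I) :
    0 < branchDist C t := by
  obtain ⟨M, h⟩ := hS.regularAt ht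
  have hB := hS.branches t ht
  have hρ := hS.ρ_pos
  have hsub : ∀ j, closure (C j t) ∩ Metric.closedBall x₀ (ρ / 2) ⊆ C j t := fun j z hz =>
    hB.mem_of_mem_closure h j hz.1 (Metric.closedBall_subset_ball (by linarith) hz.2)
  have hcpt : ∀ j, IsCompact (closure (C j t) ∩ Metric.closedBall x₀ (ρ / 2)) := fun j =>
    (isCompact_closedBall x₀ (ρ / 2)).inter_left isClosed_closure
  obtain ⟨r, hr, hsep⟩ := Metric.exists_pos_forall_lt_edist (hcpt 0) (hcpt 1).isClosed
    (hB.disj.mono (hsub 0) (hsub 1))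
  have hlow : min c r ≤ branchDist C t := by
    refine le_csInf (image2_nonempty_iff.2 ⟨hB.nonempty 0, hB.nonempty 1⟩) ?_
    rintro _ ⟨p, hp, q, hq, rfl⟩
    by_contra! hlt
    obtain ⟨hpB, hqB⟩ := hS.touch_only t ht p hp q hq (hlt.trans_le (min_le_left _ _))
    have := hsep p ⟨subset_closure hp, Metric.ball_subset_closedBall hpB⟩ q
      ⟨subset_closure hq, Metric.ball_subset_closedBall hqB⟩
    rw [edist_nndist, ENNReal.coe_lt_coe] at this
    have h2 : (r : ℝ) < dist p q := by exact_mod_cast this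
    linarith [min_le_right c (r : ℝ)]
  exact (lt_min hS.c_pos (by exact_mod_cast hr)).trans_le hlow

/-- The distance of the branches is upper semicontinuous in time. -/
theorem SplashWindow.eventually_branchDist_lt (hS : SplashWindow k γ Ω L x x₀ ρ c C I)
    (ht : t ∈ I) {y : ℝ} (hy : branchDist C t < y) : ∀ᶠ s in 𝓝[I] t, branchDist C s < y := by
  by_contra hcon
  have hfr : ∃ᶠ s in 𝓝[I] t, y ≤ branchDist C s := by
    simpa only [not_eventually, not_lt] using hcon
  obtain ⟨U, hU, hbad⟩ := exists_ultrafilter_of_frequently hfr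
  have hne : (U : Filter ℝ) ≤ 𝓝[≠] t := by
    rw [nhdsWithin, le_inf_iff, le_principal_iff]
    refine ⟨hU.trans nhdsWithin_le_nhds, ?_⟩
    filter_upwards [hbad] with s hs
    rintro rfl
    exact absurd hy (not_lt.2 hs)
  have hB := hS.branches t ht
  obtain ⟨p, hp, q, hq, hpq⟩ := hB.exists_dist_lt hy
  obtain ⟨i, hi⟩ := mem_iUnion.1 (hB.subset 0 hp).1
  obtain ⟨i', hi'⟩ := mem_iUnion.1 (hB.subset 1 hq).1
  obtain ⟨f, hf, hfp⟩ := hS.exists_approx ht hU hi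
  obtain ⟨g, hg, hgq⟩ := hS.exists_approx ht hU hi'
  have hI : ∀ᶠ s in (U : Filter ℝ), s ∈ I := hU self_mem_nhdsWithin
  have hfC : ∀ᶠ s in (U : Filter ℝ), f s ∈ C 0 s ∨ f s ∈ C 1 s := by
    filter_upwards [hf, hI, hfp.eventually (Metric.isOpen_ball.mem_nhds (hB.subset 0 hp).2)]
      with s h1 h2 h3
    exact (hS.branches s h2).mem_or_mem_rev 0 (mem_iUnion.2 ⟨i, h1⟩) h3
  have hgC : ∀ᶠ s in (U : Filter ℝ), g s ∈ C 0 s ∨ g s ∈ C 1 s := by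
    filter_upwards [hg, hI, hgq.eventually (Metric.isOpen_ball.mem_nhds (hB.subset 1 hq).2)]
      with s h1 h2 h3
    exact (hS.branches s h2).mem_or_mem_rev 0 (mem_iUnion.2 ⟨i', h1⟩) h3
  have hlt : ∀ᶠ s in (U : Filter ℝ), dist (f s) (g s) < y :=
    (hfp.dist hgq).eventually (gt_mem_nhds hpq)
  -- Along the ultrafilter the approximations of `p` and `q` have constant labels. Different labels
  -- contradict `hbad`; equal labels would make `p` and `q` limits of the same branch.
  have key : ∀ j : Fin 2, (∀ᶠ s in (U : Filter ℝ), f s ∈ C j s) →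
      (∀ᶠ s in (U : Filter ℝ), g s ∈ C j.rev s) → False := fun j h1 h2 => by
    obtain ⟨s, h1, h2, h3, h4⟩ := (h1.and (h2.and (hlt.and hbad))).exists
    linarith [branchDist_le_rev h1 h2]
  have key' : ∀ j : Fin 2, (∀ᶠ s in (U : Filter ℝ), f s ∈ C j s) →
      (∀ᶠ s in (U : Filter ℝ), g s ∈ C j s) → False := fun j h1 h2 =>
    hS.notMem_limitSet_of_branches ht hU hne hp hq (mem_limitSet_of_tendsto h1 hfp)
      (mem_limitSet_of_tendsto h2 hgq)
  rcases Ultrafilter.eventually_or.1 hfC with h1 | h1 <;>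
    rcases Ultrafilter.eventually_or.1 hgC with h2 | h2
  · exact key' 0 h1 h2
  · exact key 0 h1 h2
  · exact key 1 h1 h2
  · exact key' 1 h1 h2

/-- Limits of points of the interface, and of the values of a function which is continuous along
the boundary curves. -/
theorem RegularAt.exists_tendsto (h : RegularAt k γ M Ω L x t) {V : Plane → Plane}
    (hV : ∀ i, Continuous fun s => V (x i t s)) {ι : Type*} (U : Ultrafilter ι) {f : ι → Plane}
    (hf : ∀ᶠ n in (U : Filter ι), f n ∈ interface Ω t) :
    ∃ z ∈ interface Ω t, Tendsto f U (𝓝 z) ∧ Tendsto (fun n => V (f n)) U (𝓝 (V z)) := by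
  have h1 : ∀ᶠ n in (U : Filter ι), ∃ i, f n ∈ frontier (Ω i t) := by
    filter_upwards [hf] with n hn using mem_iUnion.1 hn
  obtain ⟨i, hi⟩ := Ultrafilter.eventually_exists_iff.1 h1
  have hex : ∀ n, ∃ s, f n ∈ frontier (Ω i t) → s ∈ Icc 0 (L i t) ∧ x i t s = f n := fun n => by
    by_cases hn : f n ∈ frontier (Ω i t)
    · have hn' := hn
      rw [← (h.param i).range_eq] at hn'
      obtain ⟨s, hs⟩ := hn'
      obtain ⟨m, hm, hm'⟩ := (h.param i).exists_mem_Ico s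
      exact ⟨_, fun _ => ⟨Ico_subset_Icc_self hm, hm'.trans hs⟩⟩
    · exact ⟨0, fun h' => absurd h' hn⟩
  choose s hs using hex
  obtain ⟨a, -, ha⟩ := exists_tendsto_ultrafilter isCompact_Icc U (hi.mono fun n hn => (hs n hn).1)
  have heq : ∀ᶠ n in (U : Filter ι), x i t (s n) = f n := hi.mono fun n hn => (hs n hn).2
  refine ⟨x i t a, (mem_interface h).2 ⟨i, a, rfl⟩, ?_, ?_⟩
  · exact (((h.param i).continuous.tendsto a).comp ha).congr' heq
  · refine (((hV i).tendsto a).comp ha).congr' ?_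
    filter_upwards [heq] with n hn
    simp only [Function.comp_apply, hn]

/-- The branches approach each other at most with the relative velocity of their closest points. -/
theorem SplashWindow.branchDist_sub_le (hS : SplashWindow k γ Ω L x x₀ ρ c C I) (ht : t ∈ I)
    (hI : 𝓝[>] t ≤ 𝓝[I] t) {V : Plane → Plane} (hV : ∀ i, Continuous fun s => V (x i t s))
    (htr : Tendsto (fun h : ℝ => Metric.hausdorffEDist (interface Ω (t + h))
      ((fun z => z + h • V z) '' interface Ω t) / ENNReal.ofReal h) (𝓝[>] 0) (𝓝 0))
    (hc : branchDist C t < c) {Ψ : ℝ} (hΨ : 0 ≤ Ψ)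
    (hest : ∀ p ∈ C 0 t, ∀ q ∈ C 1 t, dist p q = branchDist C t → ‖V p - V q‖ ≤ Ψ)
    {η : ℝ} (hη : 0 < η) :
    ∀ᶠ s in 𝓝[>] t, branchDist C t - branchDist C s ≤ (Ψ + η) * (s - t) := by
  by_contra hcon
  have hfr : ∃ᶠ s in 𝓝[>] t, (Ψ + η) * (s - t) < branchDist C t - branchDist C s := by
    simpa only [not_eventually, not_le] using hcon
  obtain ⟨U, hUt, hbad⟩ := exists_ultrafilter_of_frequently hfr
  have hU := hUt.trans hI
  have hpos : ∀ᶠ s in (U : Filter ℝ), t < s := hUt self_mem_nhdsWithin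
  have hne : (U : Filter ℝ) ≤ 𝓝[≠] t := hUt.trans (nhdsWithin_mono _ fun s hs => ne_of_gt hs)
  have hUI : ∀ᶠ s in (U : Filter ℝ), s ∈ I := hU self_mem_nhdsWithin
  obtain ⟨M, h⟩ := hS.regularAt ht
  have hB := hS.branches t ht
  have hlim0 : Tendsto (fun s => s - t) U (𝓝[>] 0) := by
    refine tendsto_nhdsWithin_iff.2 ⟨?_, hpos.mono fun s hs => sub_pos.2 hs⟩
    have h1 : Tendsto (fun s : ℝ => s - t) (𝓝 t) (𝓝 (t - t)) :=
      (continuous_id.sub continuous_const).tendsto t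
    rw [sub_self] at h1
    exact h1.mono_left (hUt.trans nhdsWithin_le_nhds)
  have hlim : Tendsto (fun s => s - t) U (𝓝 0) := hlim0.mono_right nhdsWithin_le_nhds
  -- Budget for the slack `η * (s - t)`: an eighth for each of the two transport errors, a quarter
  -- for choosing an almost closest pair, a quarter for the change of the relative velocity.
  -- Together this is three quarters.
  have hhaus : ∀ᶠ s in (U : Filter ℝ), Metric.hausdorffEDist (interface Ω s)
      ((fun z => z + (s - t) • V z) '' interface Ω t) < ENNReal.ofReal (η / 8 * (s - t)) := by
    have h1 := (htr.comp hlim0).eventually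
      (gt_mem_nhds (ENNReal.ofReal_pos.2 (by linarith : 0 < η / 8)))
    filter_upwards [h1, hpos] with s h1 h2
    rw [Function.comp_apply, ENNReal.div_lt_iff (Or.inl (by simpa using h2))
      (Or.inl ENNReal.ofReal_ne_top), ← ENNReal.ofReal_mul (by linarith), add_sub_cancel] at h1
    exact h1
  have hex : ∀ s, ∃ p q z w : Plane, s ∈ I → t < s → (Ψ + η) * (s - t) < branchDist C t - branchDist C s →
      Metric.hausdorffEDist (interface Ω s)
        ((fun z => z + (s - t) • V z) '' interface Ω t) < ENNReal.ofReal (η / 8 * (s - t)) →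
      p ∈ C 0 s ∧ q ∈ C 1 s ∧ dist p q < branchDist C s + η / 4 * (s - t) ∧ z ∈ interface Ω t ∧
      w ∈ interface Ω t ∧ dist p (z + (s - t) • V z) < η / 8 * (s - t) ∧
      dist q (w + (s - t) • V w) < η / 8 * (s - t) := by
    intro s
    by_cases hs : s ∈ I ∧ t < s ∧ Metric.hausdorffEDist (interface Ω s)
        ((fun z => z + (s - t) • V z) '' interface Ω t) < ENNReal.ofReal (η / 8 * (s - t))
    · obtain ⟨hsI, hst, hH⟩ := hs
      have hst' : 0 < s - t := sub_pos.2 hst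
      have hBs := hS.branches s hsI
      obtain ⟨p, hp, q, hq, hpq⟩ := hBs.exists_dist_lt
        (lt_add_of_pos_right (branchDist C s) (by positivity : 0 < η / 4 * (s - t)))
      obtain ⟨_, ⟨z, hz, rfl⟩, hpz⟩ :=
        Metric.exists_edist_lt_of_hausdorffEDist_lt (hBs.subset 0 hp).1 hH
      obtain ⟨_, ⟨w, hw, rfl⟩, hqw⟩ :=
        Metric.exists_edist_lt_of_hausdorffEDist_lt (hBs.subset 1 hq).1 hH
      refine ⟨p, q, z, w, fun _ _ _ _ => ⟨hp, hq, hpq, hz, hw, ?_, ?_⟩⟩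
      · rwa [edist_dist, ENNReal.ofReal_lt_ofReal_iff (by positivity)] at hpz
      · rwa [edist_dist, ENNReal.ofReal_lt_ofReal_iff (by positivity)] at hqw
    · exact ⟨x₀, x₀, x₀, x₀, fun h1 h2 _ h4 => absurd ⟨h1, h2, h4⟩ hs⟩
  choose p q z w hpqzw using hex
  have hall : ∀ᶠ s in (U : Filter ℝ), p s ∈ C 0 s ∧ q s ∈ C 1 s ∧
      dist (p s) (q s) < branchDist C s + η / 4 * (s - t) ∧ z s ∈ interface Ω t ∧
      w s ∈ interface Ω t ∧ dist (p s) (z s + (s - t) • V (z s)) < η / 8 * (s - t) ∧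
      dist (q s) (w s + (s - t) • V (w s)) < η / 8 * (s - t) := by
    filter_upwards [hUI, hpos, hbad, hhaus] with s h1 h2 h3 h4 using hpqzw s h1 h2 h3 h4
  obtain ⟨a, haI, hza, hVa⟩ := h.exists_tendsto hV U (hall.mono fun s hs => hs.2.2.2.1)
  obtain ⟨b, hbI, hwb, hVb⟩ := h.exists_tendsto hV U (hall.mono fun s hs => hs.2.2.2.2.1)
  have hsmall : ∀ {f g : ℝ → Plane} {e : Plane}, Tendsto g U (𝓝 e) →
      (∃ v, Tendsto (fun s => V (g s)) U (𝓝 v)) →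
      (∀ᶠ s in (U : Filter ℝ), dist (f s) (g s + (s - t) • V (g s)) < η / 8 * (s - t)) →
      Tendsto f U (𝓝 e) := by
    rintro f g e hg ⟨v, hv⟩ hfg
    have h1 : Tendsto (fun s => g s + (s - t) • V (g s)) U (𝓝 e) := by
      have := hg.add (hlim.smul hv)
      rwa [zero_smul, add_zero] at this
    have h2 : Tendsto (fun s => dist (f s) (g s + (s - t) • V (g s))) U (𝓝 0) := by
      refine squeeze_zero' (Eventually.of_forall fun _ => dist_nonneg) (hfg.mono fun s hs => hs.le) ?_
      simpa using hlim.const_mul (η / 8)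
    exact (tendsto_iff_of_dist h2).2 h1
  have hpa : Tendsto p U (𝓝 a) := hsmall hza ⟨_, hVa⟩ (hall.mono fun s hs => hs.2.2.2.2.2.1)
  have hqb : Tendsto q U (𝓝 b) := hsmall hwb ⟨_, hVb⟩ (hall.mono fun s hs => hs.2.2.2.2.2.2)
  have hclose : ∀ᶠ s in (U : Filter ℝ), dist (p s) (q s) < branchDist C t := by
    filter_upwards [hall, hbad, hpos] with s h1 h2 h3
    nlinarith [h1.2.2.1, mul_pos hη (sub_pos.2 h3), mul_nonneg hΨ (sub_pos.2 h3).le]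
  have hball : ∀ᶠ s in (U : Filter ℝ), p s ∈ Metric.closedBall x₀ (ρ / 2) ∧
      q s ∈ Metric.closedBall x₀ (ρ / 2) := by
    filter_upwards [hall, hclose, hUI] with s h1 h2 h3
    have := hS.touch_only s h3 _ h1.1 _ h1.2.1 (h2.trans hc)
    exact ⟨Metric.ball_subset_closedBall this.1, Metric.ball_subset_closedBall this.2⟩
  have hρ := hS.ρ_pos
  have hsubB : Metric.closedBall x₀ (ρ / 2) ⊆ Metric.ball x₀ ρ :=
    Metric.closedBall_subset_ball (by linarith)
  have haB := hsubB (Metric.isClosed_closedBall.mem_of_tendsto hpa (hball.mono fun s hs => hs.1))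
  have hbB := hsubB (Metric.isClosed_closedBall.mem_of_tendsto hqb (hball.mono fun s hs => hs.2))
  -- The labels at time `t` may be interchanged with respect to those at the times `s`, hence the
  -- index `j`.
  obtain ⟨j, haj, hbj⟩ := hS.exists_rev_of_limitSet ht hU hne
    (mem_limitSet_of_tendsto (hall.mono fun s hs => hs.1) hpa)
    (mem_limitSet_of_tendsto (hall.mono fun s hs => hs.2.1) hqb) haI hbI haB hbB
  have hab : dist a b = branchDist C t :=
    le_antisymm (le_of_tendsto (hpa.dist hqb) (hclose.mono fun s hs => hs.le))
      (branchDist_le_rev haj hbj)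
  have hVab : ‖V a - V b‖ ≤ Ψ := by
    fin_cases j
    · exact hest a haj b hbj hab
    · rw [norm_sub_rev]; exact hest b hbj a haj (by rw [dist_comm]; exact hab)
  have hVlim : ∀ᶠ s in (U : Filter ℝ), ‖V (z s) - V (w s)‖ < Ψ + η / 4 :=
    (hVa.sub hVb).norm.eventually (gt_mem_nhds (by linarith))
  obtain ⟨s, h1, h2, h3, h4, h5, h6⟩ := (hall.and (hbad.and (hpos.and (hVlim.and
    ((hza.eventually (hB.exists_nhds h j haj)).and
      (hwb.eventually (hB.exists_nhds h j.rev hbj))))))).exists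
  obtain ⟨-, -, e1, e2, e3, e4, e5⟩ := h1
  have h7 := branchDist_le_rev (h5 e2) (h6 e3)
  have hst : 0 < s - t := sub_pos.2 h3
  have h8 : dist (z s) (w s) ≤ dist (z s + (s - t) • V (z s)) (w s + (s - t) • V (w s)) +
      (s - t) * ‖V (z s) - V (w s)‖ := by
    rw [dist_eq_norm, dist_eq_norm]
    have : z s - w s = (z s + (s - t) • V (z s) - (w s + (s - t) • V (w s))) -
        (s - t) • (V (z s) - V (w s)) := by rw [smul_sub]; abel
    rw [this]
    refine (norm_sub_le _ _).trans_eq ?_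
    rw [norm_smul, Real.norm_of_nonneg hst.le]
  have h9 := dist_triangle4 (z s + (s - t) • V (z s)) (p s) (q s) (w s + (s - t) • V (w s))
  rw [dist_comm _ (p s)] at h9
  nlinarith [mul_le_mul_of_nonneg_left h4.le hst.le, mul_pos hη hst]

end Distance

/-! ### The approach velocity of the branches -/

/-- The fraction of the regularity scale on which the branches through a pair of closest points are
single strands, where `κ` measures the simplicity of the branches. -/
noncomputable def strandFraction (β κ ρ : ℝ) : ℝ :=
  min (smallness β) (min (κ * smallness β / 8) (ρ / 8))

theorem strandFraction_pos {β κ ρ : ℝ} (hκ : 0 < κ) (hρ : 0 < ρ) : 0 < strandFraction β κ ρ := by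
  have := smallness_pos β
  exact lt_min this (lt_min (by positivity) (by positivity))

section Approach

variable {N : ℕ} {k : ℕ} {α γ M R κ ρ t : ℝ} {Ω : Fin N → ℝ → Set Plane} {x₀ : Plane}
  {L : Fin N → ℝ → ℝ} {x : Fin N → ℝ → ℝ → Plane} {C : Fin 2 → ℝ → Set Plane} {θ : Fin N → ℝ}

theorem IsArcLengthParam.exists_add_eq {Γ : Set Plane} {l : ℝ} {y : ℝ → Plane}
    (h : IsArcLengthParam Γ l y) (s r : ℝ) : ∃ u, |u| = arcDist l r s ∧ y r = y (s + u) := by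
  refine ⟨r - s - round (l⁻¹ * (r - s)) * l, (AddCircle.norm_eq l).symm, ?_⟩
  rw [← h.add_int_mul (-round (l⁻¹ * (r - s))) r]
  congr 1
  push_cast
  ring

/-- Points of a branch which are close in comparison with the regularity scale are close along the
branch. -/
theorem BranchesAt.exists_add_eq (hC : BranchesAt Ω x x₀ ρ C t) (h : RegularAt k γ M Ω L x t)
    (hκ : 0 < κ) (hR : 0 < R) (hsimple : ∀ j i s r, x i t s ∈ C j t → x i t r ∈ C j t →
      κ * min (arcDist (L i t) s r) R ≤ dist (x i t s) (x i t r)) {j : Fin 2} {i : Fin N} {s : ℝ}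
    (hs : x i t s ∈ C j t) {z : Plane} (hz : z ∈ C j t) {σ : ℝ} (hσ : σ < 1)
    (hd : dist z (x i t s) < κ * (σ * R)) : ∃ u, |u| ≤ σ * R ∧ z = x i t (s + u) := by
  obtain ⟨i', a, b, -, hj⟩ := hC.branch j
  have hz' := hz
  rw [hj] at hz'
  obtain ⟨r, -, rfl⟩ := hz'
  have hs' := hs
  rw [hj] at hs'
  obtain ⟨r', -, hr'⟩ := hs'
  have hii : i = i' :=
    mem_of_eq_of_mem_frontier h ((h.param i).mem s) (hr' ▸ (h.param i').mem r')
  subst hii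
  obtain ⟨u, hu, hur⟩ := (h.param i).exists_add_eq s r
  refine ⟨u, ?_, hur⟩
  have h1 := (hsimple j i r s hz hs).trans_lt hd
  have h2 : min (arcDist (L i t) r s) R < σ * R := lt_of_mul_lt_mul_left h1 hκ.le
  rcases min_lt_iff.1 h2 with h3 | h3
  · rw [hu]; exact h3.le
  · nlinarith

/-- The relative velocity of a closest pair of points of the two branches. -/
theorem BranchesAt.norm_velocity_sub_le (hC : BranchesAt Ω x x₀ ρ C t)
    (h : RegularAt k γ M Ω L x t) (hk : k = 1 ∨ k = 2)
    (hα : 0 < α) (hγ0 : 0 < γ) (hγ1 : γ ≤ 1) (hαγ : 1 + 2 * α ≤ k + γ) (hR : 0 < R) (hR1 : R ≤ 1)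
    (hMR : M * R ^ (k + γ - 1) ≤ 1) (hM : 0 ≤ M) {V : Plane → Plane}
    (hV : ∀ i s, IsNormalVelocity α (vorticity θ Ω t) (x i t s) (perp (deriv (x i t) s))
      (V (x i t s))) (hκ : 0 < κ) (hρ : 0 < ρ)
    (hsimple : ∀ j i s r, x i t s ∈ C j t → x i t r ∈ C j t →
      κ * min (arcDist (L i t) s r) R ≤ dist (x i t s) (x i t r)) {p q : Plane}
    (hp : p ∈ C 0 t) (hq : q ∈ C 1 t) (hpB : p ∈ Metric.ball x₀ (ρ / 2))
    (hqB : q ∈ Metric.ball x₀ (ρ / 2)) (hpq : dist p q = branchDist C t)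
    (hd0 : 0 < branchDist C t) (hd1 : branchDist C t < 1) :
    ‖V p - V q‖ ≤ velocityConst (2 + 2 * α) * (∑ i, |θ i|) *
      ((strandFraction (k + γ) κ ρ * R) ^ (-(2 * α)) +
        24 * M * (strandFraction (k + γ) κ ρ * R) ^ (k + γ - 1 - 2 * α)) *
      (branchDist C t * (1 - Real.log (branchDist C t))) := by
  obtain ⟨i, s₁, rfl⟩ := (mem_interface h).1 (hC.subset 0 hp).1
  obtain ⟨j, s₂, rfl⟩ := (mem_interface h).1 (hC.subset 1 hq).1
  set β : ℝ := k + γ with hβ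
  set f := strandFraction β κ ρ with hf
  have hf0 : 0 < f := strandFraction_pos hκ hρ
  have hs0 := smallness_pos β
  have hs1 : smallness β ≤ 1 / 12 := min_le_left _ _
  have f1 : f ≤ smallness β := min_le_left _ _
  have f2 : f ≤ κ * smallness β / 8 := (min_le_right _ _).trans (min_le_left _ _)
  have f3 : f ≤ ρ / 8 := (min_le_right _ _).trans (min_le_right _ _)
  have r1 : f * R ≤ smallness β * R := mul_le_mul_of_nonneg_right f1 hR.le
  -- The factor `8` is twice `4`: a point of one branch within `4 * r` of the closest point on the
  -- other branch is within `8 * r` of the closest point on its own, because the distance of the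
  -- pair is minimal.
  have r2 : 8 * (f * R) ≤ κ * (smallness β * R) := by
    have := mul_le_mul_of_nonneg_right f2 hR.le
    linarith
  have r3 : f * R ≤ ρ / 8 := (mul_le_of_le_one_right hf0.le hR1).trans f3
  have hr0 : 0 < f * R := mul_pos hf0 hR
  have n1 : ∀ᶠ u in 𝓝 (0:ℝ), x i t (s₁ + u) ∈ C 0 t := by
    have hc : Tendsto (fun u => x i t (s₁ + u)) (𝓝 0) (𝓝 (x i t s₁)) := by
      have := ((h.param i).continuous.comp (continuous_const.add continuous_id)).tendsto (0:ℝ)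
        (f := fun u => x i t (s₁ + u))
      simpa using this
    filter_upwards [hc.eventually (hC.exists_nhds h 0 hp)] with u hu
    exact hu ((mem_interface h).2 ⟨i, _, rfl⟩)
  have n2 : ∀ᶠ u in 𝓝 (0:ℝ), x j t (s₂ + u) ∈ C 1 t := by
    have hc : Tendsto (fun u => x j t (s₂ + u)) (𝓝 0) (𝓝 (x j t s₂)) := by
      have := ((h.param j).continuous.comp (continuous_const.add continuous_id)).tendsto (0:ℝ)
        (f := fun u => x j t (s₂ + u))
      simpa using this
    filter_upwards [hc.eventually (hC.exists_nhds h 1 hq)] with u hu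
    exact hu ((mem_interface h).2 ⟨j, _, rfl⟩)
  obtain ⟨δ, hδ, hball⟩ := Metric.eventually_nhds_iff.1 (n1.and n2)
  simp only [Real.dist_0_eq_abs] at hball
  refine h.norm_velocity_sub_le hk hα hγ0 hγ1 hαγ hR hMR hM hV hpq hd0 hd1 hδ
    (fun u v hu hv => branchDist_le (hball hu).1 (hball hv).2) hr0 (by nlinarith) r1 ?_
  intro z hz hzd
  have hzB : z ∈ Metric.ball x₀ ρ := by
    rw [Metric.mem_ball] at hpB hqB ⊢
    rcases hzd with h1 | h1
    · linarith [dist_triangle z (x i t s₁) x₀]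
    · linarith [dist_triangle z (x j t s₂) x₀]
  have hσ : smallness β < 1 := by linarith
  rcases hC.mem_or_mem_rev 0 hz hzB with hz0 | hz1
  · left
    refine hC.exists_add_eq h hκ hR hsimple hp hz0 hσ ?_
    rcases hzd with h1 | h1
    · linarith
    · have := branchDist_le hz0 hq
      have := dist_triangle z (x j t s₂) (x i t s₁)
      rw [dist_comm (x j t s₂)] at this
      linarith
  · right
    refine hC.exists_add_eq h hκ hR hsimple hq hz1 hσ ?_
    rcases hzd with h1 | h1
    · have := branchDist_le hp hz1
      rw [dist_comm] at this
      have := dist_triangle z (x i t s₁) (x j t s₂)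
      linarith
    · linarith

/-- The growth rate of the logarithm of the distance of the branches, in terms of the norm of the
interface. -/
theorem strand_rate_le {β M f : ℝ} (hα : 0 < α) (hk : 1 ≤ k) (hβ1 : 0 < β - 1)
    (hM : 1 ≤ M) (hf : 0 < f) :
    (f * M ^ (-(1 / (β - 1)))) ^ (-(2 * α)) +
      24 * M * (f * M ^ (-(1 / (β - 1)))) ^ (β - 1 - 2 * α) ≤
    (f ^ (-(2 * α)) + 24 * f ^ (β - 1 - 2 * α)) * M ^ ((k + 2 * α - 1) / (β - 1)) := by
  have hM0 : 0 < M := by linarith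
  have hb := hβ1.ne'
  have e1 : (M ^ (-(1 / (β - 1)))) ^ (-(2 * α)) = M ^ (2 * α / (β - 1)) := by
    rw [← Real.rpow_mul hM0.le]; congr 1; field_simp
  have e2 : M * (M ^ (-(1 / (β - 1)))) ^ (β - 1 - 2 * α) = M ^ (2 * α / (β - 1)) := by
    rw [← Real.rpow_mul hM0.le]
    nth_rewrite 1 [← Real.rpow_one M]
    rw [← Real.rpow_add hM0]; congr 1; field_simp; ring
  -- The two exponents agree for `k = 1`; for `k = 2` the estimate has room to spare.
  have hle : M ^ (2 * α / (β - 1)) ≤ M ^ ((k + 2 * α - 1) / (β - 1)) := by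
    refine Real.rpow_le_rpow_of_exponent_le hM ?_
    have : (1:ℝ) ≤ k := by exact_mod_cast hk
    gcongr
    linarith
  have hg : 0 ≤ M ^ (-(1 / (β - 1))) := Real.rpow_nonneg hM0.le _
  rw [Real.mul_rpow hf.le hg, Real.mul_rpow hf.le hg, e1]
  calc f ^ (-(2 * α)) * M ^ (2 * α / (β - 1)) +
        24 * M * (f ^ (β - 1 - 2 * α) * (M ^ (-(1 / (β - 1)))) ^ (β - 1 - 2 * α))
      = (f ^ (-(2 * α)) + 24 * f ^ (β - 1 - 2 * α)) * M ^ (2 * α / (β - 1)) := by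
        rw [← e2]; ring
    _ ≤ _ := mul_le_mul_of_nonneg_left hle (by positivity)

end Approach

/-! ### Splash singularities -/

section Splash

variable {N : ℕ} {k : ℕ} {α γ T ρ ε t : ℝ} {Ω : Fin N → ℝ → Set Plane} {x₀ : Plane}
  {L : Fin N → ℝ → ℝ} {x : Fin N → ℝ → ℝ → Plane} {C : Fin 2 → ℝ → Set Plane} {θ : Fin N → ℝ}

theorem eq_one_or_two_of_ceil (hα₀ : 0 < α) (hα₁ : α < 1) (hk : k = ⌈2 * α⌉₊) : k = 1 ∨ k = 2 := by
  have h1 : 0 < ⌈2 * α⌉₊ := Nat.ceil_pos.2 (by linarith)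
  have h2 : ⌈2 * α⌉₊ ≤ 2 := Nat.ceil_le.2 (by push_cast; linarith)
  omega

theorem exponent_pos_of_ceil (hα₀ : 0 < α) (hk : k = ⌈2 * α⌉₊) (hγ₀ : 2 * α - k + 1 ≤ γ) :
    0 < γ := by
  have := Nat.ceil_lt_add_one (by linarith : 0 ≤ 2 * α)
  rw [← hk] at this
  linarith

theorem IsPatchSolution.regularAt (hsol : IsPatchSolution α k γ T θ Ω L x) (ht : t ∈ Ico 0 T)
    (hγ : 0 < γ) {M : ℝ} (hM : 0 ≤ M) (h : interfaceNorm k γ x t ≤ ENNReal.ofReal M) :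
    RegularAt k γ M Ω L x t where
  isOpen i := hsol.isOpen i t ht
  isBounded i := hsol.isBounded i t ht
  param i := hsol.param i t ht
  disjoint := hsol.disjoint t ht
  holder i := by
    have hb := holderNorm_bounds hγ ((le_iSup (fun i => holderNorm k γ (x i t)) i).trans h) hM
    exact ⟨hsol.contDiff i t ht, (hsol.param i t ht).unit_speed, hb.1, hb.2⟩

theorem IsPatchSolution.interfaceNorm_ne_top (hsol : IsPatchSolution α k γ T θ Ω L x)
    (ht : t ∈ Ico 0 T) : interfaceNorm k γ x t ≠ ∞ := by
  obtain ⟨M, hM⟩ := hsol.locally_bounded t ht.2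
  exact ne_top_of_le_ne_top ENNReal.coe_ne_top (hM t ⟨ht.1, le_rfl⟩)

theorem one_le_interfaceNorm (hk : 1 ≤ k) {i : Fin N} (h : ‖deriv (x i t) 0‖ = 1) :
    1 ≤ interfaceNorm k γ x t := by
  refine le_trans ?_ (le_iSup (fun i => holderNorm k γ (x i t)) i)
  refine le_trans ?_ le_self_add
  refine le_trans ?_ (Finset.single_le_sum (f := fun l => ⨆ s, ‖iteratedDeriv l (x i t) s‖ₑ)
    (fun _ _ => zero_le) (Finset.mem_range.2 (Nat.lt_succ_of_le hk)))
  refine le_trans ?_ (le_iSup (fun s => ‖iteratedDeriv 1 (x i t) s‖ₑ) 0)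
  rw [iteratedDeriv_one, ← ofReal_norm, h, ENNReal.ofReal_one]

theorem IsSplashAt.branchesAt (hs : IsSplashAt k γ T Ω L x x₀ ρ ε C) (ht : t ∈ Ico (T - ε) T) :
    BranchesAt Ω x x₀ ρ C t :=
  ⟨hs.branch t ht, hs.branch_disjoint t ht, hs.branch_union t ht⟩

theorem IsSplashAt.mem_Ico (hs : IsSplashAt k γ T Ω L x x₀ ρ ε C) (ht : t ∈ Ico (T - ε) T) :
    t ∈ Ico 0 T := ⟨by linarith [ht.1, hs.ε_le], ht.2⟩

theorem IsSplashAt.one_le_interfaceNorm (hs : IsSplashAt k γ T Ω L x x₀ ρ ε C)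
    (hsol : IsPatchSolution α k γ T θ Ω L x) (hk : 1 ≤ k) (ht : t ∈ Ico (T - ε) T) :
    1 ≤ interfaceNorm k γ x t := by
  obtain ⟨i, -⟩ := hs.branch t ht 0
  exact SQGPatch.one_le_interfaceNorm hk ((hsol.param i t (hs.mem_Ico ht)).unit_speed 0)

theorem BranchesAt.branchDist_le_infDist_add (hC : BranchesAt Ω x x₀ ρ C t) (a : Plane) :
    branchDist C t ≤ Metric.infDist a (C 0 t) + Metric.infDist a (C 1 t) := by
  refine le_of_forall_pos_lt_add fun η hη => ?_
  obtain ⟨p, hp, h1⟩ := (Metric.infDist_lt_iff (hC.nonempty 0)).1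
    (lt_add_of_pos_right (Metric.infDist a (C 0 t)) (half_pos hη))
  obtain ⟨q, hq, h2⟩ := (Metric.infDist_lt_iff (hC.nonempty 1)).1
    (lt_add_of_pos_right (Metric.infDist a (C 1 t)) (half_pos hη))
  have := branchDist_le hp hq
  have := dist_triangle_left p q a
  linarith

theorem IsSplashAt.tendsto_branchDist (hs : IsSplashAt k γ T Ω L x x₀ ρ ε C) :
    Tendsto (branchDist C) (𝓝[<] T) (𝓝 0) := by
  have hI : ∀ᶠ t in 𝓝[<] T, t ∈ Ico (T - ε) T :=
    mem_of_superset (Ioo_mem_nhdsLT (by linarith [hs.ε_pos])) Ioo_subset_Ico_self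
  refine squeeze_zero' (hI.mono fun t _ => ?_)
    (hI.mono fun t ht => (hs.branchesAt ht).branchDist_le_infDist_add x₀) ?_
  · refine Real.sInf_nonneg ?_
    rintro _ ⟨p, -, q, -, rfl⟩
    exact dist_nonneg
  · simpa using (hs.touch 0).add (hs.touch 1)

/-- Shortly before the splash, the branches are close to each other. -/
theorem IsSplashAt.exists_splashWindow (hs : IsSplashAt k γ T Ω L x x₀ ρ ε C)
    (hsol : IsPatchSolution α k γ T θ Ω L x) (hk : k = 1 ∨ k = 2) (hγ0 : 0 < γ) (hγ1 : γ ≤ 1) :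
    ∃ t₀ ∈ Ico (T - ε) T, ∃ c, SplashWindow k γ Ω L x x₀ ρ c C (Ico t₀ T) ∧
      ∀ t ∈ Ico t₀ T, branchDist C t < c ∧ branchDist C t < 1 := by
  have hρ := hs.ρ_pos
  obtain ⟨c, hc, htouch⟩ := hs.touch_only (ρ / 2) (by linarith)
  have hev : ∀ᶠ t in 𝓝[<] T, T - ε < t ∧ (branchDist C t < c ∧ branchDist C t < 1) ∧
      ∀ j, Metric.infDist x₀ (C j t) < ρ / 2 := by
    refine Eventually.and ?_ (Eventually.and ?_ (eventually_all.2 fun j => ?_))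
    · filter_upwards [Ioo_mem_nhdsLT (by linarith [hs.ε_pos] : T - ε < T)] with t ht using ht.1
    · exact (hs.tendsto_branchDist.eventually (gt_mem_nhds hc)).and
        (hs.tendsto_branchDist.eventually (gt_mem_nhds one_pos))
    · exact (hs.touch j).eventually (gt_mem_nhds (by linarith))
  obtain ⟨l, hl, hlT⟩ := mem_nhdsLT_iff_exists_Ioo_subset.1 hev
  have hl' : l < T := hl
  have hmem : ∀ t ∈ Ico ((l + T) / 2) T, t ∈ Ioo l T := fun t ht => ⟨by linarith [ht.1], ht.2⟩
  have hsub : ∀ t ∈ Ico ((l + T) / 2) T, t ∈ Ico (T - ε) T := fun t ht =>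
    ⟨(hlT (hmem t ht)).1.le, ht.2⟩
  have hsub0 : Ico ((l + T) / 2) T ⊆ Ico 0 T := fun t ht => hs.mem_Ico (hsub t ht)
  refine ⟨(l + T) / 2, hsub _ ⟨le_rfl, by linarith⟩, c, ?_, fun t ht => (hlT (hmem t ht)).2.1⟩
  refine ⟨hk, hγ0, hγ1, hρ, hc, fun t ht => ?_, fun i t ht => ?_, fun t ht => hs.branchesAt (hsub t ht),
    fun t ht => htouch t (hsub t ht), fun t ht j => ?_⟩
  · obtain ⟨M, hM⟩ := hsol.locally_bounded ((t + T) / 2) (by linarith [ht.2])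
    refine ⟨M, ?_⟩
    filter_upwards [self_mem_nhdsWithin,
      nhdsWithin_le_nhds (gt_mem_nhds (by linarith [ht.2] : t < (t + T) / 2))] with t' h1 h2
    refine hsol.regularAt (hsub0 h1) hγ0 M.2 ?_
    rw [ENNReal.ofReal_coe_nnreal]
    exact hM t' ⟨(hsub0 h1).1, h2.le⟩
  · exact (hsol.continuous i t (hsub0 ht)).mono_left (nhdsWithin_mono _ hsub0)
  · obtain ⟨z, hz, hd⟩ := (Metric.infDist_lt_iff ((hs.branchesAt (hsub t ht)).nonempty j)).1
      ((hlT (hmem t ht)).2.2 j)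
    exact ⟨z, hz, by rwa [Metric.mem_ball, dist_comm]⟩

/-- The blow-up criterion on a time interval before the splash. -/
theorem IsSplashAt.exists_lintegral_eq_top (hs : IsSplashAt k γ T Ω L x x₀ ρ ε C)
    (hsol : IsPatchSolution α k γ T θ Ω L x) (hk : k = 1 ∨ k = 2) (hα : 0 < α)
    (hγ0 : 0 < γ) (hγ1 : γ ≤ 1) (hαγ : 1 + 2 * α ≤ k + γ) :
    ∃ t₀ ∈ Ico (T - ε) T,
      ∫⁻ t in Ico t₀ T, interfaceNorm k γ x t ^ ((k + 2 * α - 1) / (k + γ - 1)) = ∞ := by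
  obtain ⟨t₀, ht₀, c, hS, hclose⟩ := hs.exists_splashWindow hsol hk hγ0 hγ1
  obtain ⟨κ, hκ, hsimple⟩ := hs.branch_simple
  refine ⟨t₀, ht₀, ?_⟩
  have hsub : Ico t₀ T ⊆ Ico (T - ε) T := Ico_subset_Ico_left ht₀.1
  have hk1 : 1 ≤ k := by omega
  have hβ1 : (0:ℝ) < k + γ - 1 := by linarith
  have hβne := hβ1.ne'
  set e : ℝ := (k + 2 * α - 1) / (k + γ - 1) with he
  set M : ℝ → ℝ := fun t => (interfaceNorm k γ x t).toReal with hM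
  have htop : ∀ t ∈ Ico t₀ T, interfaceNorm k γ x t ≠ ∞ := fun t ht =>
    hsol.interfaceNorm_ne_top (hs.mem_Ico (hsub ht))
  have hM1 : ∀ t ∈ Ico t₀ T, 1 ≤ M t := fun t ht => by
    have := (ENNReal.toReal_le_toReal ENNReal.one_ne_top (htop t ht)).2
      (hs.one_le_interfaceNorm hsol hk1 (hsub ht))
    rwa [ENNReal.toReal_one] at this
  have he0 : 0 ≤ e := by
    have : (1:ℝ) ≤ k := by exact_mod_cast hk1
    exact div_nonneg (by linarith) hβ1.le
  set f := strandFraction (k + γ) κ ρ with hf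
  have hf0 : 0 < f := strandFraction_pos hκ hs.ρ_pos
  set A : ℝ := velocityConst (2 + 2 * α) * (∑ i, |θ i|) *
    (f ^ (-(2 * α)) + 24 * f ^ (k + γ - 1 - 2 * α)) with hA
  have hv := velocityConst_nonneg (by linarith : 0 < 2 + 2 * α)
  have hθ : 0 ≤ ∑ i, |θ i| := Finset.sum_nonneg fun _ _ => abs_nonneg _
  have hA0 : 0 ≤ A := by positivity
  have hpos : ∀ t ∈ Ico t₀ T, 0 < branchDist C t := fun t ht => hS.branchDist_pos ht
  have hlog : ∀ t ∈ Ico t₀ T, 0 ≤ branchDist C t * (1 - Real.log (branchDist C t)) := fun t ht => by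
    have := Real.log_neg (hpos t ht) (hclose t ht).2
    exact mul_nonneg (hpos t ht).le (by linarith)
  have hmain : ∫⁻ t in Ico t₀ T, ENNReal.ofReal (A * M t ^ e) = ∞ := by
    refine lintegral_eq_top_of_tendsto_zero ht₀.2 (d := branchDist C)
      (fun t ht => ⟨hpos t ht, (hclose t ht).2⟩)
      (fun t ht y hy => hS.eventually_branchDist_lt ht hy) ?_ hs.tendsto_branchDist ?_
    · intro t ht η hη
      have hI : 𝓝[>] t ≤ 𝓝[Ico t₀ T] t := nhdsWithin_le_of_mem
        (mem_of_superset (Ioo_mem_nhdsGT ht.2) fun s hs => ⟨ht.1.trans hs.1.le, hs.2⟩)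
      have hM0 : 0 < M t := one_pos.trans_le (hM1 t ht)
      have hreg : RegularAt k γ (M t) Ω L x t := hsol.regularAt (hs.mem_Ico (hsub ht)) hγ0 hM0.le
        (by rw [hM, ENNReal.ofReal_toReal (htop t ht)])
      set R := M t ^ (-(1 / (k + γ - 1))) with hR
      have hR0 : 0 < R := Real.rpow_pos_of_pos hM0 _
      have hR1 : R ≤ 1 := Real.rpow_le_one_of_one_le_of_nonpos (hM1 t ht)
        (neg_nonpos.2 (by positivity))
      have hMR : M t * R ^ (k + γ - 1) ≤ 1 := by
        rw [hR, ← Real.rpow_mul hM0.le, neg_mul, one_div_mul_cancel hβne, Real.rpow_neg_one,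
          mul_inv_cancel₀ hM0.ne']
      obtain ⟨V, hV, htr⟩ := hsol.transport t (hs.mem_Ico (hsub ht))
      have hVc : ∀ i, Continuous fun s => V (x i t s) := fun i =>
        hreg.continuous_velocity hk hα hγ0 hγ1 hαγ hR0 hMR hM0.le i (hV i)
      refine hS.branchDist_sub_le ht hI hVc htr (hclose t ht).1
        (mul_nonneg (by positivity) (hlog t ht)) ?_ hη
      intro p hp q hq hpq
      obtain ⟨hpB, hqB⟩ := hS.touch_only t ht p hp q hq (hpq.trans_lt (hclose t ht).1)
      refine ((hS.branches t ht).norm_velocity_sub_le hreg hk hα hγ0 hγ1 hαγ hR0 hR1 hMR hM0.le hV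
        hκ hs.ρ_pos (hsimple t (hsub ht)) hp hq hpB hqB hpq (hpos t ht) (hclose t ht).2).trans ?_
      refine mul_le_mul_of_nonneg_right ?_ (hlog t ht)
      rw [hA, mul_assoc _ _ (M t ^ e)]
      exact mul_le_mul_of_nonneg_left (strand_rate_le hα hk1 hβ1 (hM1 t ht) hf0)
        (mul_nonneg hv hθ)
    · intro T' hT'
      obtain ⟨K, hK⟩ := hsol.locally_bounded T' hT'
      refine ⟨A * (K : ℝ) ^ e, fun t ht => mul_le_mul_of_nonneg_left ?_ hA0⟩
      have ht' : t ∈ Ico t₀ T := ⟨ht.1, ht.2.trans_lt hT'⟩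
      refine Real.rpow_le_rpow ENNReal.toReal_nonneg ?_ he0
      exact ENNReal.toReal_le_coe_of_le_coe (hK t ⟨(hs.mem_Ico (hsub ht')).1, ht.2⟩)
  have heq : ∫⁻ t in Ico t₀ T, ENNReal.ofReal (A * M t ^ e) =
      ENNReal.ofReal A * ∫⁻ t in Ico t₀ T, interfaceNorm k γ x t ^ e := by
    rw [← lintegral_const_mul' _ _ ENNReal.ofReal_ne_top]
    refine setLIntegral_congr_fun measurableSet_Ico fun t ht => ?_
    rw [ENNReal.ofReal_mul hA0, ← ENNReal.ofReal_rpow_of_nonneg ENNReal.toReal_nonneg he0,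
      ENNReal.ofReal_toReal (htop t ht)]
  rw [heq, ENNReal.mul_eq_top] at hmain
  exact (hmain.resolve_right fun h => ENNReal.ofReal_ne_top h.1).2

/-! ### The curvature criterion -/

/-- The `C^{1,γ}` norm of a curve of bounded size is controlled by its curvature. -/
theorem holderNorm_one_le {y : ℝ → Plane} {A : ℝ} (hγ0 : 0 < γ) (hγ1 : γ ≤ 1)
    (hA : ∀ s, ‖y s‖ ≤ A) (hy : ∀ s, ‖deriv y s‖ = 1) :
    holderNorm 1 γ y ≤ ENNReal.ofReal A + 3 + maxCurvature y := by
  have he : ∀ s, ‖deriv y s‖ₑ = 1 := fun s => by rw [← ofReal_norm, hy, ENNReal.ofReal_one]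
  have h0 : (⨆ s, ‖iteratedDeriv 0 y s‖ₑ) ≤ ENNReal.ofReal A := iSup_le fun s => by
    rw [iteratedDeriv_zero, ← ofReal_norm]; exact ENNReal.ofReal_le_ofReal (hA s)
  have h1 : (⨆ s, ‖iteratedDeriv 1 y s‖ₑ) ≤ 1 := iSup_le fun s => by
    rw [iteratedDeriv_one, he]
  have h2 : (⨆ s, ⨆ r, ‖iteratedDeriv 1 y s - iteratedDeriv 1 y r‖ₑ /
      ENNReal.ofReal (|s - r| ^ γ)) ≤ 2 + maxCurvature y := iSup₂_le fun s r => by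
    rw [iteratedDeriv_one]
    rcases eq_or_ne s r with rfl | hsr
    · simp
    have hpos : 0 < |s - r| := abs_pos.2 (sub_ne_zero.2 hsr)
    -- At distance at least `1` it suffices that unit tangents differ by at most `2`; at shorter
    -- distance `|s - r| ≤ |s - r| ^ γ`.
    rcases le_total 1 |s - r| with h | h
    · refine le_trans ?_ le_self_add
      refine ENNReal.div_le_of_le_mul ?_
      have h3 : (1 : ℝ≥0∞) ≤ ENNReal.ofReal (|s - r| ^ γ) :=
        ENNReal.one_le_ofReal.2 (Real.one_le_rpow h hγ0.le)
      calc ‖deriv y s - deriv y r‖ₑ ≤ ‖deriv y s‖ₑ + ‖deriv y r‖ₑ := enorm_sub_le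
        _ = 2 * 1 := by rw [he, he]; norm_num
        _ ≤ _ := by gcongr
    · refine le_trans ?_ le_add_self
      refine le_trans ?_ (le_iSup₂ (f := fun s r => ‖deriv y s - deriv y r‖ₑ /
        ENNReal.ofReal |s - r|) s r)
      refine ENNReal.div_le_div_left (ENNReal.ofReal_le_ofReal ?_) _
      nth_rewrite 1 [← Real.rpow_one |s - r|]
      exact Real.rpow_le_rpow_of_exponent_ge hpos h hγ1
  rw [holderNorm, Finset.sum_range_succ, Finset.sum_range_one]
  calc _ ≤ ENNReal.ofReal A + 1 + (2 + maxCurvature y) := by gcongr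
    _ = _ := by rw [← add_assoc, add_assoc (ENNReal.ofReal A) 1 2]; norm_num

/-- Positions are bounded by `‖x₀‖ + ρ` in the ball and by `bounded_outside` elsewhere, and tangents
have length one. Only the Hölder seminorm is left for the curvature to control. -/
theorem IsSplashAt.exists_interfaceNorm_le (hs : IsSplashAt 1 γ T Ω L x x₀ ρ ε C)
    (hsol : IsPatchSolution α 1 γ T θ Ω L x) (hγ0 : 0 < γ) (hγ1 : γ ≤ 1) :
    ∃ A : ℝ, ∀ t ∈ Ico (T - ε) T,
      interfaceNorm 1 γ x t ≤ ENNReal.ofReal A + 3 + ⨆ i, maxCurvature (x i t) := by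
  obtain ⟨M, hM⟩ := hs.bounded_outside
  refine ⟨max M (‖x₀‖ + ρ), fun t ht => iSup_le fun i => ?_⟩
  refine (holderNorm_one_le hγ0 hγ1 (A := max M (‖x₀‖ + ρ)) (fun s => ?_)
    (hsol.param i t (hs.mem_Ico ht)).unit_speed).trans ?_
  · by_cases hB : x i t s ∈ Metric.ball x₀ ρ
    · refine le_max_of_le_right ?_
      have h1 : ‖x i t s - x₀‖ < ρ := mem_ball_iff_norm.1 hB
      have h2 := norm_add_le x₀ (x i t s - x₀)
      rw [add_sub_cancel] at h2
      linarith
    · have := (hM t ht i).1 0 (by norm_num) s hB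
      rw [iteratedDeriv_zero] at this
      exact this.trans (le_max_left _ _)
  · gcongr
    exact le_iSup (fun i => maxCurvature (x i t)) i

/-- For `k = 1` the exponent is `2α / γ ≤ 1` and the norm is at least `1`, so the power is at most
the norm. The additive constant has a finite integral over a bounded interval. -/
theorem IsSplashAt.lintegral_maxCurvature_eq_top (hs : IsSplashAt 1 γ T Ω L x x₀ ρ ε C)
    (hsol : IsPatchSolution α 1 γ T θ Ω L x) (hα : 0 < α) (hγ0 : 2 * α ≤ γ) (hγ1 : γ ≤ 1) :
    ∫⁻ t in Ico 0 T, ⨆ i, maxCurvature (x i t) = ∞ := by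
  have hγ : 0 < γ := by linarith
  obtain ⟨t₀, ht₀, h⟩ := hs.exists_lintegral_eq_top hsol (Or.inl rfl) hα hγ hγ1
    (by push_cast; linarith)
  obtain ⟨A, hA⟩ := hs.exists_interfaceNorm_le hsol hγ hγ1
  have hsub : Ico t₀ T ⊆ Ico (T - ε) T := Ico_subset_Ico_left ht₀.1
  have hle : ∀ t ∈ Ico t₀ T, interfaceNorm 1 γ x t ^ (((1 : ℕ) + 2 * α - 1) / ((1 : ℕ) + γ - 1)) ≤
      ENNReal.ofReal A + 3 + ⨆ i, maxCurvature (x i t) := fun t ht => by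
    refine le_trans ?_ (hA t (hsub ht))
    nth_rewrite 2 [← ENNReal.rpow_one (interfaceNorm 1 γ x t)]
    refine ENNReal.rpow_le_rpow_of_exponent_le (hs.one_le_interfaceNorm hsol le_rfl (hsub ht)) ?_
    push_cast
    rw [div_le_one (by linarith)]
    linarith
  have h1 := setLIntegral_mono' (μ := volume) measurableSet_Ico hle
  rw [h, top_le_iff, lintegral_add_left measurable_const, ENNReal.add_eq_top] at h1
  have h2 : ∫⁻ _ in Ico t₀ T, (ENNReal.ofReal A + 3) ≠ ∞ := by
    rw [setLIntegral_const, Real.volume_Ico]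
    exact ENNReal.mul_ne_top (ENNReal.add_ne_top.2 ⟨ENNReal.ofReal_ne_top, by norm_num⟩)
      ENNReal.ofReal_ne_top
  refine top_le_iff.1 ((h1.resolve_left h2).symm.le.trans ?_)
  exact lintegral_mono_set fun t ht => hs.mem_Ico (hsub ht)

end Splash

end SQGPatch

/-! ### The theorem -/

theorem theorem1 (α γ T : ℝ) (k : ℕ) (hα₀ : 0 < α) (hα₁ : α < 1) (hk : k = ⌈2 * α⌉₊)
    (hγ₀ : 2 * α - k + 1 ≤ γ) (hγ₁ : γ ≤ 1)
    (N : ℕ) (θ : Fin N → ℝ) (Ω : Fin N → ℝ → Set SQGPatch.Plane)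
    (L : Fin N → ℝ → ℝ) (x : Fin N → ℝ → ℝ → SQGPatch.Plane)
    (hsol : SQGPatch.IsPatchSolution α k γ T θ Ω L x)
    (hsplash : SQGPatch.FormsSplash k γ T Ω L x) :
    (∫⁻ t in Ico 0 T, SQGPatch.interfaceNorm k γ x t ^ ((k + 2 * α - 1) / (k + γ - 1)) = ∞) ∧
    (α ≤ 1 / 2 → ∫⁻ t in Ico 0 T, ⨆ i, SQGPatch.maxCurvature (x i t) = ∞) ∧
    (α = 1 / 2 → ∫⁻ t in Ico 0 T, SQGPatch.interfaceNorm 1 1 x t = ∞) := by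
  obtain ⟨x₀, ρ, ε, C, hs⟩ := hsplash
  have hk12 := SQGPatch.eq_one_or_two_of_ceil hα₀ hα₁ hk
  have hγ := SQGPatch.exponent_pos_of_ceil hα₀ hk hγ₀
  have hmain : ∫⁻ t in Ico 0 T,
      SQGPatch.interfaceNorm k γ x t ^ ((k + 2 * α - 1) / (k + γ - 1)) = ∞ := by
    obtain ⟨t₀, ht₀, h⟩ := hs.exists_lintegral_eq_top hsol hk12 hα₀ hγ hγ₁ (by linarith)
    refine top_le_iff.1 (h.symm.le.trans (lintegral_mono_set fun t ht => ?_))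
    exact hs.mem_Ico ⟨ht₀.1.trans ht.1, ht.2⟩
  have hone : α ≤ 1 / 2 → k = 1 := fun h => by
    have : ⌈2 * α⌉₊ ≤ 1 := Nat.ceil_le.2 (by push_cast; linarith)
    omega
  refine ⟨hmain, fun h => ?_, fun h => ?_⟩
  · obtain rfl := hone h
    exact hs.lintegral_maxCurvature_eq_top hsol hα₀ (by push_cast at hγ₀; linarith) hγ₁
  · obtain rfl := hone h.le
    -- For `2α = 1` and `k = 1` the lower bound on `γ` equals the upper bound `1`, and the exponent
    -- becomes `1`.
    obtain rfl : γ = 1 := le_antisymm hγ₁ (by push_cast at hγ₀; linarith)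
    subst h
    norm_num at hmain
    exact hmain
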